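/- **Setting.** Let $(x^1,x^2,x^3,x^4)=(\xi^1,\xi^2,\underline u,u)$ and $\xi=\xi^1+i\xi^2$. Fields are written $\Phi=(e,\gamma,w)\in\mathbb C^5\oplus\mathbb C^8\oplus\mathbb C^5$, and $\mathcal R$ is the real subspace on which $e_3,e_4,e_5,\gamma_2,\gamma_6$ are real. Given $\Phi$, put $$D=e_1\partial_{\xi^1}+e_2\partial_{\xi^2},\quad \overline D=\overline e_1\partial_{\xi^1}+\overline e_2\partial_{\xi^2},\quad N=e_4\partial_{\xi^1}+e_5\partial_{\xi^2}+\partial_u,\quad L=e_3\partial_{\underline u}.$$ *The system (SHS)*, with weights $\lambda_1,\dots,\lambda_4$, is $\mathbf A(\Phi)\Phi=\mathbf f(\Phi)$, where $\mathbf A(\Phi)=\mathbf A^\mu(\Phi)\,\partial_{x^\mu}$ is the direct sum of $\mathrm{diag}(L,L,N,L,L)$, $\mathrm{diag}(L,L,L,L,N,N,N,L)$ and $$\begin{pmatrix}\lambda_1N&\lambda_1D&0&0&0\\ \lambda_1\overline D&\lambda_1L+\lambda_2N&\lambda_2D&0&0\\ 0&\lambda_2\overline D&\lambda_2L+\lambda_3N&\lambda_3D&0\\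 0&0&\lambda_3\overline D&\lambda_3L+\lambda_4N&\lambda_4D\\ 0&0&0&\lambda_4\overline D&\lambda_4L\end{pmatrix},$$ and the components of $\mathbf f(\Phi)$ are, in the order $e_1,\dots,e_5$, $$-e_1\gamma_2-\overline e_1\gamma_1,\quad -e_2\gamma_2-\overline e_2\gamma_1,\quad 2e_3\,\Re\gamma_8,\quad 2\Re(-e_1\gamma_4+e_1\gamma_5+e_1\overline\gamma_3),\quad 2\Re(-e_2\gamma_4+e_2\gamma_5+e_2\overline\gamma_3),$$ in the order $\gamma_1,\dots,\gamma_8$, $$\begin{aligned} &-2\gamma_1\gamma_2-w_1,\qquad -|\gamma_1|^2-\gamma_2^2,\qquad \gamma_1\gamma_4-\gamma_1\gamma_5-\gamma_2\gamma_3-w_2,\qquad -\gamma_2\gamma_4+\gamma_2\gamma_5+\gamma_3\overline\gamma_1,\\ &-\gamma_3\gamma_7+\gamma_4\gamma_6-\gamma_5\gamma_6-\gamma_5\gamma_8+\gamma_5\overline\gamma_8-\gamma_6\overline\gamma_3+\gamma_7\overline\gamma_4-\gamma_7\overline\gamma_5+w_4,\\ &-\gamma_6^2-2\gamma_6\Re\gamma_8-|\gamma_7|^2,\qquad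 -2\gamma_6\gamma_7-3\gamma_7\gamma_8+\gamma_7\overline\gamma_8-w_5,\\ &-2\gamma_3\gamma_4+2\gamma_3\gamma_5+|\gamma_3|^2+|\gamma_4|^2-\gamma_4\overline\gamma_5-\gamma_5\overline\gamma_4+w_3, \end{aligned}$$ and in the order $w_1,\dots,w_5$, $$\begin{aligned} &-\lambda_1(3\gamma_1w_3-6\gamma_3w_2+\gamma_6w_1-4\gamma_8w_1+4\overline\gamma_4w_2),\\ &-\lambda_1(4\gamma_2w_2+4\gamma_4w_1+\gamma_5w_1)-\lambda_2(2\gamma_1w_4-3\gamma_3w_3+2\gamma_6w_2-2\gamma_8w_2+3\overline\gamma_4w_3),\\ &-\lambda_2(3\gamma_2w_3+2\gamma_4w_2+2\gamma_5w_2+\gamma_7w_1)-\lambda_3(\gamma_1w_5+3\gamma_6w_3+2\overline\gamma_4w_4),\\ &-\lambda_3(2\gamma_2w_4+3\gamma_5w_3+2\gamma_7w_2)-\lambda_4(3\gamma_3w_5+4\gamma_6w_4+2\gamma_8w_4+\overline\gamma_4w_5),\\ &-\lambda_4(\gamma_2w_5-2\gamma_4w_4+4\gamma_5w_4+3\gamma_7w_3).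 \end{aligned}$$ *The constraint field* $\Phi^\sharp=(t,u,v)\in\mathbb C^5\oplus\mathbb C^9\oplus\mathbb C^3$ of $\Phi$ is $$\begin{aligned} t_j&=-2\Im\big(D(\overline e_j)+\overline e_j\gamma_3+\overline e_j\overline\gamma_4\big)\quad(j=1,2),\qquad t_3=D(e_3)-e_3\gamma_3+e_3\overline\gamma_4+e_3\overline\gamma_5,\\ t_{j+3}&=\overline D(e_{j+3})-N(\overline e_j)-e_j\gamma_7-\overline e_j\gamma_6+\overline e_j\overline\gamma_8-\overline e_j\gamma_8\quad(j=1,2),\\ u_1&=D(\gamma_2)-\overline D(\gamma_1)+w_2-3\gamma_1\gamma_4-\gamma_1\overline\gamma_3-\gamma_2\gamma_3+\gamma_2\overline\gamma_4,\\ u_2&=D(\gamma_4)+\overline D(\gamma_3)-w_3+2\gamma_3\gamma_4+\gamma_1\gamma_7-\gamma_2\gamma_6+|\gamma_3|^2+|\gamma_4|^2,\\ u_3&=\overline D(\gamma_3)-\overline D(\overline\gamma_4)+N(\gamma_2)-w_3+2\gamma_3\gamma_4-2|\gamma_4|^2+\gamma_1\gamma_7+\gamma_2\gamma_6-\gamma_2\gamma_8-\gamma_2\overline\gamma_8,\\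 u_4&=D(\overline\gamma_4)-D(\gamma_3)-N(\gamma_1)+3\gamma_1\gamma_8+2\gamma_3^2-2\gamma_3\overline\gamma_4-\gamma_1\gamma_6-\gamma_1\overline\gamma_8-\gamma_2\overline\gamma_7,\\ u_5&=\overline D(\gamma_5)-L(\gamma_7)-\gamma_2\gamma_7-\gamma_4\gamma_5+\gamma_5^2-\gamma_5\overline\gamma_3-\gamma_6\overline\gamma_1,\\ u_6&=L(\gamma_6)-D(\gamma_5)-w_3+\gamma_1\gamma_7+\gamma_2\gamma_6-\gamma_3\gamma_5-\gamma_5\overline\gamma_4-|\gamma_5|^2,\\ u_7&=D(\gamma_8)-N(\gamma_3)-2\gamma_3\gamma_6+\gamma_3\gamma_8-\gamma_3\overline\gamma_8+\gamma_4\overline\gamma_7+\gamma_6\overline\gamma_4,\\ u_8&=N(\gamma_4)+\overline D(\gamma_8)+w_4-2\gamma_3\gamma_7+\gamma_4\gamma_6+\gamma_4\gamma_8-\gamma_4\overline\gamma_8+\gamma_7\overline\gamma_4,\\ u_9&=D(\gamma_7)-\overline D(\gamma_6)-w_4+3\gamma_3\gamma_7+\gamma_4\gamma_6-\gamma_6\overline\gamma_3+\gamma_7\overline\gamma_4,\\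 v_1&=\lambda_1\big(\overline D(w_1)+L(w_2)+4\gamma_2w_2+4\gamma_4w_1+\gamma_5w_1\big),\\ v_2&=\lambda_2\big(\overline D(w_2)+L(w_3)+3\gamma_2w_3+2\gamma_4w_2+2\gamma_5w_2+\gamma_7w_1\big),\\ v_3&=\lambda_3\big(\overline D(w_3)+L(w_4)+2\gamma_2w_4+3\gamma_5w_3+2\gamma_7w_2\big). \end{aligned}$$ *The background.* For real $a,\mathfrak A\neq0$ put $\mathbf e(\xi)=\frac a2\big(1+\frac{\mathfrak A^2}{a^2}|\xi|^2\big)$, $\boldsymbol\lambda(\xi)=-\frac{\mathfrak A^2}{2a}\xi$, $\rho=\mathfrak A^2\underline u-u$, and $$\mathcal M_{a,\mathfrak A}=\big(\rho^{-1}\mathbf e,\ i\rho^{-1}\mathbf e,\ 1,\ 0,\ 0\big)\oplus\big(0,\ \rho^{-1}\mathfrak A^2,\ \rho^{-1}\boldsymbol\lambda,\ \rho^{-1}\overline{\boldsymbol\lambda},\ 0,\ -\rho^{-1},\ 0,\ 0\big)\oplus(0,0,0,0,0).$$ $[\mathcal M_{a,\mathfrak A}]$ is its formal expansion in $\frac1u$,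 obtained from $[\frac1\rho]=-\frac1u-\frac1{u^2}\sum_{k\ge0}u^{-k}\,\mathfrak A^{2(k+1)}\underline u^{k+1}$. *Formal far-field system.* Let $M,E$ be the diagonal matrices with diagonals $M=(2,2,2,3,3)\oplus(1,2,2,2,2,2,2,3)\oplus(1,2,3,4,4)$ and $E=(4,4,4,6,6)\oplus(2,4,4,4,4,4,4,6)\oplus(0,0,0,0,0)$, let $M^\sharp=\mathrm{diag}\big((2,2,2,3,3)\oplus(2,2,2,2,2,2,3,3,3)\oplus(0,-1,-2)\big)$, and let $\lambda_j=u^{2j}$. A formal power series is $[\Psi]=\sum_{k\ge0}u^{-k}\Psi(k)$ with smooth coefficient fields $\Psi(k)=(f(k),\omega(k),z(k)):\mathbb R^2\times(0,\infty)\to\mathcal R$, functions of $(\xi,\underline u)$. Put $[\Phi]=[\mathcal M_{a,\mathfrak A}]+u^{-M}[\Psi]$. All operations are those of formal Laurent series in $\frac1u$ whose coefficients are functions of $(\xi,\underline u)$, with $\partial_u u^{-k}=-k\,u^{-k-1}$. The *far-field system* is $$u^{E-M}\mathbf A^\mu(\Phi)\,u^{-M}\,\partial_{x^\mu}\Psi=u^{E-M}\Big(-\mathbf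 A^\mu(\Phi)\,(\partial_{x^\mu}u^{-M})\,\Psi+\mathbf f(\Phi)-\mathbf A^\mu(\Phi)\,\partial_{x^\mu}\mathcal M_{a,\mathfrak A}\Big)$$ with $[\Phi],[\Psi],[\mathcal M_{a,\mathfrak A}]$ substituted for $\Phi,\Psi,\mathcal M_{a,\mathfrak A}$, and the *formal constraint field* is $[\Psi^\sharp]=u^{M^\sharp}[\Phi^\sharp]$, where $[\Phi^\sharp]$ is the constraint field of $[\Phi]$. **Proposition.** Let $a,\mathfrak A$ be real numbers with $a,\mathfrak A\neq0$. 1. For every $\underline u_0>0$ and every smooth $\mathrm{DATA}:\mathbb R^2\times(0,\infty)\to\mathbb C$ that vanishes for $\underline u<\underline u_0$, there is a unique formal power series $[\Psi]=\sum_{k\ge0}u^{-k}\Psi(k)$ as above that solves the far-field system, satisfies $[\Psi^\sharp]=0$, satisfies $\Psi(k)(\xi,\underline u)=0$ for all $k\ge0$ and all $\underline u<\underline u_0$, and satisfies $\omega_1(0)=\mathrm{DATA}$. 2. (Formal finite speed of propagation.) For every $k\ge0$ and every $(\xi,\underline u)\in\mathbb R^2\times(0,\infty)$, the value $\Psi(k)(\xi,\underline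 u)$ depends only on the restriction of $\mathrm{DATA}$ and of its derivatives of all orders to the half-open segment $\{\xi\}\times(0,\underline u]$. That is, if $[\Psi]$ and $[\Psi']$ are the solutions for the same $a,\mathfrak A$ with data $\mathrm{DATA}$ and $\mathrm{DATA}'$ (vanishing below $\underline u_0$ and $\underline u_0'$ respectively), and the data and all their partial derivatives agree at all points of $\{\xi\}\times(0,\underline u]$, then $\Psi(k)(\xi,\underline u)=\Psi'(k)(\xi,\underline u)$ for all $k\ge0$. -/

import Mathlib

open scoped ContDiff

noncomputable section

namespace FarField

/-! ### Smooth complex functions of `(ξ¹, ξ², u̲)` on `ℝ² × (0, ∞)` -/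

/-- The set `ℝ² × (0, ∞)` of points `(ξ¹, ξ², u̲)`. -/
def HalfSpace : Set (ℝ × ℝ × ℝ) := {q | 0 < q.2.2}

theorem isOpen_halfSpace : IsOpen HalfSpace :=
  isOpen_lt continuous_const (continuous_snd.comp continuous_snd)

/-- Extension by zero to all of `ℝ³` of a function on `ℝ² × (0, ∞)`; it only serves to speak about
derivatives at points of the open set `ℝ² × (0, ∞)`. -/
def ext0 (f : HalfSpace → ℂ) : ℝ × ℝ × ℝ → ℂ := Function.extend Subtype.val f 0

theorem ext0_apply (f : HalfSpace → ℂ) (q : HalfSpace) : ext0 f q = f q :=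
  Subtype.val_injective.extend_apply f 0 q

theorem ext0_add (f g : HalfSpace → ℂ) : ext0 (f + g) = ext0 f + ext0 g := by
  simpa [ext0] using Function.extend_add (Subtype.val : HalfSpace → ℝ × ℝ × ℝ) f g 0 0

theorem ext0_smul (c : ℂ) (f : HalfSpace → ℂ) : ext0 (c • f) = c • ext0 f := by
  simpa [ext0] using Function.extend_smul c (Subtype.val : HalfSpace → ℝ × ℝ × ℝ) f 0

theorem ext0_congr {f : HalfSpace → ℂ} {g : ℝ × ℝ × ℝ → ℂ} (h : ∀ q : HalfSpace, f q = g q) :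
    Set.EqOn (ext0 f) g HalfSpace := fun q hq => by
  rw [← h ⟨q, hq⟩, ← ext0_apply f ⟨q, hq⟩]

/-- The smooth functions among all functions `ℝ² × (0, ∞) → ℂ`. -/
def smoothAlgebra : Subalgebra ℂ (HalfSpace → ℂ) where
  carrier := {f | ContDiffOn ℝ ∞ (ext0 f) HalfSpace}
  mul_mem' {f g} hf hg := (ContDiffOn.mul hf hg).congr
    (ext0_congr fun q => by simp [ext0_apply])
  add_mem' {f g} hf hg := (ContDiffOn.add hf hg).congr
    (ext0_congr fun q => by simp [ext0_apply])
  algebraMap_mem' c := (contDiffOn_const (c := c)).congr (ext0_congr fun q => by simp)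

/-- The algebra of smooth functions `ℝ² × (0, ∞) → ℂ`. -/
def Coef : Type := smoothAlgebra

instance : CommRing Coef := inferInstanceAs (CommRing smoothAlgebra)

instance : Algebra ℂ Coef := inferInstanceAs (Algebra ℂ smoothAlgebra)

instance : CoeFun Coef fun _ => HalfSpace → ℂ := ⟨Subtype.val⟩

theorem Coef.ext {f g : Coef} (h : ∀ q, f q = g q) : f = g := Subtype.ext (funext h)

theorem Coef.contDiffOn (f : Coef) : ContDiffOn ℝ ∞ (ext0 f) HalfSpace := f.2

theorem Coef.differentiableAt (f : Coef) (q : HalfSpace) :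
    DifferentiableAt ℝ (ext0 f) q :=
  ((Coef.contDiffOn f).contDiffAt (isOpen_halfSpace.mem_nhds q.2)).differentiableAt (by simp)

/-- The restriction to `ℝ² × (0, ∞)` of a smooth function on `ℝ³`. -/
def Coef.restrict (g : ℝ × ℝ × ℝ → ℂ) (hg : ContDiff ℝ ∞ g) : Coef :=
  ⟨fun q => g q, hg.contDiffOn.congr (ext0_congr fun _ => rfl)⟩

/-- Complex conjugation of functions. -/
def Coef.conj : Coef →+* Coef where
  toFun f := ⟨fun q => star (f q), by
    have h : ContDiffOn ℝ ∞ (fun x => Complex.conjCLE (ext0 f x)) HalfSpace :=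
      Complex.conjCLE.contDiff.comp_contDiffOn (Coef.contDiffOn f)
    exact h.congr (ext0_congr fun q => by simp [ext0_apply])⟩
  map_one' := Coef.ext fun _ => star_one ℂ
  map_mul' f g := Coef.ext fun q => star_mul' (f q) (g q)
  map_zero' := Coef.ext fun _ => star_zero ℂ
  map_add' f g := Coef.ext fun q => star_add (f q) (g q)

/-- The derivative of functions in the direction of a constant vector `v` of `ℝ³`. -/
def Coef.dir (v : ℝ × ℝ × ℝ) : Coef →ₗ[ℂ] Coef where
  toFun f := ⟨fun q => fderiv ℝ (ext0 f) q v, by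
    have h : ContDiffOn ℝ ∞ (fun x => fderiv ℝ (ext0 f) x v) HalfSpace :=
      ((Coef.contDiffOn f).fderiv_of_isOpen isOpen_halfSpace (by simp)).clm_apply contDiffOn_const
    exact h.congr (ext0_congr fun _ => rfl)⟩
  map_add' f g := by
    refine Coef.ext fun q => ?_
    change fderiv ℝ (ext0 ((f : HalfSpace → ℂ) + g)) q v = fderiv ℝ (ext0 f) q v + fderiv ℝ (ext0 g) q v
    rw [ext0_add, fderiv_add (Coef.differentiableAt f q) (Coef.differentiableAt g q)]
    rfl
  map_smul' c f := by
    refine Coef.ext fun q => ?_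
    change fderiv ℝ (ext0 (c • (f : HalfSpace → ℂ))) q v = c • fderiv ℝ (ext0 f) q v
    rw [ext0_smul, fderiv_const_smul (Coef.differentiableAt f q)]
    rfl

/-- `f(ξ, u̲) = 0` whenever `u̲ < u₀`. -/
def VanishesBelow (u₀ : ℝ) (f : Coef) : Prop :=
  ∀ q : HalfSpace, q.1.2.2 < u₀ → f q = 0

/-! ### Formal series in `1/u`

A formal Laurent series in the variable `1/u` with smooth coefficients on `ℝ² × (0, ∞)`:
the coefficient of index `n : ℤ` stands in front of `(1/u)ⁿ`. -/

abbrev FSeries := LaurentSeries Coef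

/-- `uⁿ` for an integer `n`. -/
def upow (n : ℤ) : FSeries := HahnSeries.single (-n) 1

/-- A function of `(ξ, u̲)`, as a series. -/
def ofCoef (f : Coef) : FSeries := HahnSeries.C f

/-- A complex constant, as a series. -/
def cst (c : ℂ) : FSeries := ofCoef (algebraMap ℂ Coef c)

/-- `∑ₖ (1/u)ᵏ ψ(k)`. -/
def ofSeq (ψ : ℕ → Coef) : FSeries := HahnSeries.ofPowerSeries ℤ Coef (PowerSeries.mk ψ)

/-- Complex conjugation (`u` is real). -/
def bar (x : FSeries) : FSeries := HahnSeries.map x Coef.conj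

def re (x : FSeries) : FSeries := cst (1 / 2) * (x + bar x)

def im (x : FSeries) : FSeries := cst (1 / (2 * Complex.I)) * (x - bar x)

/-- Names of the coordinates `(x¹, x², x³, x⁴) = (ξ¹, ξ², u̲, u)`. -/
inductive Coord | xi1 | xi2 | ub | u

/-- The coordinate derivatives `∂/∂x^μ` of formal series. Since the variable of the series is
`v = 1/u`, one has `∂/∂u = -v² ∂/∂v`. -/
def partialD : Coord → FSeries → FSeries
  | .xi1, x => HahnSeries.map x (Coef.dir (1, 0, 0))
  | .xi2, x => HahnSeries.map x (Coef.dir (0, 1, 0))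
  | .ub, x => HahnSeries.map x (Coef.dir (0, 0, 1))
  | .u, x => -(upow (-2) * LaurentSeries.derivative Coef x)

/-! ### Fields -/

/-- Names of the components of a field `Φ = (e, γ, w)`. -/
inductive Comp
  | e1 | e2 | e3 | e4 | e5
  | γ1 | γ2 | γ3 | γ4 | γ5 | γ6 | γ7 | γ8
  | w1 | w2 | w3 | w4 | w5

/-- Names of the components of a constraint field `Φ♯ = (t, u, v)`. -/
inductive CComp
  | t1 | t2 | t3 | t4 | t5
  | u1 | u2 | u3 | u4 | u5 | u6 | u7 | u8 | u9
  | v1 | v2 | v3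

/-- The field takes its values in
`𝓡 = {(e, γ, w) ∈ ℂ⁵ ⊕ ℂ⁸ ⊕ ℂ⁵ | e₃, e₄, e₅, γ₂, γ₆ ∈ ℝ}`. -/
def ValuedInR (φ : Comp → Coef) : Prop :=
  ∀ i ∈ [Comp.e3, Comp.e4, Comp.e5, Comp.γ2, Comp.γ6], ∀ q : HalfSpace, (φ i q).im = 0

/-! ### The frame, the quasilinear symmetric hyperbolic system and the constraint field

For a field `Φ`, the frame is `D = e₁ ∂_{ξ¹} + e₂ ∂_{ξ²}`, `N = e₄ ∂_{ξ¹} + e₅ ∂_{ξ²} + ∂_u`,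
`L = e₃ ∂_{u̲}`. The functions `symD`, … apply the coefficients of these vector fields to a family
`X = (X_μ)` that stands for the coordinate derivatives. -/

def symD (Φ : Comp → FSeries) (X : Coord → FSeries) : FSeries :=
  Φ .e1 * X .xi1 + Φ .e2 * X .xi2

def symDbar (Φ : Comp → FSeries) (X : Coord → FSeries) : FSeries :=
  bar (Φ .e1) * X .xi1 + bar (Φ .e2) * X .xi2

def symN (Φ : Comp → FSeries) (X : Coord → FSeries) : FSeries :=
  Φ .e4 * X .xi1 + Φ .e5 * X .xi2 + X .u

def symL (Φ : Comp → FSeries) (X : Coord → FSeries) : FSeries :=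
  Φ .e3 * X .ub

/-- `A^μ(Φ) X_μ` (summed over `μ`), where `A(Φ) = A^μ(Φ) ∂/∂x^μ` is the matrix differential operator
of the system with weights `lam 1, …, lam 4`. Here `X i μ` is the `i`-th component of `X_μ`. -/
def Amat (lam : ℕ → FSeries) (Φ : Comp → FSeries) (X : Comp → Coord → FSeries) : Comp → FSeries
  | .e1 => symL Φ (X .e1)
  | .e2 => symL Φ (X .e2)
  | .e3 => symN Φ (X .e3)
  | .e4 => symL Φ (X .e4)
  | .e5 => symL Φ (X .e5)
  | .γ1 => symL Φ (X .γ1)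
  | .γ2 => symL Φ (X .γ2)
  | .γ3 => symL Φ (X .γ3)
  | .γ4 => symL Φ (X .γ4)
  | .γ5 => symN Φ (X .γ5)
  | .γ6 => symN Φ (X .γ6)
  | .γ7 => symN Φ (X .γ7)
  | .γ8 => symL Φ (X .γ8)
  | .w1 => lam 1 * symN Φ (X .w1) + lam 1 * symD Φ (X .w2)
  | .w2 => lam 1 * symDbar Φ (X .w1) + (lam 1 * symL Φ (X .w2) + lam 2 * symN Φ (X .w2))
      + lam 2 * symD Φ (X .w3)
  | .w3 => lam 2 * symDbar Φ (X .w2) + (lam 2 * symL Φ (X .w3) + lam 3 * symN Φ (X .w3))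
      + lam 3 * symD Φ (X .w4)
  | .w4 => lam 3 * symDbar Φ (X .w3) + (lam 3 * symL Φ (X .w4) + lam 4 * symN Φ (X .w4))
      + lam 4 * symD Φ (X .w5)
  | .w5 => lam 4 * symDbar Φ (X .w4) + lam 4 * symL Φ (X .w5)

/-- The right hand side `f(Φ)` of the system `A(Φ) Φ = f(Φ)`. -/
def rhs (lam : ℕ → FSeries) (Φ : Comp → FSeries) : Comp → FSeries
  | .e1 => -(Φ .e1 * Φ .γ2) - bar (Φ .e1) * Φ .γ1
  | .e2 => -(Φ .e2 * Φ .γ2) - bar (Φ .e2) * Φ .γ1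
  | .e3 => Φ .e3 * (2 * re (Φ .γ8))
  | .e4 => 2 * re (-(Φ .e1 * Φ .γ4) + Φ .e1 * Φ .γ5 + Φ .e1 * bar (Φ .γ3))
  | .e5 => 2 * re (-(Φ .e2 * Φ .γ4) + Φ .e2 * Φ .γ5 + Φ .e2 * bar (Φ .γ3))
  | .γ1 => -(2 * Φ .γ1 * Φ .γ2) - Φ .w1
  | .γ2 => -(Φ .γ1 * bar (Φ .γ1)) - Φ .γ2 * Φ .γ2
  | .γ3 => Φ .γ1 * Φ .γ4 - Φ .γ1 * Φ .γ5 - Φ .γ2 * Φ .γ3 - Φ .w2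
  | .γ4 => -(Φ .γ2 * Φ .γ4) + Φ .γ2 * Φ .γ5 + Φ .γ3 * bar (Φ .γ1)
  | .γ5 => -(Φ .γ3 * Φ .γ7) + Φ .γ4 * Φ .γ6 - Φ .γ5 * Φ .γ6 - Φ .γ5 * Φ .γ8
      + Φ .γ5 * bar (Φ .γ8) - Φ .γ6 * bar (Φ .γ3) + Φ .γ7 * bar (Φ .γ4)
      - Φ .γ7 * bar (Φ .γ5) + Φ .w4
  | .γ6 => -(Φ .γ6 * Φ .γ6) - Φ .γ6 * (2 * re (Φ .γ8)) - Φ .γ7 * bar (Φ .γ7)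
  | .γ7 => -(2 * Φ .γ6 * Φ .γ7) - 3 * Φ .γ7 * Φ .γ8 + Φ .γ7 * bar (Φ .γ8) - Φ .w5
  | .γ8 => -(2 * Φ .γ3 * Φ .γ4) + 2 * Φ .γ3 * Φ .γ5 + Φ .γ3 * bar (Φ .γ3)
      + Φ .γ4 * bar (Φ .γ4) - Φ .γ4 * bar (Φ .γ5) - Φ .γ5 * bar (Φ .γ4) + Φ .w3
  | .w1 => -(lam 1 * (3 * Φ .γ1 * Φ .w3 - 6 * Φ .γ3 * Φ .w2 + Φ .γ6 * Φ .w1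
      - 4 * Φ .γ8 * Φ .w1 + 4 * bar (Φ .γ4) * Φ .w2))
  | .w2 => -(lam 1 * (4 * Φ .γ2 * Φ .w2 + 4 * Φ .γ4 * Φ .w1 + Φ .γ5 * Φ .w1))
      - lam 2 * (2 * Φ .γ1 * Φ .w4 - 3 * Φ .γ3 * Φ .w3 + 2 * Φ .γ6 * Φ .w2
        - 2 * Φ .γ8 * Φ .w2 + 3 * bar (Φ .γ4) * Φ .w3)
  | .w3 => -(lam 2 * (3 * Φ .γ2 * Φ .w3 + 2 * Φ .γ4 * Φ .w2 + 2 * Φ .γ5 * Φ .w2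
        + Φ .γ7 * Φ .w1))
      - lam 3 * (Φ .γ1 * Φ .w5 + 3 * Φ .γ6 * Φ .w3 + 2 * bar (Φ .γ4) * Φ .w4)
  | .w4 => -(lam 3 * (2 * Φ .γ2 * Φ .w4 + 3 * Φ .γ5 * Φ .w3 + 2 * Φ .γ7 * Φ .w2))
      - lam 4 * (3 * Φ .γ3 * Φ .w5 + 4 * Φ .γ6 * Φ .w4 + 2 * Φ .γ8 * Φ .w4
        + bar (Φ .γ4) * Φ .w5)
  | .w5 => -(lam 4 * (Φ .γ2 * Φ .w5 - 2 * Φ .γ4 * Φ .w4 + 4 * Φ .γ5 * Φ .w4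
        + 3 * Φ .γ7 * Φ .w3))

def opD (Φ : Comp → FSeries) (x : FSeries) : FSeries := symD Φ fun μ => partialD μ x
def opDbar (Φ : Comp → FSeries) (x : FSeries) : FSeries := symDbar Φ fun μ => partialD μ x
def opN (Φ : Comp → FSeries) (x : FSeries) : FSeries := symN Φ fun μ => partialD μ x
def opL (Φ : Comp → FSeries) (x : FSeries) : FSeries := symL Φ fun μ => partialD μ x

/-- The constraint field `Φ♯ = (t, u, v)` associated to `Φ` and the weights `lam 1, …, lam 4`. -/
def constraint (lam : ℕ → FSeries) (Φ : Comp → FSeries) : CComp → FSeries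
  | .t1 => -(2 * im (opD Φ (bar (Φ .e1)) + bar (Φ .e1) * Φ .γ3 + bar (Φ .e1) * bar (Φ .γ4)))
  | .t2 => -(2 * im (opD Φ (bar (Φ .e2)) + bar (Φ .e2) * Φ .γ3 + bar (Φ .e2) * bar (Φ .γ4)))
  | .t3 => opD Φ (Φ .e3) - Φ .e3 * Φ .γ3 + Φ .e3 * bar (Φ .γ4) + Φ .e3 * bar (Φ .γ5)
  | .t4 => opDbar Φ (Φ .e4) - opN Φ (bar (Φ .e1)) - Φ .e1 * Φ .γ7 - bar (Φ .e1) * Φ .γ6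
      + bar (Φ .e1) * bar (Φ .γ8) - bar (Φ .e1) * Φ .γ8
  | .t5 => opDbar Φ (Φ .e5) - opN Φ (bar (Φ .e2)) - Φ .e2 * Φ .γ7 - bar (Φ .e2) * Φ .γ6
      + bar (Φ .e2) * bar (Φ .γ8) - bar (Φ .e2) * Φ .γ8
  | .u1 => opD Φ (Φ .γ2) - opDbar Φ (Φ .γ1) + Φ .w2 - 3 * Φ .γ1 * Φ .γ4
      - Φ .γ1 * bar (Φ .γ3) - Φ .γ2 * Φ .γ3 + Φ .γ2 * bar (Φ .γ4)
  | .u2 => opD Φ (Φ .γ4) + opDbar Φ (Φ .γ3) - Φ .w3 + 2 * Φ .γ3 * Φ .γ4 + Φ .γ1 * Φ .γ7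
      - Φ .γ2 * Φ .γ6 + Φ .γ3 * bar (Φ .γ3) + Φ .γ4 * bar (Φ .γ4)
  | .u3 => opDbar Φ (Φ .γ3) - opDbar Φ (bar (Φ .γ4)) + opN Φ (Φ .γ2) - Φ .w3
      + 2 * Φ .γ3 * Φ .γ4 - 2 * Φ .γ4 * bar (Φ .γ4) + Φ .γ1 * Φ .γ7 + Φ .γ2 * Φ .γ6
      - Φ .γ2 * Φ .γ8 - Φ .γ2 * bar (Φ .γ8)
  | .u4 => opD Φ (bar (Φ .γ4)) - opD Φ (Φ .γ3) - opN Φ (Φ .γ1) + 3 * Φ .γ1 * Φ .γ8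
      + 2 * Φ .γ3 * Φ .γ3 - 2 * Φ .γ3 * bar (Φ .γ4) - Φ .γ1 * Φ .γ6
      - Φ .γ1 * bar (Φ .γ8) - Φ .γ2 * bar (Φ .γ7)
  | .u5 => opDbar Φ (Φ .γ5) - opL Φ (Φ .γ7) - Φ .γ2 * Φ .γ7 - Φ .γ4 * Φ .γ5 + Φ .γ5 * Φ .γ5
      - Φ .γ5 * bar (Φ .γ3) - Φ .γ6 * bar (Φ .γ1)
  | .u6 => opL Φ (Φ .γ6) - opD Φ (Φ .γ5) - Φ .w3 + Φ .γ1 * Φ .γ7 + Φ .γ2 * Φ .γ6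
      - Φ .γ3 * Φ .γ5 - Φ .γ5 * bar (Φ .γ4) - Φ .γ5 * bar (Φ .γ5)
  | .u7 => opD Φ (Φ .γ8) - opN Φ (Φ .γ3) - 2 * Φ .γ3 * Φ .γ6 + Φ .γ3 * Φ .γ8
      - Φ .γ3 * bar (Φ .γ8) + Φ .γ4 * bar (Φ .γ7) + Φ .γ6 * bar (Φ .γ4)
  | .u8 => opN Φ (Φ .γ4) + opDbar Φ (Φ .γ8) + Φ .w4 - 2 * Φ .γ3 * Φ .γ7 + Φ .γ4 * Φ .γ6
      + Φ .γ4 * Φ .γ8 - Φ .γ4 * bar (Φ .γ8) + Φ .γ7 * bar (Φ .γ4)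
  | .u9 => opD Φ (Φ .γ7) - opDbar Φ (Φ .γ6) - Φ .w4 + 3 * Φ .γ3 * Φ .γ7 + Φ .γ4 * Φ .γ6
      - Φ .γ6 * bar (Φ .γ3) + Φ .γ7 * bar (Φ .γ4)
  | .v1 => lam 1 * (opDbar Φ (Φ .w1) + opL Φ (Φ .w2) + 4 * Φ .γ2 * Φ .w2
      + 4 * Φ .γ4 * Φ .w1 + Φ .γ5 * Φ .w1)
  | .v2 => lam 2 * (opDbar Φ (Φ .w2) + opL Φ (Φ .w3) + 3 * Φ .γ2 * Φ .w3
      + 2 * Φ .γ4 * Φ .w2 + 2 * Φ .γ5 * Φ .w2 + Φ .γ7 * Φ .w1)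
  | .v3 => lam 3 * (opDbar Φ (Φ .w3) + opL Φ (Φ .w4) + 2 * Φ .γ2 * Φ .w4
      + 3 * Φ .γ5 * Φ .w3 + 2 * Φ .γ7 * Φ .w2)

/-! ### The formal expansion of the doubly scaled Minkowski field -/

/-- `e_{a,𝔄}(ξ) = (a/2) (1 + (𝔄²/a²) |ξ|²)`. -/
def eFun (a A : ℝ) : Coef :=
  Coef.restrict
    (fun q => ((a / 2 * (1 + A ^ 2 / a ^ 2 * (q.1 ^ 2 + q.2.1 ^ 2)) : ℝ) : ℂ))
    (Complex.ofRealCLM.contDiff.comp (contDiff_const.mul (contDiff_const.add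
      (contDiff_const.mul ((contDiff_fst.pow 2).add
        ((contDiff_fst.comp contDiff_snd).pow 2))))))

/-- `λ_{a,𝔄}(ξ) = -(𝔄²/(2a)) ξ` with `ξ = ξ¹ + i ξ²`. -/
def lamFun (a A : ℝ) : Coef :=
  Coef.restrict (fun q => -((A : ℂ) ^ 2 / (2 * (a : ℂ))) * ((q.1 : ℂ) + Complex.I * (q.2.1 : ℂ)))
    (contDiff_const.mul ((Complex.ofRealCLM.contDiff.comp contDiff_fst).add
      (contDiff_const.mul
        (Complex.ofRealCLM.contDiff.comp (contDiff_fst.comp contDiff_snd)))))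

/-- The function `u̲`. -/
def ubFun : Coef :=
  Coef.restrict (fun q => (q.2.2 : ℂ))
    (Complex.ofRealCLM.contDiff.comp (contDiff_snd.comp contDiff_snd))

/-- `[S] = -∑ₖ (1/u)ᵏ 𝔄^{2(k+1)} u̲^{k+1}`. -/
def sSeries (A : ℝ) : FSeries :=
  -ofSeq fun k => algebraMap ℂ Coef ((A : ℂ) ^ (2 * (k + 1))) * ubFun ^ (k + 1)

/-- `[1/ρ] = -1/u + (1/u²) [S]`, the expansion of `1/ρ` for `ρ = 𝔄² u̲ - u`. -/
def rhoInv (A : ℝ) : FSeries := -upow (-1) + upow (-2) * sSeries A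

/-- `[𝓜_{a,𝔄}]`, the formal expansion in `1/u` of the doubly scaled Minkowski field. -/
def mink (a A : ℝ) : Comp → FSeries
  | .e1 => rhoInv A * ofCoef (eFun a A)
  | .e2 => cst Complex.I * rhoInv A * ofCoef (eFun a A)
  | .e3 => 1
  | .γ2 => rhoInv A * cst ((A : ℂ) ^ 2)
  | .γ3 => rhoInv A * ofCoef (lamFun a A)
  | .γ4 => rhoInv A * bar (ofCoef (lamFun a A))
  | .γ6 => -rhoInv A
  | _ => 0

/-! ### The far field system -/

/-- The exponents `M`. -/
def expM : Comp → ℤ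
  | .e1 => 2 | .e2 => 2 | .e3 => 2 | .e4 => 3 | .e5 => 3
  | .γ1 => 1 | .γ2 => 2 | .γ3 => 2 | .γ4 => 2 | .γ5 => 2 | .γ6 => 2 | .γ7 => 2 | .γ8 => 3
  | .w1 => 1 | .w2 => 2 | .w3 => 3 | .w4 => 4 | .w5 => 4

/-- The exponents `E`. -/
def expE : Comp → ℤ
  | .e1 => 4 | .e2 => 4 | .e3 => 4 | .e4 => 6 | .e5 => 6
  | .γ1 => 2 | .γ2 => 4 | .γ3 => 4 | .γ4 => 4 | .γ5 => 4 | .γ6 => 4 | .γ7 => 4 | .γ8 => 6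
  | .w1 => 0 | .w2 => 0 | .w3 => 0 | .w4 => 0 | .w5 => 0

/-- The exponents `M♯`. -/
def expMsharp : CComp → ℤ
  | .t1 => 2 | .t2 => 2 | .t3 => 2 | .t4 => 3 | .t5 => 3
  | .u1 => 2 | .u2 => 2 | .u3 => 2 | .u4 => 2 | .u5 => 2 | .u6 => 2
  | .u7 => 3 | .u8 => 3 | .u9 => 3
  | .v1 => 0 | .v2 => -1 | .v3 => -2

/-- The weights `λ_j = u^{2j}`. -/
def weight (j : ℕ) : FSeries := upow (2 * j)

/-- The field `[Φ] = [𝓜_{a,𝔄}] + u^{-M} [Ψ]`. -/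
def farField (a A : ℝ) (Ψ : Comp → FSeries) : Comp → FSeries :=
  fun i => mink a A i + upow (-expM i) * Ψ i

/-- The left hand side `A_{a,𝔄}(x, Ψ) Ψ = u^E (u^{-M} A^μ(Φ) u^{-M}) ∂_μ Ψ` of the far field
system. -/
def farLHS (a A : ℝ) (Ψ : Comp → FSeries) : Comp → FSeries := fun i =>
  upow (expE i) * (upow (-expM i) *
    Amat weight (farField a A Ψ) (fun j μ => upow (-expM j) * partialD μ (Ψ j)) i)

/-- The right hand side
`f_{a,𝔄}(x, Ψ) = u^{E-M} (-A^μ(Φ) (∂_μ u^{-M}) Ψ + f(Φ) - A^μ(Φ) ∂_μ 𝓜_{a,𝔄})` of the far field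
system. -/
def farRHS (a A : ℝ) (Ψ : Comp → FSeries) : Comp → FSeries := fun i =>
  upow (expE i - expM i) *
    (-Amat weight (farField a A Ψ) (fun j μ => partialD μ (upow (-expM j)) * Ψ j) i
      + rhs weight (farField a A Ψ) i
      - Amat weight (farField a A Ψ) (fun j μ => partialD μ (mink a A j)) i)

/-- The formal constraint field `[Ψ♯]`, defined by `Φ♯ = u^{-M♯} Ψ♯`. -/
def farConstraint (a A : ℝ) (Ψ : Comp → FSeries) : CComp → FSeries := fun i =>
  upow (expMsharp i) * constraint weight (farField a A Ψ) i

/-- The formal series `[Ψ] = ∑ₖ (1/u)ᵏ Ψ(k)` with coefficient functions `Ψ(k)`. -/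
def toSeries (Ψ : ℕ → Comp → Coef) : Comp → FSeries := fun i => ofSeq fun k => Ψ k i

/-- `[Ψ] = ∑ₖ (1/u)ᵏ Ψ(k)` is a formal far field solution with data `DATA`: its coefficients are
smooth fields on `ℝ² × (0, ∞)` with values in `𝓡`, it solves the far field system, its formal
constraint field vanishes, it vanishes for `u̲ < u₀`, and `ω₁(0) = DATA` (here `ω₁` is the
`γ₁`-component of `Ψ`). -/
structure IsFormalSolution (a A u₀ : ℝ) (DATA : Coef) (Ψ : ℕ → Comp → Coef) : Prop where
  valued : ∀ k, ValuedInR (Ψ k)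
  system : farLHS a A (toSeries Ψ) = farRHS a A (toSeries Ψ)
  constraint : farConstraint a A (toSeries Ψ) = 0
  vanish : ∀ k i, VanishesBelow u₀ (Ψ k i)
  data : Ψ 0 .γ1 = DATA

/-- `f` and `g`, together with their derivatives of all orders, coincide along the half-open
segment `{ξ} × (0, u̲]`, where `q = (ξ, u̲)`. -/
def AgreeAlongSegment (f g : Coef) (q : HalfSpace) : Prop :=
  ∀ s : ℝ, 0 < s → s ≤ q.1.2.2 → ∀ n : ℕ,
    iteratedFDeriv ℝ n (ext0 f) (q.1.1, q.1.2.1, s) =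
      iteratedFDeriv ℝ n (ext0 g) (q.1.1, q.1.2.1, s)

end FarField

end

noncomputable section

namespace FarField

open MeasureTheory Set Topology

/-! ### Smooth dependence of integrals on parameters -/

section ParametricIntegral

variable {X : Type} [NormedAddCommGroup X] [NormedSpace ℝ X] [FiniteDimensional ℝ X]

/-! The system and its constraints together are overdetermined. A suitable part of them, the reduced
system `IsReduced`, already determines the coefficients order by order in 1/u, and the remaining
equations are then automatic.

In the reduced system most components obey a transport equation along u̲. The exceptions are γ₅,
which the constraint t₃ gives algebraically, and e₃ and w₁, which obey ∂_u equations; on formal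
series ∂_u only multiplies coefficients by integers (`isReduced_iff`). Counting orders with the
exponents M shows that the k-th coefficient of each right hand side involves coefficients of lower
order, and those of order k only for components earlier in the list `rank` (`source_sub_below`). The
unknowns are therefore found one after the other, by integration from a height c below the support,
by substitution, or by division by an integer. That integer vanishes exactly once: for w₁ it is k,
so z₁(0) is free. The lowest order of the γ₁ equation is ∂_{u̲} ω₁(0) = -z₁(0) (`dir_γ1_eq`), which
converts this freedom into the datum. Formal solutions are thus fixed points of the triangular map
`iterStep`, whose iterates become stationary entry by entry.

Uniqueness, vanishing for small u̲ and finite speed are one statement, `sub_mem_of_iterStep_eq`: if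
an ideal of coefficient functions is stable under conjugation, derivatives and integration in u̲,
and the data agree modulo it, so do the solutions. The ideals are zero, the functions vanishing
below u₀, and the functions that vanish below u₀ and to infinite order along the segment.

For the remaining equations, the commutators of D, N, L give a linear homogeneous system for their
residuals (`IsReduced.propagated_eq`). Below u₀ the field is the Minkowski field, whose residuals
are zero (`resid_mink`). The homogeneous system is again triangular with respect to orders
(`coupling_below`), so integration from the region below u₀ kills the residuals order by order
(`resid_eq_zero`). -/

theorem exists_compact_nhd_prod_subset {Ω : Set (X × ℝ)} (hΩ : IsOpen Ω) {p : X}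
    (hp : ∀ θ ∈ Icc (0 : ℝ) 1, (p, θ) ∈ Ω) :
    ∃ K ∈ 𝓝 p, IsCompact K ∧ K ×ˢ Icc (0 : ℝ) 1 ⊆ Ω := by
  obtain ⟨U, V, hU, -, hpU, hV, hUV⟩ := generalized_tube_lemma (isCompact_singleton (x := p))
    (isCompact_Icc (a := (0 : ℝ)) (b := 1)) hΩ (by
      rintro ⟨x, θ⟩ ⟨hx, hθ⟩
      rw [mem_singleton_iff] at hx
      subst hx
      exact hp θ hθ)
  have : ProperSpace X := FiniteDimensional.proper ℝ X
  obtain ⟨K, hK, hKU, hKc⟩ := local_compact_nhds (hU.mem_nhds (hpU rfl))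
  exact ⟨K, hK, hKc, (prod_mono hKU hV).trans hUV⟩

/-- A compact neighbourhood of p times [0, 1] bounds the derivative of the integrand by a constant,
which is the domination needed to differentiate under the integral. -/
theorem hasFDerivAt_integral_of_contDiffOn {E : Type} [NormedAddCommGroup E] [NormedSpace ℝ E]
    {Ω : Set (X × ℝ)} (hΩ : IsOpen Ω) {G : X × ℝ → E} (hG : ContDiffOn ℝ 1 G Ω) {p : X}
    (hp : ∀ θ ∈ Icc (0 : ℝ) 1, (p, θ) ∈ Ω) :
    HasFDerivAt (fun x => ∫ θ in (0 : ℝ)..1, G (x, θ))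
      (∫ θ in (0 : ℝ)..1, (fderiv ℝ G (p, θ)).comp (ContinuousLinearMap.inl ℝ X ℝ)) p := by
  obtain ⟨K, hK, hKc, hKΩ⟩ := exists_compact_nhd_prod_subset hΩ hp
  have hpK : p ∈ K := mem_of_mem_nhds hK
  have hfd : ContinuousOn (fun z => (fderiv ℝ G z).comp (ContinuousLinearMap.inl ℝ X ℝ))
      (K ×ˢ Icc (0 : ℝ) 1) :=
    ((hG.continuousOn_fderiv_of_isOpen hΩ le_rfl).mono hKΩ).clm_comp continuousOn_const
  have hslice : ∀ x ∈ K, ContinuousOn (fun θ : ℝ => (x, θ)) (Icc 0 1) ∧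
      MapsTo (fun θ : ℝ => (x, θ)) (Icc 0 1) (K ×ˢ Icc (0 : ℝ) 1) := fun x hx =>
    ⟨(by fun_prop), fun θ hθ => ⟨hx, hθ⟩⟩
  have hGx : ∀ x ∈ K, ContinuousOn (fun θ => G (x, θ)) (Icc 0 1) := fun x hx =>
    (hG.continuousOn.mono hKΩ).comp (hslice x hx).1 (hslice x hx).2
  have hsub : uIoc (0 : ℝ) 1 ⊆ Icc 0 1 := by
    rw [uIoc_of_le zero_le_one]; exact Ioc_subset_Icc_self
  obtain ⟨C, hC⟩ := (hKc.prod isCompact_Icc).exists_bound_of_continuousOn hfd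
  refine intervalIntegral.hasFDerivAt_integral_of_dominated_of_fderiv_le (bound := fun _ => C)
    (F' := fun x θ => (fderiv ℝ G (x, θ)).comp (ContinuousLinearMap.inl ℝ X ℝ)) hK ?_ ?_ ?_ ?_ ?_ ?_
  · filter_upwards [hK] with x hx
    exact ((hGx x hx).mono hsub).aestronglyMeasurable measurableSet_uIoc
  · refine ContinuousOn.intervalIntegrable ?_
    rw [uIcc_of_le zero_le_one]
    exact hGx p hpK
  · exact ((hfd.comp (hslice p hpK).1 (hslice p hpK).2).mono hsub).aestronglyMeasurable
      measurableSet_uIoc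
  · exact Filter.Eventually.of_forall fun θ hθ x hx => hC (x, θ) ⟨hx, hsub hθ⟩
  · exact intervalIntegrable_const
  · refine Filter.Eventually.of_forall fun θ hθ x hx => ?_
    have hd : HasFDerivAt G (fderiv ℝ G (x, θ)) (x, θ) :=
      ((hG.contDiffAt (hΩ.mem_nhds (hKΩ ⟨hx, hsub hθ⟩))).differentiableAt (by simp)).hasFDerivAt
    exact hd.comp x (hasFDerivAt_prodMk_left x θ)

/-- Induction on n: the derivative of the integral is an integral of the same type. E is quantified
after n because the differentiated integrand takes values in another space. -/
theorem contDiffOn_integral {Ω : Set (X × ℝ)} (hΩ : IsOpen Ω) {U : Set X} (hU : IsOpen U)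
    (hUΩ : ∀ p ∈ U, ∀ θ ∈ Icc (0 : ℝ) 1, (p, θ) ∈ Ω) (n : ℕ) :
    ∀ {E : Type} [NormedAddCommGroup E] [NormedSpace ℝ E] {G : X × ℝ → E},
      ContDiffOn ℝ ∞ G Ω → ContDiffOn ℝ n (fun x => ∫ θ in (0 : ℝ)..1, G (x, θ)) U := by
  induction n with
  | zero =>
    intro E _ _ G hG
    refine contDiffOn_zero.2 fun p hp => ?_
    exact (hasFDerivAt_integral_of_contDiffOn hΩ (hG.of_le (by simp)) (hUΩ p
        hp)).continuousAt.continuousWithinAt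
  | succ n ih =>
    intro E _ _ G hG
    have hd := fun p hp =>
      hasFDerivAt_integral_of_contDiffOn hΩ (hG.of_le (by simp)) (hUΩ p hp)
    push_cast
    rw [contDiffOn_succ_iff_fderiv_of_isOpen hU]
    refine ⟨fun p hp => (hd p hp).differentiableAt.differentiableWithinAt, by simp, ?_⟩
    refine (ih (G := fun z => (fderiv ℝ G z).comp (ContinuousLinearMap.inl ℝ X ℝ)) ?_).congr
      fun p hp => (hd p hp).fderiv
    exact (hG.fderiv_of_isOpen hΩ (by simp)).clm_comp contDiffOn_const

end ParametricIntegral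

/-! ### Calculus in the algebra of smooth functions -/

namespace Coef

theorem add_apply (f g : Coef) (q : HalfSpace) : (f + g) q = f q + g q := rfl
theorem sub_apply (f g : Coef) (q : HalfSpace) : (f - g) q = f q - g q := rfl
theorem mul_apply (f g : Coef) (q : HalfSpace) : (f * g) q = f q * g q := rfl
theorem zero_apply (q : HalfSpace) : (0 : Coef) q = 0 := rfl
theorem conj_apply (f : Coef) (q : HalfSpace) : conj f q = star (f q) := rfl
theorem smul_apply (c : ℂ) (f : Coef) (q : HalfSpace) : (c • f) q = c * f q := rfl
theorem algebraMap_apply (c : ℂ) (q : HalfSpace) : (algebraMap ℂ Coef c) q = c := rfl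

theorem conj_conj (f : Coef) : conj (conj f) = f := Coef.ext fun q => star_star (f q)

theorem conj_algebraMap (c : ℂ) : conj (algebraMap ℂ Coef c) = algebraMap ℂ Coef (star c) := rfl

theorem dir_apply (v : ℝ × ℝ × ℝ) (f : Coef) (q : HalfSpace) :
    dir v f q = fderiv ℝ (ext0 f) q v := rfl

theorem dir_mul (v : ℝ × ℝ × ℝ) (f g : Coef) : dir v (f * g) = dir v f * g + f * dir v g := by
  refine Coef.ext fun q => ?_
  have h : ext0 (f * g : Coef) =ᶠ[𝓝 (q : ℝ × ℝ × ℝ)] fun x => ext0 f x * ext0 g x :=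
    Filter.eventuallyEq_of_mem (isOpen_halfSpace.mem_nhds q.2)
      (ext0_congr fun p => by simp [ext0_apply, mul_apply])
  rw [add_apply, mul_apply, mul_apply, dir_apply, h.fderiv_eq,
    fderiv_fun_mul (differentiableAt f q) (differentiableAt g q)]
  simp [ext0_apply, dir_apply]
  ring

theorem dir_eqOn (v : ℝ × ℝ × ℝ) (f : Coef) :
    EqOn (ext0 (dir v f)) (fun x => fderiv ℝ (ext0 f) x v) HalfSpace :=
  ext0_congr fun _ => rfl

theorem differentiableAt_fderiv (f : Coef) (q : HalfSpace) :
    DifferentiableAt ℝ (fderiv ℝ (ext0 f)) q :=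
  (((Coef.contDiffOn f).fderiv_of_isOpen isOpen_halfSpace (m := ∞) (by simp)).contDiffAt
    (isOpen_halfSpace.mem_nhds q.2)).differentiableAt (by simp)

theorem dir_dir_apply (v w : ℝ × ℝ × ℝ) (f : Coef) (q : HalfSpace) :
    dir v (dir w f) q = fderiv ℝ (fderiv ℝ (ext0 f)) q v w := by
  have h : ext0 (dir w f) =ᶠ[𝓝 (q : ℝ × ℝ × ℝ)] fun x => fderiv ℝ (ext0 f) x w :=
    Filter.eventuallyEq_of_mem (isOpen_halfSpace.mem_nhds q.2) (dir_eqOn w f)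
  rw [dir_apply, h.fderiv_eq, fderiv_clm_apply (differentiableAt_fderiv f q) (by fun_prop)]
  simp

theorem dir_comm (v w : ℝ × ℝ × ℝ) (f : Coef) : dir v (dir w f) = dir w (dir v f) := by
  refine Coef.ext fun q => ?_
  rw [dir_dir_apply, dir_dir_apply]
  exact (((Coef.contDiffOn f).contDiffAt (isOpen_halfSpace.mem_nhds q.2)).isSymmSndFDerivAt
    (by rw [minSmoothness_of_isRCLikeNormedField]; exact WithTop.coe_le_coe.2 le_top)).eq v w

theorem conj_dir (v : ℝ × ℝ × ℝ) (f : Coef) : conj (dir v f) = dir v (conj f) := by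
  refine Coef.ext fun q => ?_
  have h : ext0 (conj f) =ᶠ[𝓝 (q : ℝ × ℝ × ℝ)] fun x => Complex.conjCLE (ext0 f x) :=
    Filter.eventuallyEq_of_mem (isOpen_halfSpace.mem_nhds q.2)
      (ext0_congr fun p => by simp [ext0_apply, conj_apply])
  have h2 := (Complex.conjCLE.toContinuousLinearMap.hasFDerivAt.comp (q : ℝ × ℝ × ℝ)
    (differentiableAt f q).hasFDerivAt).fderiv
  rw [dir_apply, h.fderiv_eq, conj_apply, dir_apply]
  erw [h2]
  simp

theorem dir_one (v : ℝ × ℝ × ℝ) : dir v 1 = 0 := by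
  have := dir_mul v 1 1
  simpa using this

theorem dir_algebraMap (v : ℝ × ℝ × ℝ) (c : ℂ) : dir v (algebraMap ℂ Coef c) = 0 := by
  rw [Algebra.algebraMap_eq_smul_one, map_smul, dir_one, smul_zero]

/-! ### Antiderivatives in the variable `u̲` -/

/-- The point `(ξ, c + θ (u̲ - c))` of the segment from `(ξ, c)` to `(ξ, u̲)`. -/
def segmentPoint (c : ℝ) (z : (ℝ × ℝ × ℝ) × ℝ) : ℝ × ℝ × ℝ :=
  (z.1.1, z.1.2.1, c + z.2 * (z.1.2.2 - c))

theorem contDiff_segmentPoint (c : ℝ) : ContDiff ℝ ∞ (segmentPoint c) := by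
  unfold segmentPoint
  fun_prop

theorem segmentPoint_mem {c : ℝ} (hc : 0 < c) {p : ℝ × ℝ × ℝ} (hp : p ∈ HalfSpace) {θ : ℝ}
    (hθ : θ ∈ Icc (0 : ℝ) 1) : segmentPoint c (p, θ) ∈ HalfSpace := by
  have hp' : 0 < p.2.2 := hp
  change 0 < c + θ * (p.2.2 - c)
  rcases eq_or_lt_of_le hθ.1 with h | h
  · simpa [← h] using hc
  · nlinarith [mul_pos h hp', mul_nonneg (sub_nonneg.2 hθ.2) hc.le]

theorem contDiffOn_comp_segmentPoint (c : ℝ) (f : Coef) :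
    ContDiffOn ℝ ∞ (fun z => ext0 f (segmentPoint c z)) (segmentPoint c ⁻¹' HalfSpace) :=
  (Coef.contDiffOn f).comp (contDiff_segmentPoint c).contDiffOn fun _ h => h

theorem isOpen_segmentPoint_preimage (c : ℝ) : IsOpen (segmentPoint c ⁻¹' HalfSpace) :=
  isOpen_halfSpace.preimage (contDiff_segmentPoint c).continuous

/-- The substitution t = c + θ (u̲ - c) moves the variable endpoint into the integrand, so that
smoothness in all variables reduces to an integral over a fixed interval. -/
theorem mul_integral_segment (c : ℝ) (g : ℝ × ℝ × ℝ → ℂ) (p : ℝ × ℝ × ℝ) :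
    ((p.2.2 - c : ℝ) : ℂ) * ∫ θ in (0 : ℝ)..1, g (segmentPoint c (p, θ)) =
      ∫ t in c..p.2.2, g (p.1, p.2.1, t) := by
  have h := intervalIntegral.smul_integral_comp_mul_add
    (fun t => g (p.1, p.2.1, t)) (a := 0) (b := 1) (p.2.2 - c) c
  simp only [mul_zero, zero_add, mul_one, sub_add_cancel] at h
  rw [← h, ← Complex.real_smul]
  refine congrArg _ (intervalIntegral.integral_congr fun θ _ => ?_)
  simp only [segmentPoint]
  ring_nf

theorem contDiffOn_integral_segment {c : ℝ} (hc : 0 < c) (f : Coef) :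
    ContDiffOn ℝ ∞ (fun p : ℝ × ℝ × ℝ => ∫ t in c..p.2.2, ext0 f (p.1, p.2.1, t)) HalfSpace := by
  refine contDiffOn_infty.2 fun n => ?_
  have h := contDiffOn_integral (isOpen_segmentPoint_preimage c) isOpen_halfSpace
    (fun p hp θ hθ => segmentPoint_mem hc hp hθ) n (contDiffOn_comp_segmentPoint c f)
  have h2 : ContDiffOn ℝ n (fun p : ℝ × ℝ × ℝ => ((p.2.2 - c : ℝ) : ℂ)) HalfSpace :=
    (Complex.ofRealCLM.contDiff.comp (by fun_prop : ContDiff ℝ n fun p : ℝ × ℝ × ℝ => p.2.2 -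
        c)).contDiffOn
  exact (h2.mul h).congr fun p _ => (mul_integral_segment c _ p).symm

/-- The antiderivative `∫_c^{u̲} f(ξ, t) dt`. -/
def antideriv {c : ℝ} (hc : 0 < c) (f : Coef) : Coef :=
  ⟨fun q => ∫ t in c..q.1.2.2, ext0 f (q.1.1, q.1.2.1, t),
    (contDiffOn_integral_segment hc f).congr (ext0_congr fun _ => rfl)⟩

variable {c : ℝ} (hc : 0 < c)

theorem antideriv_apply (f : Coef) (q : HalfSpace) :
    antideriv hc f q = ∫ t in c..q.1.2.2, ext0 f (q.1.1, q.1.2.1, t) := rfl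

theorem continuousOn_slice (f : Coef) (x y : ℝ) :
    ContinuousOn (fun t : ℝ => ext0 f (x, y, t)) (Ioi 0) :=
  (Coef.contDiffOn f).continuousOn.comp (by fun_prop) fun _ ht => ht

theorem intervalIntegrable_slice (f : Coef) (x y : ℝ) {a b : ℝ} (ha : 0 < a) (hb : 0 < b) :
    IntervalIntegrable (fun t : ℝ => ext0 f (x, y, t)) volume a b :=
  ((continuousOn_slice f x y).mono fun _ ht =>
    lt_of_lt_of_le (lt_min ha hb) ht.1).intervalIntegrable

theorem hasDerivAt_slice (f : Coef) (q : HalfSpace) :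
    HasDerivAt (fun t : ℝ => ext0 f (q.1.1, q.1.2.1, t)) (dir (0, 0, 1) f q) q.1.2.2 := by
  have h2 : HasDerivAt (fun t : ℝ => ((q.1.1, q.1.2.1, t) : ℝ × ℝ × ℝ)) (0, 0, 1) q.1.2.2 :=
    (hasDerivAt_const _ _).prodMk ((hasDerivAt_const _ _).prodMk (hasDerivAt_id _))
  exact (differentiableAt f q).hasFDerivAt.comp_hasDerivAt q.1.2.2 h2

theorem dir_antideriv (f : Coef) : dir (0, 0, 1) (antideriv hc f) = f := by
  refine Coef.ext fun q => ?_
  have h1 := hasDerivAt_slice (antideriv hc f) q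
  have hq : 0 < q.1.2.2 := q.2
  have h2 : HasDerivAt (fun s : ℝ => ∫ t in c..s, ext0 f (q.1.1, q.1.2.1, t))
      (ext0 f (q.1.1, q.1.2.1, q.1.2.2)) q.1.2.2 :=
    intervalIntegral.integral_hasDerivAt_right (intervalIntegrable_slice f _ _ hc hq)
      ((continuousOn_slice f _ _).stronglyMeasurableAtFilter isOpen_Ioi _ hq)
      ((continuousOn_slice f _ _).continuousAt (Ioi_mem_nhds hq))
  have h3 : (fun t : ℝ => ext0 (antideriv hc f) (q.1.1, q.1.2.1, t)) =ᶠ[𝓝 q.1.2.2]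
      fun s : ℝ => ∫ t in c..s, ext0 f (q.1.1, q.1.2.1, t) := by
    filter_upwards [Ioi_mem_nhds hq] with s hs
    exact ext0_apply (antideriv hc f) ⟨(q.1.1, q.1.2.1, s), hs⟩
  rw [(h1.congr_of_eventuallyEq h3.symm).unique h2]
  exact ext0_apply f q

/-- A vector without u̲-component leaves the factor u̲ - c unchanged and translates every point of
the segment by itself, so differentiation passes to the integrand. -/
theorem dir_antideriv_of_tangent (f : Coef) (x y : ℝ) :
    dir (x, y, 0) (antideriv hc f) = antideriv hc (dir (x, y, 0) f) := by
  refine Coef.ext fun q => ?_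
  rw [dir_apply]
  set v : ℝ × ℝ × ℝ := (x, y, 0) with hv
  have hseg : ∀ θ ∈ Icc (0 : ℝ) 1, segmentPoint c (q.1, θ) ∈ HalfSpace :=
    fun θ hθ => segmentPoint_mem hc q.2 hθ
  have h1 := hasFDerivAt_integral_of_contDiffOn (isOpen_segmentPoint_preimage c)
    ((contDiffOn_comp_segmentPoint c f).of_le (by simp)) hseg
  have hs : HasFDerivAt (fun p : ℝ × ℝ × ℝ => ((p.2.2 - c : ℝ) : ℂ))
      (Complex.ofRealCLM.comp ((ContinuousLinearMap.snd ℝ ℝ ℝ).comp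
        (ContinuousLinearMap.snd ℝ ℝ (ℝ × ℝ)))) q.1 :=
    Complex.ofRealCLM.hasFDerivAt.comp q.1
      (((ContinuousLinearMap.snd ℝ ℝ ℝ).comp
        (ContinuousLinearMap.snd ℝ ℝ (ℝ × ℝ))).hasFDerivAt.sub_const c)
  have h3 : ext0 (antideriv hc f) =ᶠ[𝓝 q.1] fun p => ((p.2.2 - c : ℝ) : ℂ) *
      ∫ θ in (0 : ℝ)..1, ext0 f (segmentPoint c (p, θ)) := by
    filter_upwards [isOpen_halfSpace.mem_nhds q.2] with p hp
    rw [mul_integral_segment]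
    exact ext0_apply (antideriv hc f) ⟨p, hp⟩
  rw [(h3.hasFDerivAt_iff.2 (hs.mul h1)).fderiv]
  have hint : IntervalIntegrable (fun θ => (fderiv ℝ (fun z => ext0 f (segmentPoint c z))
      (q.1, θ)).comp (ContinuousLinearMap.inl ℝ (ℝ × ℝ × ℝ) ℝ)) volume 0 1 := by
    refine ContinuousOn.intervalIntegrable ?_
    rw [uIcc_of_le zero_le_one]
    refine ContinuousOn.clm_comp ?_ continuousOn_const
    exact ((contDiffOn_comp_segmentPoint c f).continuousOn_fderiv_of_isOpen
      (isOpen_segmentPoint_preimage c) (by simp)).comp (by fun_prop) fun θ hθ => hseg θ hθ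
  have hdir : ∀ θ ∈ Icc (0 : ℝ) 1, (fderiv ℝ (fun z => ext0 f (segmentPoint c z)) (q.1, θ))
      (v, 0) = ext0 (dir v f) (segmentPoint c (q.1, θ)) := by
    intro θ hθ
    have hin : HasFDerivAt (segmentPoint c) (fderiv ℝ (segmentPoint c) (q.1, θ)) (q.1, θ) :=
      ((contDiff_segmentPoint c).differentiable (by simp) _).hasFDerivAt
    have hline : HasDerivAt (fun t : ℝ => segmentPoint c ((q.1, θ) + t • (v, (0 : ℝ)))) v 0 := by
      have : (fun t : ℝ => segmentPoint c ((q.1, θ) + t • (v, (0 : ℝ)))) =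
          fun t : ℝ => segmentPoint c (q.1, θ) + t • v := by
        funext t
        simp [segmentPoint, hv]
      rw [this]
      simpa using ((hasDerivAt_id (0 : ℝ)).smul_const v).const_add (segmentPoint c (q.1, θ))
    have hline2 : HasDerivAt (fun t : ℝ => (q.1, θ) + t • (v, (0 : ℝ))) (v, 0) 0 := by
      simpa using ((hasDerivAt_id (0 : ℝ)).smul_const (v, (0 : ℝ))).const_add (q.1, θ)
    have heq : fderiv ℝ (segmentPoint c) (q.1, θ) (v, 0) = v :=
      HasDerivAt.unique (f := fun t : ℝ => segmentPoint c ((q.1, θ) + t • (v, (0 : ℝ))))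
        (hin.comp_hasDerivAt_of_eq (0 : ℝ) hline2 (by simp)) hline
    have hout := (differentiableAt f ⟨_, hseg θ hθ⟩).hasFDerivAt
    have hcomp := (hout.comp (q.1, θ) hin).fderiv
    rw [dir_eqOn v f (hseg θ hθ)]
    change (fderiv ℝ (ext0 f ∘ segmentPoint c) (q.1, θ)) (v, 0) = _
    rw [hcomp, ContinuousLinearMap.comp_apply, heq]
  rw [antideriv_apply, ← mul_integral_segment]
  simp only [_root_.add_apply, _root_.smul_apply, smul_eq_mul]
  rw [ContinuousLinearMap.intervalIntegral_apply hint]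
  have : ((Complex.ofRealCLM.comp ((ContinuousLinearMap.snd ℝ ℝ ℝ).comp
        (ContinuousLinearMap.snd ℝ ℝ (ℝ × ℝ)))) v) = 0 := by simp [hv]
  rw [this, mul_zero, add_zero]
  refine congrArg _ (intervalIntegral.integral_congr fun θ hθ => ?_)
  rw [uIcc_of_le zero_le_one] at hθ
  exact hdir θ hθ

theorem antideriv_zero : antideriv hc 0 = 0 := by
  refine Coef.ext fun q => ?_
  rw [antideriv_apply]
  have hq : 0 < q.1.2.2 := q.2
  refine (intervalIntegral.integral_congr (g := fun _ => (0 : ℂ))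
    fun t ht => ?_).trans (by simp; rfl)
  exact ext0_apply (0 : Coef) ⟨(q.1.1, q.1.2.1, t), lt_of_lt_of_le (lt_min hc hq) ht.1⟩

theorem antideriv_sub (f g : Coef) :
    antideriv hc (f - g) = antideriv hc f - antideriv hc g := by
  refine Coef.ext fun q => ?_
  have hq : 0 < q.1.2.2 := q.2
  rw [sub_apply, antideriv_apply, antideriv_apply, antideriv_apply,
    ← intervalIntegral.integral_sub (intervalIntegrable_slice f _ _ hc hq)
      (intervalIntegrable_slice g _ _ hc hq)]
  refine intervalIntegral.integral_congr fun t ht => ?_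
  have ht' : 0 < t := lt_of_lt_of_le (lt_min hc hq) ht.1
  have e := fun h : Coef => ext0_apply h ⟨(q.1.1, q.1.2.1, t), ht'⟩
  simp only at e
  rw [e, e, e, sub_apply]

theorem conj_antideriv (f : Coef) : conj (antideriv hc f) = antideriv hc (conj f) := by
  refine Coef.ext fun q => ?_
  have hq : 0 < q.1.2.2 := q.2
  rw [conj_apply, antideriv_apply, antideriv_apply]
  have h := Complex.conjCLE.toContinuousLinearMap.intervalIntegral_comp_comm
    (intervalIntegrable_slice f q.1.1 q.1.2.1 hc hq)
  refine (h.symm.trans (intervalIntegral.integral_congr fun t ht => ?_))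
  have ht' : 0 < t := lt_of_lt_of_le (lt_min hc hq) ht.1
  have e := fun h : Coef => ext0_apply h ⟨(q.1.1, q.1.2.1, t), ht'⟩
  simp only at e
  simp only [e]
  rfl

/-- Since c < u₀, the path from c to a point below u₀ stays below u₀. -/
theorem vanishesBelow_antideriv {u₀ : ℝ} (hcu : c < u₀) {f : Coef} (hf : VanishesBelow u₀ f) :
    VanishesBelow u₀ (antideriv hc f) := by
  intro q hq
  have hq0 : 0 < q.1.2.2 := q.2
  rw [antideriv_apply]
  refine (intervalIntegral.integral_congr (g := fun _ => (0 : ℂ)) fun t ht => ?_).trans (by simp)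
  have ht' : 0 < t := lt_of_lt_of_le (lt_min hc hq0) ht.1
  exact (ext0_apply f ⟨(q.1.1, q.1.2.1, t), ht'⟩).trans
    (hf _ (lt_of_le_of_lt ht.2 (max_lt hcu hq)))

/-- Every u̲-line reaches the region where f vanishes, and f is constant along it. This is the
uniqueness behind each integration, for the field and for the residuals. -/
theorem eq_zero_of_dir_eq_zero {u₀ : ℝ} (hu₀ : 0 < u₀) {f : Coef} (hf : VanishesBelow u₀ f)
    (h : dir (0, 0, 1) f = 0) : f = 0 := by
  refine Coef.ext fun q => ?_
  have hq : 0 < q.1.2.2 := q.2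
  have hder : ∀ t : ℝ, 0 < t →
      HasDerivAt (fun t : ℝ => ext0 f (q.1.1, q.1.2.1, t)) 0 t := fun t ht => by
    simpa [h, zero_apply] using hasDerivAt_slice f ⟨(q.1.1, q.1.2.1, t), ht⟩
  have hm : 0 < min (u₀ / 2) q.1.2.2 := lt_min (by linarith) hq
  have hconst : ext0 f (q.1.1, q.1.2.1, q.1.2.2) =
      ext0 f (q.1.1, q.1.2.1, min (u₀ / 2) q.1.2.2) := by
    refine (isOpen_Ioi (a := (0 : ℝ))).is_const_of_deriv_eq_zero isPreconnected_Ioi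
      (f := fun t : ℝ => ext0 f (q.1.1, q.1.2.1, t))
      (fun t ht => (hder t ht).differentiableAt.differentiableWithinAt)
      (fun t ht => (hder t ht).deriv) hq hm
  have h0 := hf ⟨(q.1.1, q.1.2.1, min (u₀ / 2) q.1.2.2), hm⟩
    (lt_of_le_of_lt (min_le_left _ _) (by linarith))
  rw [← ext0_apply f] at h0
  rw [← ext0_apply f q, zero_apply]
  exact hconst.trans h0

theorem vanishesBelow_dir {u₀ : ℝ} {f : Coef} (hf : VanishesBelow u₀ f) (v : ℝ × ℝ × ℝ) :
    VanishesBelow u₀ (dir v f) := by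
  intro q hq
  have h : ext0 f =ᶠ[𝓝 q.1] fun _ => (0 : ℂ) := by
    have ho : IsOpen {p : ℝ × ℝ × ℝ | p.2.2 < u₀} :=
      isOpen_lt (continuous_snd.comp continuous_snd) continuous_const
    filter_upwards [isOpen_halfSpace.mem_nhds q.2, ho.mem_nhds hq] with p hp hpu
    exact (ext0_apply f ⟨p, hp⟩).trans (hf ⟨p, hp⟩ hpu)
  rw [dir_apply, h.fderiv_eq]
  simp

theorem antideriv_dir {u₀ : ℝ} (hcu : c < u₀) {f : Coef} (hf : VanishesBelow u₀ f) :
    antideriv hc (dir (0, 0, 1) f) = f := by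
  rw [← sub_eq_zero]
  refine eq_zero_of_dir_eq_zero (hc.trans hcu) (fun q hq => ?_) ?_
  · rw [sub_apply, hf q hq, vanishesBelow_antideriv hc hcu (vanishesBelow_dir hf _) q hq, sub_zero]
  · rw [map_sub, dir_antideriv, sub_self]

/-! ### Ideals stable under the operations of the recursion -/

/-- The ideals of functions that are stable under conjugation, derivatives and `∫_c^{u̲}`. -/
structure IsStable (J : Ideal Coef) : Prop where
  conj : ∀ f ∈ J, Coef.conj f ∈ J
  dir : ∀ f ∈ J, ∀ v, Coef.dir v f ∈ J
  antideriv : ∀ f ∈ J, antideriv hc f ∈ J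

theorem isStable_bot : IsStable hc ⊥ where
  conj f hf := by simp_all
  dir f hf v := by simp_all
  antideriv f hf := by simp_all [antideriv_zero]

/-- The ideal of functions that vanish for `u̲ < u₀`. -/
def vanishingIdeal (u₀ : ℝ) : Ideal Coef where
  carrier := {f | VanishesBelow u₀ f}
  add_mem' {f g} hf hg q hq := by rw [add_apply, hf q hq, hg q hq, add_zero]
  zero_mem' _ _ := rfl
  smul_mem' f g hg q hq := by rw [smul_eq_mul, mul_apply, hg q hq, mul_zero]

theorem isStable_vanishingIdeal {u₀ : ℝ} (hcu : c < u₀) : IsStable hc (vanishingIdeal u₀) where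
  conj f hf q hq := by rw [conj_apply, hf q hq, star_zero]
  dir f hf v := vanishesBelow_dir hf v
  antideriv f hf := vanishesBelow_antideriv hc hcu hf

/-- An iterated derivative in the directions of a list of vectors. -/
def dirs (l : List (ℝ × ℝ × ℝ)) (f : Coef) : Coef := l.foldr (fun v g => dir v g) f

theorem dirs_add (l : List (ℝ × ℝ × ℝ)) (f g : Coef) : dirs l (f + g) = dirs l f + dirs l g := by
  induction l with
  | nil => rfl
  | cons v l ih => simpa [dirs] using (congrArg (dir v) ih).trans (map_add _ _ _)

theorem dirs_sub (l : List (ℝ × ℝ × ℝ)) (f g : Coef) : dirs l (f - g) = dirs l f - dirs l g := by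
  induction l with
  | nil => rfl
  | cons v l ih => simpa [dirs] using (congrArg (dir v) ih).trans (map_sub _ _ _)

theorem dirs_zero (l : List (ℝ × ℝ × ℝ)) : dirs l 0 = 0 := by
  simpa using dirs_sub l 0 0

theorem dir_dirs (v : ℝ × ℝ × ℝ) (l : List (ℝ × ℝ × ℝ)) (f : Coef) :
    dir v (dirs l f) = dirs l (dir v f) := by
  induction l with
  | nil => rfl
  | cons w l ih =>
    change dir v (dir w (dirs l f)) = dir w (dirs l (dir v f))
    rw [dir_comm, ih]

theorem conj_dirs (l : List (ℝ × ℝ × ℝ)) (f : Coef) : Coef.conj (dirs l f) = dirs l (Coef.conj f)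
    := by
  induction l with
  | nil => rfl
  | cons w l ih =>
    change Coef.conj (dir w (dirs l f)) = dir w (dirs l (Coef.conj f))
    rw [conj_dir, ih]

/-- Translates the hypothesis of agreement of all derivatives into iterated directional derivatives,
which remain in `Coef` and commute with `dir` and `conj`. -/
theorem dirs_apply_eq_iteratedFDeriv (l : List (ℝ × ℝ × ℝ)) (f : Coef) (q : HalfSpace) :
    dirs l f q = iteratedFDeriv ℝ l.length (ext0 f) q l.get := by
  induction l generalizing q with
  | nil => simp [dirs, ext0_apply]
  | cons v l ih =>
    have hd : DifferentiableAt ℝ (iteratedFDeriv ℝ l.length (ext0 f)) q :=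
      (((Coef.contDiffOn f).contDiffAt (isOpen_halfSpace.mem_nhds
          q.2))).differentiableAt_iteratedFDeriv
        (by exact_mod_cast ENat.natCast_lt_top _)
    have h : ext0 (dirs l f) =ᶠ[𝓝 q.1] fun x => iteratedFDeriv ℝ l.length (ext0 f) x l.get := by
      filter_upwards [isOpen_halfSpace.mem_nhds q.2] with p hp
      exact (ext0_apply (dirs l f) ⟨p, hp⟩).trans (ih ⟨p, hp⟩)
    change dir v (dirs l f) q = _
    rw [dir_apply, h.fderiv_eq]
    rw [fderiv_continuousMultilinear_apply_const_apply hd]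
    rfl

/-- The ideal of functions whose derivatives of all orders vanish along `{ξ} × (0, u̲]` and that
vanish for `u̲ < u₀`. -/
def segmentIdeal (q : HalfSpace) (u₀ : ℝ) : Ideal Coef where
  carrier := {f | VanishesBelow u₀ f ∧
    ∀ l (p : HalfSpace), p.1.1 = q.1.1 → p.1.2.1 = q.1.2.1 → p.1.2.2 ≤ q.1.2.2 → dirs l f p = 0}
  add_mem' {f g} hf hg := ⟨(vanishingIdeal u₀).add_mem hf.1 hg.1, fun l p h1 h2 h3 => by
    rw [dirs_add, add_apply, hf.2 l p h1 h2 h3, hg.2 l p h1 h2 h3, add_zero]⟩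
  zero_mem' := ⟨(vanishingIdeal u₀).zero_mem, fun l p _ _ _ => by rw [dirs_zero, zero_apply]⟩
  smul_mem' f g hg := ⟨(vanishingIdeal u₀).mul_mem_left f hg.1, fun l => by
    replace hg := hg.2
    rw [smul_eq_mul]
    -- Leibniz rule: each derivative falls on either factor, so both factors must vary in the
    -- induction.
    induction l generalizing f g with
    | nil => intro p h1 h2 h3; change f p * g p = 0; rw [show g p = 0 from hg [] p h1 h2 h3,
          mul_zero]
    | cons v l ih =>
      intro p h1 h2 h3
      change dir v (dirs l (f * g)) p = 0
      rw [dir_dirs, dir_mul, dirs_add, add_apply, ih (dir v f) g hg p h1 h2 h3,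
        ih f (dir v g) (fun l' p h1 h2 h3 => by rw [← dir_dirs]; exact hg (v :: l') p h1 h2 h3)
          p h1 h2 h3, add_zero]⟩

theorem apply_eq_zero_of_mem_segmentIdeal {q : HalfSpace} {u₀ : ℝ} {f : Coef}
    (hf : f ∈ segmentIdeal q u₀) : f q = 0 := hf.2 [] q rfl rfl le_rfl

theorem sub_mem_segmentIdeal {q : HalfSpace} {u₀ : ℝ} {f g : Coef} (hf : VanishesBelow u₀ f)
    (hg : VanishesBelow u₀ g) (h : AgreeAlongSegment f g q) : f - g ∈ segmentIdeal q u₀ := by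
  refine ⟨(vanishingIdeal u₀).sub_mem hf hg, fun l p h1 h2 h3 => ?_⟩
  have := h p.1.2.2 p.2 h3 l.length
  rw [← h1, ← h2] at this
  rw [dirs_sub, sub_apply, dirs_apply_eq_iteratedFDeriv, dirs_apply_eq_iteratedFDeriv]
  exact sub_eq_zero.2 (congrArg (fun T => T l.get) this)

/-- Directional derivatives commute with `∫_c^{u̲}` up to terms without an integral. -/
theorem dir_antideriv_eq (v : ℝ × ℝ × ℝ) (f : Coef) : dir v (antideriv hc f) =
    antideriv hc (dir (v.1, v.2.1, 0) f) + (v.2.2 : ℂ) • f := by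
  have h1 : ∀ g : Coef, dir v g = dir (v.1, v.2.1, 0) g + (v.2.2 : ℂ) • dir (0, 0, 1) g := by
    intro g
    refine Coef.ext fun p => ?_
    have hv : v = (v.1, v.2.1, 0) + v.2.2 • ((0 : ℝ), (0 : ℝ), (1 : ℝ)) := by
      ext <;> simp
    rw [add_apply, smul_apply, dir_apply, dir_apply, dir_apply]
    conv_lhs => rw [hv]
    rw [map_add, map_smul, Complex.real_smul]
  rw [h1, dir_antideriv_of_tangent, dir_antideriv]

/-- The path of integration from c to a point of the segment can leave the segment only upwards,
when u̲ < c. There its heights are at most c < u₀ and f vanishes, which is why the ideal also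
demands vanishing below u₀. Derivatives of the integral reduce to this case by `dir_antideriv_eq`.
-/
theorem isStable_segmentIdeal {u₀ : ℝ} (hcu : c < u₀) (q : HalfSpace) :
    IsStable hc (segmentIdeal q u₀) where
  conj f hf := ⟨(isStable_vanishingIdeal hc hcu).conj f hf.1, fun l p h1 h2 h3 => by
    rw [← conj_dirs, conj_apply, hf.2 l p h1 h2 h3, star_zero]⟩
  dir f hf v := ⟨vanishesBelow_dir hf.1 v, fun l p h1 h2 h3 => by
    rw [← dir_dirs]; exact hf.2 (v :: l) p h1 h2 h3⟩
  antideriv f hf := ⟨vanishesBelow_antideriv hc hcu hf.1, fun l => by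
    induction l generalizing f with
    | nil =>
      intro p h1 h2 h3
      have hp0 : 0 < p.1.2.2 := p.2
      change antideriv hc f p = 0
      rw [antideriv_apply]
      refine (intervalIntegral.integral_congr (g := fun _ => (0 : ℂ)) fun t ht => ?_).trans (by
          simp)
      have ht0 : 0 < t := lt_of_lt_of_le (lt_min hc hp0) ht.1
      refine (ext0_apply f ⟨(p.1.1, p.1.2.1, t), ht0⟩).trans ?_
      rcases le_or_gt t p.1.2.2 with htp | htp
      · exact hf.2 [] _ h1 h2 (htp.trans h3)
      · refine hf.1 _ (lt_of_le_of_lt ((le_max_iff.1 ht.2).resolve_right (not_le.2 htp)) hcu)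
    | cons v l ih =>
      intro p h1 h2 h3
      change dir v (dirs l (antideriv hc f)) p = 0
      rw [dir_dirs, dir_antideriv_eq, dirs_add, add_apply,
        ih _ ⟨vanishesBelow_dir hf.1 _, fun l' p h1 h2 h3 => by
          rw [← dir_dirs]; exact hf.2 (_ :: l') p h1 h2 h3⟩ p h1 h2 h3, zero_add]
      have : (v.2.2 : ℂ) • f ∈ segmentIdeal q u₀ := by
        rw [Algebra.smul_def]; exact Ideal.mul_mem_left _ _ hf
      exact this.2 l p h1 h2 h3⟩

end Coef

end FarField

end

noncomputable section

namespace FarField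

/-! ### Coefficients of formal series -/

theorem coeff_upow_mul (n m : ℤ) (x : FSeries) : (upow n * x).coeff m = x.coeff (m + n) := by
  rw [upow, HahnSeries.coeff_single_mul, one_mul, sub_neg_eq_add]

theorem upow_mul_upow (m n : ℤ) : upow m * upow n = upow (m + n) := by
  rw [upow, upow, upow, HahnSeries.single_mul_single, one_mul, neg_add]

theorem upow_zero : upow 0 = 1 := by simp [upow]

theorem upow_mul_cancel {x y : FSeries} (n : ℤ) (h : upow n * x = upow n * y) : x = y := by
  have := congrArg (upow (-n) * ·) h
  simpa [← mul_assoc, upow_mul_upow, upow_zero] using this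

theorem coeff_ofCoef_mul (f : Coef) (x : FSeries) (n : ℤ) :
    (ofCoef f * x).coeff n = f * x.coeff n := by
  simp [ofCoef, HahnSeries.C_apply]

theorem coeff_ofSeq (ψ : ℕ → Coef) (k : ℕ) : (ofSeq ψ).coeff k = ψ k := by
  rw [ofSeq, HahnSeries.ofPowerSeries_apply_coeff, PowerSeries.coeff_mk]

theorem coeff_ofSeq_of_neg (ψ : ℕ → Coef) {n : ℤ} (hn : n < 0) : (ofSeq ψ).coeff n = 0 := by
  rw [ofSeq, PowerSeries.coeff_coe, if_pos hn]

theorem coeff_bar (x : FSeries) (n : ℤ) : (bar x).coeff n = Coef.conj (x.coeff n) := rfl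

theorem coeff_partialD_u (x : FSeries) (n : ℤ) :
    (partialD .u x).coeff n = -((n - 1) • x.coeff (n - 1)) := by
  change (-(upow (-2) * LaurentSeries.derivative Coef x)).coeff n = _
  rw [HahnSeries.coeff_neg, coeff_upow_mul, LaurentSeries.derivative_apply,
    LaurentSeries.hasseDeriv_coeff]
  have e : n + -2 + 1 = n - 1 := by ring
  push_cast
  rw [e]
  simp

theorem partialD_add (μ : Coord) (x y : FSeries) :
    partialD μ (x + y) = partialD μ x + partialD μ y := by
  cases μ
  case u => simp only [partialD, map_add, mul_add, neg_add]
  all_goals exact HahnSeries.ext (funext fun n => map_add _ _ _)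

/-- A family of additive maps of the coefficients, applied degree by degree, is a derivation of
formal series if it satisfies the Leibniz rule. -/
theorem leibniz_of_coeff {T : FSeries → FSeries} (δ : ℤ → Coef → Coef)
    (hT : ∀ x n, (T x).coeff n = δ n (x.coeff n)) (h0 : ∀ n, δ n 0 = 0)
    (hadd : ∀ n f g, δ n (f + g) = δ n f + δ n g)
    (hmul : ∀ i j f g, δ (i + j) (f * g) = δ i f * g + f * δ j g) (x y : FSeries) :
    T (x * y) = T x * y + x * T y := by
  -- T does not enlarge supports, so the Cauchy sums of all three products run over one index set.
  have hs : ∀ z, (T z).support ⊆ z.support := fun z n hn hz => hn (by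
    replace hz : z.coeff n = 0 := hz; rw [hT, hz, h0])
  refine HahnSeries.ext (funext fun n => ?_)
  rw [hT, HahnSeries.coeff_add, HahnSeries.coeff_mul,
    HahnSeries.coeff_mul_left' x.isPWO_support (hs x),
    HahnSeries.coeff_mul_right' y.isPWO_support (hs y), ← Finset.sum_add_distrib]
  have hsum : ∀ (s : Finset (ℤ × ℤ)) (F : ℤ × ℤ → Coef),
      δ n (∑ i ∈ s, F i) = ∑ i ∈ s, δ n (F i) := fun s F =>
    map_sum (AddMonoidHom.mk' (δ n) (hadd n)) F s
  rw [hsum]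
  refine Finset.sum_congr rfl fun ij hij => ?_
  rw [hT, hT, ← hmul, (Finset.mem_antidiagonal.1 hij).2.2]

/-- ∂_u shifts degrees, so `leibniz_of_coeff` does not apply to it. Up to the factor -1/u it is the
Euler operator of the variable 1/u, which preserves degrees. -/
theorem partialD_u_eq : ∃ T : FSeries → FSeries,
    (∀ y, partialD .u y = -(upow (-1) * T y)) ∧ ∀ y n, (T y).coeff n = n • y.coeff n := by
  refine ⟨fun y => -(upow 1 * partialD .u y), fun y => ?_, fun y n => ?_⟩
  · rw [mul_neg, ← mul_assoc, upow_mul_upow]; simp [upow_zero]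
  · rw [HahnSeries.coeff_neg, coeff_upow_mul, coeff_partialD_u]; simp

theorem partialD_mul (μ : Coord) (x y : FSeries) :
    partialD μ (x * y) = partialD μ x * y + x * partialD μ y := by
  cases μ
  case u =>
    obtain ⟨T, hT, hc⟩ := partialD_u_eq
    rw [hT, hT, hT, leibniz_of_coeff (T := T) (fun n f => n • f) hc (fun n => smul_zero n)
      (fun n f g => smul_add n f g) (fun i j f g => by
        simp only [zsmul_eq_mul]; push_cast; ring)]
    ring
  all_goals
    exact leibniz_of_coeff (fun _ f => Coef.dir _ f) (fun _ _ => rfl) (fun _ => map_zero _)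
      (fun _ => map_add _) (fun _ _ => Coef.dir_mul _) x y

theorem partialD_neg (μ : Coord) (x : FSeries) : partialD μ (-x) = -partialD μ x := by
  have h := partialD_add μ x (-x)
  have h0 : partialD μ (0 : FSeries) = 0 := by simpa using partialD_add μ 0 0
  rw [add_neg_cancel, h0] at h
  exact (neg_eq_of_add_eq_zero_right h.symm).symm

theorem partialD_sub (μ : Coord) (x y : FSeries) :
    partialD μ (x - y) = partialD μ x - partialD μ y := by
  rw [sub_eq_add_neg, partialD_add, partialD_neg, sub_eq_add_neg]

theorem partialD_zero (μ : Coord) : partialD μ 0 = 0 := by simpa using partialD_add μ 0 0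

theorem partialD_one (μ : Coord) : partialD μ 1 = 0 := by simpa using partialD_mul μ 1 1

theorem partialD_ofNat (μ : Coord) (n : ℕ) [n.AtLeastTwo] :
    partialD μ (ofNat(n) : FSeries) = 0 := by
  have h : ∀ m : ℕ, partialD μ (m : FSeries) = 0 := fun m => by
    induction m with
    | zero => simpa using partialD_zero μ
    | succ m ih => rw [Nat.cast_succ, partialD_add, ih, partialD_one, add_zero]
  exact h n

theorem bar_add (x y : FSeries) : bar (x + y) = bar x + bar y :=
  HahnSeries.ext (funext fun _ => map_add Coef.conj _ _)

theorem bar_sub (x y : FSeries) : bar (x - y) = bar x - bar y :=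
  HahnSeries.ext (funext fun _ => map_sub Coef.conj _ _)

theorem bar_neg (x : FSeries) : bar (-x) = -bar x :=
  HahnSeries.ext (funext fun _ => map_neg Coef.conj _)

theorem bar_zero : bar 0 = 0 := HahnSeries.ext (funext fun _ => map_zero Coef.conj)

theorem bar_mul (x y : FSeries) : bar (x * y) = bar x * bar y := by
  have hs : ∀ z, (bar z).support ⊆ z.support := fun z n hn hz => hn (by
    replace hz : z.coeff n = 0 := hz; rw [coeff_bar, hz, map_zero])
  refine HahnSeries.ext (funext fun n => ?_)
  rw [coeff_bar, HahnSeries.coeff_mul, map_sum,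
    HahnSeries.coeff_mul_left' x.isPWO_support (hs x)]
  refine Finset.sum_subset_zero_on_sdiff ?_ ?_ ?_ |>.symm
  · intro ij hij
    rw [Finset.mem_antidiagonal] at hij ⊢
    exact ⟨hij.1, hs y hij.2.1, hij.2.2⟩
  · intro ij hij
    rw [Finset.mem_sdiff, Finset.mem_antidiagonal, Finset.mem_antidiagonal] at hij
    have hy : (bar y).coeff ij.2 = 0 := by
      by_contra hne
      exact hij.2 ⟨hij.1.1, hne, hij.1.2.2⟩
    rw [map_mul, ← coeff_bar y, hy, mul_zero]
  · intro ij _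
    rw [map_mul, coeff_bar, coeff_bar]

theorem bar_bar (x : FSeries) : bar (bar x) = x :=
  HahnSeries.ext (funext fun _ => Coef.conj_conj _)

theorem bar_one : bar 1 = 1 := by
  have h := bar_mul (bar 1) 1
  simpa [bar_bar] using h.symm

theorem bar_ofNat (n : ℕ) [n.AtLeastTwo] : bar (ofNat(n) : FSeries) = ofNat(n) := by
  have h : ∀ m : ℕ, bar (m : FSeries) = m := fun m => by
    induction m with
    | zero => simpa using bar_zero
    | succ m ih => rw [Nat.cast_succ, bar_add, ih, bar_one]
  exact h n

theorem map_C_of_zero {F : Type*} [FunLike F Coef Coef] [ZeroHomClass F Coef Coef] (T : F)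
    (f : Coef) : HahnSeries.map (ofCoef f) T = ofCoef (T f) := by
  refine HahnSeries.ext (funext fun n => ?_)
  rw [HahnSeries.map_coeff, ofCoef, ofCoef, HahnSeries.C_apply, HahnSeries.C_apply,
    HahnSeries.coeff_single, HahnSeries.coeff_single]
  split_ifs
  · rfl
  · exact map_zero T

theorem bar_ofCoef (f : Coef) : bar (ofCoef f) = ofCoef (Coef.conj f) :=
  map_C_of_zero Coef.conj f

theorem bar_cst (c : ℂ) : bar (cst c) = cst (star c) := by
  rw [cst, bar_ofCoef, Coef.conj_algebraMap]; rfl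

theorem bar_upow (n : ℤ) : bar (upow n) = upow n := by
  refine HahnSeries.ext (funext fun m => ?_)
  rw [coeff_bar, upow, HahnSeries.coeff_single]
  split_ifs <;> simp

theorem bar_partialD (μ : Coord) (x : FSeries) : bar (partialD μ x) = partialD μ (bar x) := by
  refine HahnSeries.ext (funext fun n => ?_)
  cases μ
  case u => rw [coeff_bar, coeff_partialD_u, coeff_partialD_u, map_neg, map_zsmul]; rfl
  all_goals exact Coef.conj_dir _ _

theorem partialD_comm (μ ν : Coord) (x : FSeries) :
    partialD μ (partialD ν x) = partialD ν (partialD μ x) := by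
  refine HahnSeries.ext (funext fun n => ?_)
  have h : ∀ v m (f : Coef), Coef.dir v (-(m • f)) = -((m : ℤ) • Coef.dir v f) := fun v m f => by
    rw [map_neg, map_zsmul]
  cases μ <;> cases ν
  case u.u => rfl
  case u.xi1 => rw [coeff_partialD_u]; exact (h _ _ _).symm.trans (congrArg _ (coeff_partialD_u x
        n).symm)
  case u.xi2 => rw [coeff_partialD_u]; exact (h _ _ _).symm.trans (congrArg _ (coeff_partialD_u x
        n).symm)
  case u.ub => rw [coeff_partialD_u]; exact (h _ _ _).symm.trans (congrArg _ (coeff_partialD_u x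
        n).symm)
  case xi1.u => rw [coeff_partialD_u]; exact ((h _ _ _).symm.trans (congrArg _ (coeff_partialD_u x
        n).symm)).symm
  case xi2.u => rw [coeff_partialD_u]; exact ((h _ _ _).symm.trans (congrArg _ (coeff_partialD_u x
        n).symm)).symm
  case ub.u => rw [coeff_partialD_u]; exact ((h _ _ _).symm.trans (congrArg _ (coeff_partialD_u x
        n).symm)).symm
  all_goals exact Coef.dir_comm _ _ _

theorem partialD_ofCoef_xi1 (f : Coef) : partialD .xi1 (ofCoef f) = ofCoef (Coef.dir (1, 0, 0) f) :=
  map_C_of_zero _ _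
theorem partialD_ofCoef_xi2 (f : Coef) : partialD .xi2 (ofCoef f) = ofCoef (Coef.dir (0, 1, 0) f) :=
  map_C_of_zero _ _
theorem partialD_ofCoef_ub (f : Coef) : partialD .ub (ofCoef f) = ofCoef (Coef.dir (0, 0, 1) f) :=
  map_C_of_zero _ _

theorem partialD_ofCoef_u (f : Coef) : partialD .u (ofCoef f) = 0 := by
  refine HahnSeries.ext (funext fun n => ?_)
  rw [coeff_partialD_u, ofCoef, HahnSeries.C_apply, HahnSeries.coeff_single]
  split_ifs with h <;> simp [h]

theorem partialD_cst (μ : Coord) (c : ℂ) : partialD μ (cst c) = 0 := by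
  have h0 : ofCoef 0 = 0 := map_zero HahnSeries.C
  cases μ
  case u => exact partialD_ofCoef_u _
  case xi1 => rw [cst, partialD_ofCoef_xi1, Coef.dir_algebraMap, h0]
  case xi2 => rw [cst, partialD_ofCoef_xi2, Coef.dir_algebraMap, h0]
  case ub => rw [cst, partialD_ofCoef_ub, Coef.dir_algebraMap, h0]

theorem coeff_upow (n m : ℤ) : (upow n).coeff m = if m = -n then 1 else 0 := by
  rw [upow, HahnSeries.coeff_single]
  split_ifs <;> rfl

theorem partialD_upow_u (n : ℤ) : partialD .u (upow n) = n * upow (n - 1) := by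
  refine HahnSeries.ext (funext fun m => ?_)
  rw [coeff_partialD_u, ← zsmul_eq_mul, HahnSeries.coeff_smul, coeff_upow, coeff_upow]
  by_cases h : m = -(n - 1)
  · rw [if_pos (by omega), if_pos h, ← neg_smul]
    congr 1
    omega
  · rw [if_neg (by omega), if_neg h, smul_zero, smul_zero, neg_zero]

theorem partialD_upow_of_ne (n : ℤ) {μ : Coord} (h : μ ≠ .u) : partialD μ (upow n) = 0 := by
  have : ∀ v, HahnSeries.map (upow n) (Coef.dir v) = 0 := fun v => by
    refine HahnSeries.ext (funext fun m => ?_)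
    change Coef.dir v ((upow n).coeff m) = 0
    rw [coeff_upow]
    split_ifs
    · exact Coef.dir_one v
    · exact map_zero _
  cases μ
  case u => exact absurd rfl h
  all_goals exact this _

/-! ### Series with coefficients in an ideal up to a given order -/

/-- The coefficients of index less than `d` belong to the ideal `J`. -/
def Below (J : Ideal Coef) (d : ℤ) (x : FSeries) : Prop := ∀ n < d, x.coeff n ∈ J

namespace Below

variable {J : Ideal Coef} {d e : ℤ} {x y : FSeries}

theorem mono (h : Below J d x) (he : e ≤ d) : Below J e x := fun n hn => h n (hn.trans_le he)

theorem zero : Below J d 0 := fun _ _ => J.zero_mem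

theorem add (hx : Below J d x) (hy : Below J d y) : Below J d (x + y) :=
  fun n hn => J.add_mem (hx n hn) (hy n hn)

theorem sub (hx : Below J d x) (hy : Below J d y) : Below J d (x - y) :=
  fun n hn => J.sub_mem (hx n hn) (hy n hn)

theorem neg (hx : Below J d x) : Below J d (-x) := fun n hn => J.neg_mem (hx n hn)

theorem of_bot (hx : Below ⊥ d x) : Below J d x := fun n hn => by
  rw [(Ideal.mem_bot).1 (hx n hn)]; exact J.zero_mem

/-- In a term of the Cauchy product of index below d + e, either the first index is below d, or the
second is below e, where y vanishes. -/
theorem mul (hx : Below J d x) (hy : Below ⊥ e y) : Below J (d + e) (x * y) := fun n hn => by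
  rw [HahnSeries.coeff_mul]
  refine J.sum_mem fun ij hij => ?_
  have h := (Finset.mem_antidiagonal.1 hij).2.2
  rcases lt_or_ge ij.1 d with h1 | h1
  · exact J.mul_mem_right _ (hx _ h1)
  · rw [(Ideal.mem_bot).1 (hy ij.2 (by omega)), mul_zero]; exact J.zero_mem

theorem mul' (hx : Below ⊥ e x) (hy : Below J d y) : Below J (e + d) (x * y) := by
  rw [mul_comm, add_comm]; exact hy.mul hx

theorem bar (hJ : ∀ f ∈ J, Coef.conj f ∈ J) (hx : Below J d x) : Below J d (bar x) :=
  fun n hn => hJ _ (hx n hn)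

theorem partialD (hJ : ∀ f ∈ J, ∀ v, Coef.dir v f ∈ J) (hx : Below J d x) (μ : Coord) :
    Below J d (partialD μ x) := by
  intro n hn
  cases μ
  case u =>
    rw [coeff_partialD_u]
    exact J.neg_mem (zsmul_mem (hx _ (by omega)) _)
  all_goals exact hJ _ (hx n hn) _

theorem partialD_u (hx : Below J d x) : Below J (d + 1) (FarField.partialD .u x) := by
  intro n hn
  rw [coeff_partialD_u]
  exact J.neg_mem (zsmul_mem (hx _ (by omega)) _)

end Below

theorem exists_below_bot (x : FSeries) : ∃ d, Below ⊥ d x :=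
  ⟨x.order, fun _ hn => (Ideal.mem_bot).2 (HahnSeries.coeff_eq_zero_of_lt_order hn)⟩

theorem eq_zero_of_forall_below {x : FSeries} (h : ∀ d, Below ⊥ d x) : x = 0 :=
  HahnSeries.ext (funext fun n => (Ideal.mem_bot).1 (h (n + 1) n (by omega)))

theorem below_bot_upow (n : ℤ) : Below ⊥ (-n) (upow n) := fun m hm => by
  rw [coeff_upow, if_neg (by omega)]; exact Submodule.zero_mem _

theorem below_bot_ofCoef (f : Coef) : Below ⊥ 0 (ofCoef f) := fun m hm => by
  rw [ofCoef, HahnSeries.C_apply, HahnSeries.coeff_single_of_ne (by omega)]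
  exact Submodule.zero_mem _

theorem below_bot_ofNat (n : ℕ) [n.AtLeastTwo] : Below ⊥ 0 (ofNat(n) : FSeries) := by
  have : (ofNat(n) : FSeries) = ofCoef (OfNat.ofNat n) := (map_ofNat HahnSeries.C n).symm
  rw [this]
  exact below_bot_ofCoef _

theorem below_bot_one : Below ⊥ 0 (1 : FSeries) := by
  have : (1 : FSeries) = ofCoef 1 := (map_one HahnSeries.C).symm
  rw [this]
  exact below_bot_ofCoef _

theorem below_bot_ofSeq (ψ : ℕ → Coef) : Below ⊥ 0 (ofSeq ψ) := fun _ hm =>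
  (Ideal.mem_bot).2 (coeff_ofSeq_of_neg ψ hm)

end FarField

end

noncomputable section

namespace FarField

/-! ### The frame derivations of a field -/

section Frame

variable (Φ : Comp → FSeries) (x y : FSeries)

theorem two_mul_re : 2 * re x = x + bar x := by
  have h : (2 : FSeries) * cst (1 / 2) = 1 := by
    have h2 : (2 : FSeries) = cst 2 := by
      rw [cst, ofCoef, map_ofNat, map_ofNat]
    rw [h2, cst, cst, ofCoef, ofCoef, ← map_mul, ← map_mul]
    norm_num
  rw [re, ← mul_assoc, h, one_mul]

theorem opD_add : opD Φ (x + y) = opD Φ x + opD Φ y := by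
  simp only [opD, symD, partialD_add]; ring
theorem opD_sub : opD Φ (x - y) = opD Φ x - opD Φ y := by
  simp only [opD, symD, partialD_sub]; ring
theorem opD_neg : opD Φ (-x) = -opD Φ x := by
  simp only [opD, symD, partialD_neg]; ring
theorem opD_mul : opD Φ (x * y) = opD Φ x * y + x * opD Φ y := by
  simp only [opD, symD, partialD_mul]; ring
theorem opD_ofNat (n : ℕ) [n.AtLeastTwo] : opD Φ ofNat(n) = 0 := by
  simp only [opD, symD, partialD_ofNat]; ring

theorem opDbar_add : opDbar Φ (x + y) = opDbar Φ x + opDbar Φ y := by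
  simp only [opDbar, symDbar, partialD_add]; ring
theorem opDbar_sub : opDbar Φ (x - y) = opDbar Φ x - opDbar Φ y := by
  simp only [opDbar, symDbar, partialD_sub]; ring
theorem opDbar_neg : opDbar Φ (-x) = -opDbar Φ x := by
  simp only [opDbar, symDbar, partialD_neg]; ring
theorem opDbar_mul : opDbar Φ (x * y) = opDbar Φ x * y + x * opDbar Φ y := by
  simp only [opDbar, symDbar, partialD_mul]; ring
theorem opDbar_ofNat (n : ℕ) [n.AtLeastTwo] : opDbar Φ ofNat(n) = 0 := by
  simp only [opDbar, symDbar, partialD_ofNat]; ring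

theorem opN_add : opN Φ (x + y) = opN Φ x + opN Φ y := by
  simp only [opN, symN, partialD_add]; ring
theorem opN_sub : opN Φ (x - y) = opN Φ x - opN Φ y := by
  simp only [opN, symN, partialD_sub]; ring
theorem opN_neg : opN Φ (-x) = -opN Φ x := by
  simp only [opN, symN, partialD_neg]; ring
theorem opN_mul : opN Φ (x * y) = opN Φ x * y + x * opN Φ y := by
  simp only [opN, symN, partialD_mul]; ring
theorem opN_ofNat (n : ℕ) [n.AtLeastTwo] : opN Φ ofNat(n) = 0 := by
  simp only [opN, symN, partialD_ofNat]; ring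

theorem opL_add : opL Φ (x + y) = opL Φ x + opL Φ y := by
  simp only [opL, symL, partialD_add]; ring
theorem opL_sub : opL Φ (x - y) = opL Φ x - opL Φ y := by
  simp only [opL, symL, partialD_sub]; ring
theorem opL_neg : opL Φ (-x) = -opL Φ x := by
  simp only [opL, symL, partialD_neg]; ring
theorem opL_mul : opL Φ (x * y) = opL Φ x * y + x * opL Φ y := by
  simp only [opL, symL, partialD_mul]; ring
theorem opL_ofNat (n : ℕ) [n.AtLeastTwo] : opL Φ ofNat(n) = 0 := by
  simp only [opL, symL, partialD_ofNat]; ring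

theorem opD_bar : opD Φ (bar x) = bar (opDbar Φ x) := by
  simp only [opD, symD, opDbar, symDbar, bar_add, bar_mul, bar_bar, bar_partialD]
theorem opDbar_bar : opDbar Φ (bar x) = bar (opD Φ x) := by
  simp only [opD, symD, opDbar, symDbar, bar_add, bar_mul, bar_partialD]

end Frame

/-- The remaining equations: the constraints, and the equations of the system that are not used to
determine the field. -/
inductive Resid
  | τ1 | τ2 | t4 | t5 | u1 | u2 | u3 | u4 | u6 | b2 | b3 | b4 | u7 | u8 | u9 | c5 | c6 | c7

/-- The residuals of the remaining equations. -/
def resid (Φ : Comp → FSeries) : Resid → FSeries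
  | .τ1 => opD Φ (bar (Φ .e1)) - opDbar Φ (Φ .e1) + bar (Φ .e1) * (Φ .γ3 + bar (Φ .γ4))
      - Φ .e1 * (bar (Φ .γ3) + Φ .γ4)
  | .τ2 => opD Φ (bar (Φ .e2)) - opDbar Φ (Φ .e2) + bar (Φ .e2) * (Φ .γ3 + bar (Φ .γ4))
      - Φ .e2 * (bar (Φ .γ3) + Φ .γ4)
  | .t4 => constraint weight Φ .t4
  | .t5 => constraint weight Φ .t5
  | .u1 => constraint weight Φ .u1
  | .u2 => constraint weight Φ .u2
  | .u3 => constraint weight Φ .u3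
  | .u4 => constraint weight Φ .u4
  | .u6 => constraint weight Φ .u6
  | .u7 => constraint weight Φ .u7
  | .u8 => constraint weight Φ .u8
  | .u9 => constraint weight Φ .u9
  | .c5 => opN Φ (Φ .γ5) - rhs weight Φ .γ5
  | .c6 => opN Φ (Φ .γ6) - rhs weight Φ .γ6
  | .c7 => opN Φ (Φ .γ7) - rhs weight Φ .γ7
  | .b2 => opN Φ (Φ .w2) + opD Φ (Φ .w3) + (2 * Φ .γ1 * Φ .w4 - 3 * Φ .γ3 * Φ .w3
      + 2 * Φ .γ6 * Φ .w2 - 2 * Φ .γ8 * Φ .w2 + 3 * bar (Φ .γ4) * Φ .w3)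
  | .b3 => opN Φ (Φ .w3) + opD Φ (Φ .w4) + (Φ .γ1 * Φ .w5 + 3 * Φ .γ6 * Φ .w3
      + 2 * bar (Φ .γ4) * Φ .w4)
  | .b4 => opN Φ (Φ .w4) + opD Φ (Φ .w5) + (3 * Φ .γ3 * Φ .w5 + 4 * Φ .γ6 * Φ .w4
      + 2 * Φ .γ8 * Φ .w4 + bar (Φ .γ4) * Φ .w5)

/-- The equations that determine the field order by order in `1/u`. -/
structure IsReduced (Φ : Comp → FSeries) : Prop where
  real_e3 : bar (Φ .e3) = Φ .e3
  real_e4 : bar (Φ .e4) = Φ .e4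
  real_e5 : bar (Φ .e5) = Φ .e5
  real_γ2 : bar (Φ .γ2) = Φ .γ2
  real_γ6 : bar (Φ .γ6) = Φ .γ6
  L_e1 : opL Φ (Φ .e1) = rhs weight Φ .e1
  L_e2 : opL Φ (Φ .e2) = rhs weight Φ .e2
  N_e3 : opN Φ (Φ .e3) = rhs weight Φ .e3
  L_e4 : opL Φ (Φ .e4) = rhs weight Φ .e4
  L_e5 : opL Φ (Φ .e5) = rhs weight Φ .e5
  L_γ1 : opL Φ (Φ .γ1) = rhs weight Φ .γ1
  L_γ2 : opL Φ (Φ .γ2) = rhs weight Φ .γ2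
  L_γ3 : opL Φ (Φ .γ3) = rhs weight Φ .γ3
  L_γ4 : opL Φ (Φ .γ4) = rhs weight Φ .γ4
  L_γ8 : opL Φ (Φ .γ8) = rhs weight Φ .γ8
  D_e3 : opD Φ (Φ .e3) = Φ .e3 * (Φ .γ3 - bar (Φ .γ4) - bar (Φ .γ5))
  L_γ6 : constraint weight Φ .u6 + bar (constraint weight Φ .u6) = 0
  L_γ7 : opL Φ (Φ .γ7) = opDbar Φ (Φ .γ5) - Φ .γ2 * Φ .γ7 - Φ .γ4 * Φ .γ5 + Φ .γ5 * Φ .γ5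
      - Φ .γ5 * bar (Φ .γ3) - Φ .γ6 * bar (Φ .γ1)
  N_w1 : opN Φ (Φ .w1) = -opD Φ (Φ .w2) - (3 * Φ .γ1 * Φ .w3 - 6 * Φ .γ3 * Φ .w2
      + Φ .γ6 * Φ .w1 - 4 * Φ .γ8 * Φ .w1 + 4 * bar (Φ .γ4) * Φ .w2)
  L_w2 : opL Φ (Φ .w2) = -opDbar Φ (Φ .w1) - (4 * Φ .γ2 * Φ .w2 + 4 * Φ .γ4 * Φ .w1
      + Φ .γ5 * Φ .w1)
  L_w3 : opL Φ (Φ .w3) = -opDbar Φ (Φ .w2) - (3 * Φ .γ2 * Φ .w3 + 2 * Φ .γ4 * Φ .w2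
      + 2 * Φ .γ5 * Φ .w2 + Φ .γ7 * Φ .w1)
  L_w4 : opL Φ (Φ .w4) = -opDbar Φ (Φ .w3) - (2 * Φ .γ2 * Φ .w4 + 3 * Φ .γ5 * Φ .w3
      + 2 * Φ .γ7 * Φ .w2)
  L_w5 : opL Φ (Φ .w5) = -opDbar Φ (Φ .w4) - (Φ .γ2 * Φ .w5 - 2 * Φ .γ4 * Φ .w4
      + 4 * Φ .γ5 * Φ .w4 + 3 * Φ .γ7 * Φ .w3)

/-! ### Commutators of the frame derivations and first derivatives in terms of the residuals -/

/-- The residuals t₄ and t₅ are precisely the ∂_{ξ¹} and ∂_{ξ²} components of the failure of this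
commutation relation, so the identity holds for every field. The residuals τ₁ and τ₂ play the same
role for D and its conjugate. -/
theorem opDbar_opN (Φ : Comp → FSeries) (x : FSeries) : opDbar Φ (opN Φ x) = opN Φ (opDbar Φ x)
    + (Φ .γ7 * opD Φ x + (Φ .γ6 - bar (Φ .γ8) + Φ .γ8) * opDbar Φ x
      + resid Φ .t4 * partialD .xi1 x + resid Φ .t5 * partialD .xi2 x) := by
  simp only [resid, constraint, opN, symN, opD, symD, opDbar, symDbar, partialD_add, partialD_mul,
    partialD_comm .u .xi1, partialD_comm .u .xi2, partialD_comm .xi2 .xi1]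
  ring

theorem opN_opDbar (Φ : Comp → FSeries) (x : FSeries) : opN Φ (opDbar Φ x) = opDbar Φ (opN Φ x)
    - (Φ .γ7 * opD Φ x + (Φ .γ6 - bar (Φ .γ8) + Φ .γ8) * opDbar Φ x
      + resid Φ .t4 * partialD .xi1 x + resid Φ .t5 * partialD .xi2 x) := by
  rw [opDbar_opN Φ]; ring

theorem opD_opDbar (Φ : Comp → FSeries) (x : FSeries) : opD Φ (opDbar Φ x) = opDbar Φ (opD Φ x)
    + (-(Φ .γ3 + bar (Φ .γ4)) * opDbar Φ x + (bar (Φ .γ3) + Φ .γ4) * opD Φ x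
      + resid Φ .τ1 * partialD .xi1 x + resid Φ .τ2 * partialD .xi2 x) := by
  simp only [resid, opD, symD, opDbar, symDbar, partialD_add, partialD_mul,
    partialD_comm .xi2 .xi1]
  ring

theorem bar_opDbar_e1 (Φ : Comp → FSeries) : bar (opDbar Φ (Φ .e1)) = opDbar Φ (Φ .e1)
    - bar (Φ .e1) * (Φ .γ3 + bar (Φ .γ4)) + Φ .e1 * (bar (Φ .γ3) + Φ .γ4) + resid Φ .τ1 := by
  simp only [resid, opD_bar]; ring

theorem bar_opDbar_e2 (Φ : Comp → FSeries) : bar (opDbar Φ (Φ .e2)) = opDbar Φ (Φ .e2)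
    - bar (Φ .e2) * (Φ .γ3 + bar (Φ .γ4)) + Φ .e2 * (bar (Φ .γ3) + Φ .γ4) + resid Φ .τ2 := by
  simp only [resid, opD_bar]; ring

theorem bar_τ1 (Φ : Comp → FSeries) : bar (resid Φ .τ1) = -resid Φ .τ1 := by
  simp only [resid, opD_bar, bar_add, bar_sub, bar_mul, bar_bar]; ring

theorem bar_τ2 (Φ : Comp → FSeries) : bar (resid Φ .τ2) = -resid Φ .τ2 := by
  simp only [resid, opD_bar, bar_add, bar_sub, bar_mul, bar_bar]; ring

theorem opD_real (Φ : Comp → FSeries) {x : FSeries} (hx : bar x = x) : opD Φ x = bar (opDbar Φ x)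
    := by
  rw [← opD_bar, hx]

theorem opDbar_real (Φ : Comp → FSeries) {x : FSeries} (hx : bar x = x) : opDbar Φ x = bar (opD Φ
    x) := by
  rw [← opDbar_bar, hx]

theorem opD_γ2 (Φ : Comp → FSeries) : opD Φ (Φ .γ2) = opDbar Φ (Φ .γ1) - Φ .w2 + 3 * Φ .γ1 * Φ .γ4
      + Φ .γ1 * bar (Φ .γ3) + Φ .γ2 * Φ .γ3 - Φ .γ2 * bar (Φ .γ4) + resid Φ .u1 := by
  simp only [resid, constraint]; ring

theorem opDbar_γ3 (Φ : Comp → FSeries) : opDbar Φ (Φ .γ3) = -opD Φ (Φ .γ4) + Φ .w3 - 2 * Φ .γ3 * Φ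
    .γ4
      - Φ .γ1 * Φ .γ7 + Φ .γ2 * Φ .γ6 - Φ .γ3 * bar (Φ .γ3) - Φ .γ4 * bar (Φ .γ4)
      + resid Φ .u2 := by
  simp only [resid, constraint]; ring

theorem opN_γ2 (Φ : Comp → FSeries) : opN Φ (Φ .γ2) = -opDbar Φ (Φ .γ3) + bar (opD Φ (Φ .γ4)) + Φ
    .w3
      - 2 * Φ .γ3 * Φ .γ4 + 2 * Φ .γ4 * bar (Φ .γ4) - Φ .γ1 * Φ .γ7 - Φ .γ2 * Φ .γ6
      + Φ .γ2 * Φ .γ8 + Φ .γ2 * bar (Φ .γ8) + resid Φ .u3 := by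
  simp only [resid, constraint, opDbar_bar]; ring

theorem opN_γ1 (Φ : Comp → FSeries) : opN Φ (Φ .γ1) = bar (opDbar Φ (Φ .γ4)) - opD Φ (Φ .γ3) + 3 *
    Φ .γ1 * Φ .γ8
      + 2 * Φ .γ3 * Φ .γ3 - 2 * Φ .γ3 * bar (Φ .γ4) - Φ .γ1 * Φ .γ6
      - Φ .γ1 * bar (Φ .γ8) - Φ .γ2 * bar (Φ .γ7) - resid Φ .u4 := by
  simp only [resid, constraint, opD_bar]; ring

theorem opL_γ6 (Φ : Comp → FSeries) : opL Φ (Φ .γ6) = opD Φ (Φ .γ5) + Φ .w3 - Φ .γ1 * Φ .γ7 - Φ .γ2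
    * Φ .γ6
      + Φ .γ3 * Φ .γ5 + Φ .γ5 * bar (Φ .γ4) + Φ .γ5 * bar (Φ .γ5) + resid Φ .u6 := by
  simp only [resid, constraint]; ring

theorem opN_γ3 (Φ : Comp → FSeries) : opN Φ (Φ .γ3) = opD Φ (Φ .γ8) - 2 * Φ .γ3 * Φ .γ6 + Φ .γ3 * Φ
    .γ8
      - Φ .γ3 * bar (Φ .γ8) + Φ .γ4 * bar (Φ .γ7) + Φ .γ6 * bar (Φ .γ4) - resid Φ .u7 := by
  simp only [resid, constraint]; ring

theorem opN_γ4 (Φ : Comp → FSeries) : opN Φ (Φ .γ4) = -opDbar Φ (Φ .γ8) - Φ .w4 + 2 * Φ .γ3 * Φ .γ7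
      - Φ .γ4 * Φ .γ6 - Φ .γ4 * Φ .γ8 + Φ .γ4 * bar (Φ .γ8) - Φ .γ7 * bar (Φ .γ4)
      + resid Φ .u8 := by
  simp only [resid, constraint]; ring

theorem opDbar_γ6 (Φ : Comp → FSeries) : opDbar Φ (Φ .γ6) = opD Φ (Φ .γ7) - Φ .w4 + 3 * Φ .γ3 * Φ
    .γ7
      + Φ .γ4 * Φ .γ6 - Φ .γ6 * bar (Φ .γ3) + Φ .γ7 * bar (Φ .γ4) - resid Φ .u9 := by
  simp only [resid, constraint]; ring

theorem opN_γ5 (Φ : Comp → FSeries) : opN Φ (Φ .γ5) = rhs weight Φ .γ5 + resid Φ .c5 := by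
  simp only [resid]; ring

theorem opN_γ6 (Φ : Comp → FSeries) : opN Φ (Φ .γ6) = rhs weight Φ .γ6 + resid Φ .c6 := by
  simp only [resid]; ring

theorem opN_γ7 (Φ : Comp → FSeries) : opN Φ (Φ .γ7) = rhs weight Φ .γ7 + resid Φ .c7 := by
  simp only [resid]; ring

theorem opN_w2 (Φ : Comp → FSeries) : opN Φ (Φ .w2) = resid Φ .b2 - opD Φ (Φ .w3) - (2 * Φ .γ1 * Φ
    .w4
      - 3 * Φ .γ3 * Φ .w3 + 2 * Φ .γ6 * Φ .w2 - 2 * Φ .γ8 * Φ .w2 + 3 * bar (Φ .γ4) * Φ .w3) := by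
  simp only [resid]; ring

theorem opN_w3 (Φ : Comp → FSeries) : opN Φ (Φ .w3) = resid Φ .b3 - opD Φ (Φ .w4) - (Φ .γ1 * Φ .w5
      + 3 * Φ .γ6 * Φ .w3 + 2 * bar (Φ .γ4) * Φ .w4) := by
  simp only [resid]; ring

theorem opN_w4 (Φ : Comp → FSeries) : opN Φ (Φ .w4) = resid Φ .b4 - opD Φ (Φ .w5) - (3 * Φ .γ3 * Φ
    .w5
      + 4 * Φ .γ6 * Φ .w4 + 2 * Φ .γ8 * Φ .w4 + bar (Φ .γ4) * Φ .w5) := by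
  simp only [resid]; ring

namespace IsReduced

variable {Φ : Comp → FSeries}

theorem opN_bar (H : IsReduced Φ) (x : FSeries) : opN Φ (bar x) = bar (opN Φ x) := by
  simp only [opN, symN, bar_add, bar_mul, bar_partialD, H.real_e4, H.real_e5]

theorem opL_bar (H : IsReduced Φ) (x : FSeries) : opL Φ (bar x) = bar (opL Φ x) := by
  simp only [opL, symL, bar_mul, bar_partialD, H.real_e3]

/-- The coefficients of the commutator are L e₁, L e₂ and D e₃, all prescribed by the reduced
system, so no residual appears. The same holds for L and N, through L e₄, L e₅ and N e₃. -/
theorem opL_opD (H : IsReduced Φ) (x : FSeries) : opL Φ (opD Φ x) = opD Φ (opL Φ x)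
    + (-Φ .γ2 * opD Φ x - Φ .γ1 * opDbar Φ x
      - (Φ .γ3 - bar (Φ .γ4) - bar (Φ .γ5)) * opL Φ x) := by
  have h1 := H.L_e1
  have h2 := H.L_e2
  have h3 := H.D_e3
  simp only [opL, symL, opD, symD, opDbar, symDbar, partialD_add, partialD_mul, rhs,
    partialD_comm .ub .xi1, partialD_comm .ub .xi2] at h1 h2 h3 ⊢
  linear_combination partialD .xi1 x * h1 + partialD .xi2 x * h2 - partialD .ub x * h3

theorem opL_opDbar (H : IsReduced Φ) (x : FSeries) : opL Φ (opDbar Φ x) = opDbar Φ (opL Φ x)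
    + (-Φ .γ2 * opDbar Φ x - bar (Φ .γ1) * opD Φ x
      - (bar (Φ .γ3) - Φ .γ4 - Φ .γ5) * opL Φ x) := by
  have h := congrArg bar (H.opL_opD (bar x))
  simpa only [opD_bar, opDbar_bar, H.opL_bar, bar_add, bar_sub, bar_mul, bar_neg, bar_bar,
    H.real_γ2] using h

theorem opL_opN (H : IsReduced Φ) (x : FSeries) : opL Φ (opN Φ x) = opN Φ (opL Φ x)
    + ((-Φ .γ4 + Φ .γ5 + bar (Φ .γ3)) * opD Φ x
      + (-bar (Φ .γ4) + bar (Φ .γ5) + Φ .γ3) * opDbar Φ x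
      - (Φ .γ8 + bar (Φ .γ8)) * opL Φ x) := by
  have h1 := H.L_e4
  have h2 := H.L_e5
  have h3 := H.N_e3
  simp only [opL, symL, opN, symN, opD, symD, opDbar, symDbar, partialD_add, partialD_mul, rhs,
    partialD_comm .ub .xi1, partialD_comm .ub .xi2, partialD_comm .ub .u, two_mul_re, bar_add,
    bar_mul, bar_neg, bar_bar] at h1 h2 h3 ⊢
  linear_combination partialD .xi1 x * h1 + partialD .xi2 x * h2 - partialD .ub x * h3

theorem opN_opD (H : IsReduced Φ) (x : FSeries) : opN Φ (opD Φ x) = opD Φ (opN Φ x)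
    - (bar (Φ .γ7) * opDbar Φ x + (Φ .γ6 - Φ .γ8 + bar (Φ .γ8)) * opD Φ x
      + bar (resid Φ .t4) * partialD .xi1 x + bar (resid Φ .t5) * partialD .xi2 x) := by
  have h := congrArg bar (opN_opDbar Φ (bar x))
  simpa only [opD_bar, opDbar_bar, H.opN_bar, bar_add, bar_sub, bar_mul, bar_bar,
    H.real_γ6, bar_partialD] using h

theorem opN_e1 (H : IsReduced Φ) : opN Φ (Φ .e1) = bar (opDbar Φ (Φ .e4) - Φ .e1 * Φ .γ7 - bar (Φ
    .e1) * Φ .γ6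
      + bar (Φ .e1) * bar (Φ .γ8) - bar (Φ .e1) * Φ .γ8 - resid Φ .t4) := by
  simp only [resid, constraint, H.opN_bar, bar_add, bar_sub, bar_mul, bar_bar]; ring

theorem opN_e2 (H : IsReduced Φ) : opN Φ (Φ .e2) = bar (opDbar Φ (Φ .e5) - Φ .e2 * Φ .γ7 - bar (Φ
    .e2) * Φ .γ6
      + bar (Φ .e2) * bar (Φ .γ8) - bar (Φ .e2) * Φ .γ8 - resid Φ .t5) := by
  simp only [resid, constraint, H.opN_bar, bar_add, bar_sub, bar_mul, bar_bar]; ring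

theorem bar_u6 (H : IsReduced Φ) : bar (resid Φ .u6) = -resid Φ .u6 := by
  have h := H.L_γ6
  change resid Φ .u6 + bar (resid Φ .u6) = 0 at h
  linear_combination h

/-- L γ₆ is real because e₃ and γ₆ are; comparing its expression through D γ₅ with the conjugate
fixes the imaginary part of D γ₅ up to the residual u₆. -/
theorem bar_opD_γ5 (H : IsReduced Φ) : bar (opD Φ (Φ .γ5)) = opD Φ (Φ .γ5) + Φ .w3 - Φ .γ1 * Φ .γ7
      - Φ .γ2 * Φ .γ6 + Φ .γ3 * Φ .γ5 + Φ .γ5 * bar (Φ .γ4) + Φ .γ5 * bar (Φ .γ5)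
      + 2 * resid Φ .u6 - bar (Φ .w3 - Φ .γ1 * Φ .γ7 - Φ .γ2 * Φ .γ6
      + Φ .γ3 * Φ .γ5 + Φ .γ5 * bar (Φ .γ4) + Φ .γ5 * bar (Φ .γ5)) := by
  have h := congrArg bar (opL_γ6 Φ)
  rw [← H.opL_bar, H.real_γ6, opL_γ6 Φ] at h
  simp only [bar_add, bar_sub, bar_mul, bar_bar, H.bar_u6] at h ⊢
  linear_combination -h

end IsReduced
end FarField

end

/-! ### Propagation of the residuals along L -/

noncomputable section

namespace FarField

/-- The derivative of a residual along `L`; for two of the residuals, a multiple of it. -/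
def propagated (Φ : Comp → FSeries) : Resid → FSeries
  | .u6 => 2 * Φ .e3 * resid Φ .u6
  | .c5 => resid Φ .c5 * Φ .e3
  | i => opL Φ (resid Φ i)

/-- The right hand sides of the propagation equations of the residuals. -/
def coupling (Φ : Comp → FSeries) : Resid → FSeries
  | .τ1 => Φ .e1 * bar (resid Φ .u1) - bar (Φ .e1) * resid Φ .u1 - 2 * Φ .γ2 * resid Φ .τ1
  | .τ2 => Φ .e2 * bar (resid Φ .u1) - bar (Φ .e2) * resid Φ .u1 - 2 * Φ .γ2 * resid Φ .τ2
  | .t4 => -(Φ .e1 * bar (resid Φ .u4)) + bar (Φ .e1) * resid Φ .u6 + bar (Φ .e1) * resid Φ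
      .u3 - bar (Φ .γ1) * bar (resid Φ .t4) - Φ .γ2 * resid Φ .t4 - bar (Φ .γ3) * resid Φ .τ1
      + Φ .γ4 * resid Φ .τ1 - Φ .γ5 * resid Φ .τ1
  | .t5 => -(Φ .e2 * bar (resid Φ .u4)) + bar (Φ .e2) * resid Φ .u6 + bar (Φ .e2) * resid Φ
      .u3 - bar (Φ .γ1) * bar (resid Φ .t5) - Φ .γ2 * resid Φ .t5 - bar (Φ .γ3) * resid Φ .τ2
      + Φ .γ4 * resid Φ .τ2 - Φ .γ5 * resid Φ .τ2
  | .u1 => Φ .γ1 * bar (resid Φ .u1) - 3 * Φ .γ2 * resid Φ .u1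
  | .u2 => -(Φ .γ2 * resid Φ .u6) - 2 * Φ .γ2 * resid Φ .u2 - Φ .γ3 * bar (resid Φ .u1) - Φ
      .γ4 * resid Φ .u1 + Φ .γ5 * resid Φ .u1
  | .u3 => opL Φ (resid Φ .u2) + Φ .γ1 * bar (resid Φ .u4) + bar (Φ .γ1) * resid Φ .u4 + 2 * Φ
      .γ2 * resid Φ .u2 - 2 * Φ .γ2 * resid Φ .u3 + Φ .γ3 * bar (resid Φ .u1) + bar (Φ .γ3) *
      resid Φ .u1
  | .u4 => -(Φ .γ1 * resid Φ .u6) - Φ .γ1 * resid Φ .u2 + Φ .γ1 * bar (resid Φ .u2) + 2 * Φ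
      .γ1 * resid Φ .u3 - 2 * Φ .γ2 * resid Φ .u4 + Φ .γ3 * resid Φ .u1 - bar (Φ .γ4) * resid
      Φ .u1 + bar (Φ .γ5) * resid Φ .u1
  | .u6 => Φ .e3 * resid Φ .u2 - Φ .e3 * bar (resid Φ .u2) + partialD .xi1 (Φ .e3) * resid Φ
      .τ1 + partialD .xi2 (Φ .e3) * resid Φ .τ2
  | .b2 => -(4 * Φ .γ2 * resid Φ .b2) - Φ .w1 * resid Φ .c5 + 2 * Φ .w2 * resid Φ .u6 + resid
      Φ .t4 * partialD .xi1 (Φ .w1) + resid Φ .t5 * partialD .xi2 (Φ .w1) - resid Φ .τ1 *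
      partialD .xi1 (Φ .w2) - resid Φ .τ2 * partialD .xi2 (Φ .w2) - 3 * Φ .w3 * resid Φ .u1 -
      2 * Φ .w2 * resid Φ .u2 - 4 * Φ .w2 * resid Φ .u3 - 4 * Φ .w1 * resid Φ .u8 - Φ .w1 *
      resid Φ .u9
  | .b3 => -(opDbar Φ (resid Φ .b2)) - 2 * Φ .γ4 * resid Φ .b2 - 2 * Φ .γ5 * resid Φ .b2 - 3 *
      Φ .γ2 * resid Φ .b3 - 2 * Φ .w2 * resid Φ .c5 - Φ .w1 * resid Φ .c7 + 3 * Φ .w3 * resid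
      Φ .u6 + resid Φ .t4 * partialD .xi1 (Φ .w2) + resid Φ .t5 * partialD .xi2 (Φ .w2) -
      resid Φ .τ1 * partialD .xi1 (Φ .w3) - resid Φ .τ2 * partialD .xi2 (Φ .w3) - 2 * Φ .w4 *
      resid Φ .u1 - 3 * Φ .w3 * resid Φ .u3 - 2 * Φ .w2 * resid Φ .u8 - 2 * Φ .w2 * resid Φ
      .u9
  | .b4 => -(opDbar Φ (resid Φ .b3)) - 2 * Φ .γ7 * resid Φ .b2 - 3 * Φ .γ5 * resid Φ .b3 - 2 *
      Φ .γ2 * resid Φ .b4 - 3 * Φ .w3 * resid Φ .c5 - 2 * Φ .w2 * resid Φ .c7 + 4 * Φ .w4 *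
      resid Φ .u6 + resid Φ .t4 * partialD .xi1 (Φ .w3) + resid Φ .t5 * partialD .xi2 (Φ .w3)
      - resid Φ .τ1 * partialD .xi1 (Φ .w4) - resid Φ .τ2 * partialD .xi2 (Φ .w4) - Φ .w5 *
      resid Φ .u1 + 2 * Φ .w4 * resid Φ .u2 - 2 * Φ .w4 * resid Φ .u3 - 3 * Φ .w3 * resid Φ
      .u9
  | .u7 => resid Φ .b2 + Φ .γ1 * resid Φ .c5 - Φ .γ1 * resid Φ .u8 - Φ .γ2 * resid Φ .u7 - 2 *
      Φ .γ3 * resid Φ .u6 - 2 * Φ .γ3 * resid Φ .u2 + Φ .γ3 * bar (resid Φ .u2) + Φ .γ3 *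
      resid Φ .u3 + Φ .γ4 * resid Φ .u4 + bar (Φ .γ4) * resid Φ .u6 + bar (Φ .γ4) * resid Φ
      .u2 - Φ .γ5 * resid Φ .u4 - bar (Φ .γ5) * resid Φ .u2
  | .u8 => Φ .γ2 * resid Φ .c5 - bar (Φ .γ1) * resid Φ .u7 - Φ .γ2 * resid Φ .u8 - Φ .γ3 * bar
      (resid Φ .u4) + bar (Φ .γ3) * resid Φ .u2 - Φ .γ4 * resid Φ .u6 - Φ .γ4 * resid Φ .u2 -
      Φ .γ4 * resid Φ .u3 + Φ .γ5 * resid Φ .u2 + Φ .γ5 * resid Φ .u3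
  | .u9 => -(opDbar Φ (resid Φ .u6)) - 2 * Φ .γ2 * resid Φ .u9 - 3 * Φ .γ5 * resid Φ .u6 - Φ
      .γ5 * resid Φ .u2 - Φ .γ5 * bar (resid Φ .u2) + partialD .xi1 (Φ .γ5) * resid Φ .τ1 +
      partialD .xi2 (Φ .γ5) * resid Φ .τ2 + Φ .γ6 * bar (resid Φ .u1) - Φ .γ7 * resid Φ .u1
  | .c5 => -(Φ .e3 * bar (resid Φ .u7)) - Φ .e3 * resid Φ .u8 + partialD .xi1 (Φ .e3) * resid
      Φ .t4 + partialD .xi2 (Φ .e3) * resid Φ .t5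
  | .c6 => resid Φ .b3 + opD Φ (resid Φ .c5) + opN Φ (resid Φ .u6) + Φ .γ3 * resid Φ .c5 + bar
      (Φ .γ4) * resid Φ .c5 + bar (Φ .γ5) * resid Φ .c5 + Φ .γ5 * bar (resid Φ .c5) - Φ .γ2 *
      resid Φ .c6 - Φ .γ1 * resid Φ .c7 - Φ .γ3 * resid Φ .u9 + bar (Φ .γ4) * resid Φ .u9 - Φ
      .γ5 * resid Φ .u7 + Φ .γ5 * bar (resid Φ .u8) - partialD .xi1 (Φ .γ5) * bar (resid Φ
      .t4) - partialD .xi2 (Φ .γ5) * bar (resid Φ .t5) - bar (Φ .γ5) * resid Φ .u9 + 2 * Φ .γ6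
      * resid Φ .u6 + Φ .γ6 * resid Φ .u2 - Φ .γ6 * bar (resid Φ .u2) - Φ .γ6 * resid Φ .u3 +
      Φ .γ7 * resid Φ .u4
  | .c7 => opDbar Φ (resid Φ .c5) - bar (Φ .γ3) * resid Φ .c5 - Φ .γ4 * resid Φ .c5 + 2 * Φ
      .γ5 * resid Φ .c5 - bar (Φ .γ1) * resid Φ .c6 - Φ .γ2 * resid Φ .c7 + bar (Φ .γ3) *
      resid Φ .u9 - Φ .γ4 * resid Φ .u9 + Φ .γ5 * bar (resid Φ .u7) - Φ .γ5 * resid Φ .u8 + Φ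
      .γ5 * resid Φ .u9 - partialD .xi1 (Φ .γ5) * resid Φ .t4 - partialD .xi2 (Φ .γ5) * resid
      Φ .t5 + Φ .γ6 * bar (resid Φ .u4) - Φ .γ7 * resid Φ .u3

set_option maxHeartbeats 4000000 in
/-- The residuals of the remaining equations satisfy a linear homogeneous system. -/
theorem IsReduced.propagated_eq {Φ : Comp → FSeries} (H : IsReduced Φ) (i : Resid) :
    propagated Φ i = coupling Φ i := by
  have h_τ1 := H.opL_opD (bar (Φ .e1))
  have h_τ2 := H.opL_opD (bar (Φ .e2))
  have h_t4 := H.opL_opN (bar (Φ .e1))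
  have h_t5 := H.opL_opN (bar (Φ .e2))
  have h_u1 := H.opL_opD (Φ .γ2)
  have h_u2 := H.opL_opDbar (Φ .γ3)
  have h_u3 := H.opL_opN (Φ .γ2)
  have h_u4 := H.opL_opN (Φ .γ1)
  -- D e₃ and N e₃ are both prescribed. The integrability conditions for e₃, here and in `h_c5`,
  -- therefore give u₆ and c₅ algebraically, without a derivative along L.
  have h_u6 := opD_opDbar Φ (Φ .e3)
  have h_b2 := H.opL_opN (Φ .w2)
  have h_b3 := H.opL_opN (Φ .w3)
  have h_b4 := H.opL_opN (Φ .w4)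
  have h_u7 := H.opL_opN (Φ .γ3)
  have h_u8 := H.opL_opN (Φ .γ4)
  have h_u9 := H.opL_opDbar (Φ .γ6)
  have h_c5 := opDbar_opN Φ (Φ .e3)
  have h_c6 := H.opL_opN (Φ .γ6)
  have h_c7 := H.opL_opN (Φ .γ7)
  -- Normal form: L is commuted inwards, conjugations are moved out of derivatives, and each
  -- derivative with a known equation is replaced by its right hand side plus a residual. What
  -- remains of each commutator identity is the propagation equation of one residual.
  simp only [opD_add, opD_sub, opD_neg, opD_mul, opD_ofNat, opDbar_add, opDbar_sub, opDbar_neg,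
    opDbar_mul, opDbar_ofNat, opN_add, opN_sub, opN_neg, opN_mul, opN_ofNat, opL_add,
    opL_sub, opL_neg, opL_mul, opL_ofNat, opD_bar, opDbar_bar, H.opN_bar, H.opL_bar,
    bar_add, bar_sub, bar_neg, bar_mul, bar_bar, bar_ofNat, two_mul_re,
    H.opL_opD, H.opL_opDbar, H.opN_opD, opN_opDbar, opD_opDbar, H.real_e3,
    H.real_γ2, H.real_γ6, H.L_e1, H.L_e2, H.N_e3, H.L_e4, H.L_e5,
    H.L_γ1, H.L_γ2, H.L_γ3, H.L_γ4, H.L_γ8, H.D_e3, opL_γ6, H.L_γ7, H.N_w1, H.L_w2, H.L_w3,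
    H.L_w4, H.L_w5, rhs, bar_opDbar_e1, bar_opDbar_e2, H.opN_e1, H.opN_e2, opDbar_real Φ
    H.real_e3, opDbar_real Φ H.real_e4, opDbar_real Φ H.real_e5, opDbar_real Φ H.real_γ2,
    opD_real Φ H.real_γ6, opD_γ2, opDbar_γ3, opN_γ2, opN_γ1, bar_τ1, bar_τ2, H.bar_opD_γ5, opN_γ3,
        opN_γ4, opDbar_γ6, opN_γ5, opN_γ6, opN_γ7, opN_w2, opN_w3, opN_w4]
    at h_τ1 h_τ2 h_t4 h_t5 h_u1 h_u2 h_u3 h_u4 h_u6 h_b2 h_b3 h_b4 h_u7 h_u8 h_u9 h_c5 h_c6 h_c7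
  cases i <;> simp only [propagated, coupling]
  case τ1 => linear_combination h_τ1
  case τ2 => linear_combination h_τ2
  case t4 => linear_combination -h_t4
  case t5 => linear_combination -h_t5
  case u1 => linear_combination h_u1
  case u2 => linear_combination h_u2
  case u3 => linear_combination h_u3
  case u4 => linear_combination -h_u4
  case u6 => linear_combination h_u6
  case b2 => linear_combination h_b2
  case b3 => linear_combination h_b3
  case b4 => linear_combination h_b4
  case u7 => linear_combination -h_u7
  case u8 => linear_combination h_u8
  case u9 => linear_combination -h_u9
  case c5 => linear_combination h_c5
  case c6 => linear_combination h_c6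
  case c7 => linear_combination h_c7

end FarField

end

noncomputable section

namespace FarField

/-! ### The Minkowski field -/

theorem Coef.dir_restrict (v : ℝ × ℝ × ℝ) (g : ℝ × ℝ × ℝ → ℂ) (hg : ContDiff ℝ ∞ g)
    (q : HalfSpace) : dir v (restrict g hg) q = fderiv ℝ g q v := by
  have h : ext0 (restrict g hg) =ᶠ[nhds (q : ℝ × ℝ × ℝ)] g :=
    Filter.eventuallyEq_of_mem (isOpen_halfSpace.mem_nhds q.2) (ext0_congr fun _ => rfl)
  rw [dir_apply, h.fderiv_eq]

/-- The restriction to `ℝ² × (0, ∞)` of a real linear form. -/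
def linearCoef (l : ℝ × ℝ × ℝ →L[ℝ] ℝ) : Coef :=
  Coef.restrict (fun q => ((l q : ℝ) : ℂ)) (Complex.ofRealCLM.contDiff.comp l.contDiff)

theorem dir_linearCoef (v : ℝ × ℝ × ℝ) (l : ℝ × ℝ × ℝ →L[ℝ] ℝ) :
    Coef.dir v (linearCoef l) = algebraMap ℂ Coef (l v) := by
  refine Coef.ext fun q => ?_
  rw [Coef.algebraMap_apply]
  refine (Coef.dir_restrict v _ _ q).trans ?_
  have h : HasFDerivAt (fun q => ((l q : ℝ) : ℂ)) (Complex.ofRealCLM.comp l) (q : ℝ × ℝ × ℝ) :=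
    (Complex.ofRealCLM.comp l).hasFDerivAt
  rw [h.fderiv]
  rfl

theorem conj_linearCoef (l : ℝ × ℝ × ℝ →L[ℝ] ℝ) :
    Coef.conj (linearCoef l) = linearCoef l :=
  Coef.ext fun q => Complex.conj_ofReal (l q)

/-- The coordinate function `ξ¹`, as a series. -/
def xiOne : FSeries := ofCoef (linearCoef (ContinuousLinearMap.fst ℝ ℝ (ℝ × ℝ)))

/-- The coordinate function `ξ²`, as a series. -/
def xiTwo : FSeries := ofCoef (linearCoef
  ((ContinuousLinearMap.fst ℝ ℝ ℝ).comp (ContinuousLinearMap.snd ℝ ℝ (ℝ × ℝ))))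

theorem cst_mul (c d : ℂ) : cst (c * d) = cst c * cst d := by simp [cst, ofCoef]
theorem cst_neg (c : ℂ) : cst (-c) = -cst c := by simp [cst, ofCoef]
theorem cst_one : cst 1 = 1 := by simp [cst, ofCoef]
theorem cst_zero : cst 0 = 0 := by simp [cst, ofCoef]
theorem ofCoef_one : ofCoef 1 = 1 := map_one HahnSeries.C
theorem ofCoef_zero : ofCoef 0 = 0 := map_zero HahnSeries.C

theorem bar_xiOne : bar xiOne = xiOne := by rw [xiOne, bar_ofCoef, conj_linearCoef]
theorem bar_xiTwo : bar xiTwo = xiTwo := by rw [xiTwo, bar_ofCoef, conj_linearCoef]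

theorem partialD_xiOne (μ : Coord) :
    partialD μ xiOne = match μ with | .xi1 => 1 | _ => 0 := by
  cases μ
  case u => exact partialD_ofCoef_u _
  case xi1 => rw [xiOne, partialD_ofCoef_xi1, dir_linearCoef]; simp [ofCoef_one]
  case xi2 => rw [xiOne, partialD_ofCoef_xi2, dir_linearCoef]; simp [ofCoef_zero]
  case ub => rw [xiOne, partialD_ofCoef_ub, dir_linearCoef]; simp [ofCoef_zero]

theorem partialD_xiTwo (μ : Coord) :
    partialD μ xiTwo = match μ with | .xi2 => 1 | _ => 0 := by
  cases μ
  case u => exact partialD_ofCoef_u _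
  case xi1 => rw [xiTwo, partialD_ofCoef_xi1, dir_linearCoef]; simp [ofCoef_zero]
  case xi2 => rw [xiTwo, partialD_ofCoef_xi2, dir_linearCoef]; simp [ofCoef_one]
  case ub => rw [xiTwo, partialD_ofCoef_ub, dir_linearCoef]; simp [ofCoef_zero]

theorem ofCoef_mul (f g : Coef) : ofCoef (f * g) = ofCoef f * ofCoef g := map_mul HahnSeries.C f g
theorem ofCoef_add (f g : Coef) : ofCoef (f + g) = ofCoef f + ofCoef g := map_add HahnSeries.C f g

theorem ofCoef_eFun {a : ℝ} (ha : a ≠ 0) (A : ℝ) : ofCoef (eFun a A) =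
    cst (a / 2) + cst (A ^ 2 / (2 * a)) * (xiOne * xiOne + xiTwo * xiTwo) := by
  rw [xiOne, xiTwo, cst, cst, ← ofCoef_mul, ← ofCoef_mul, ← ofCoef_add, ← ofCoef_mul, ← ofCoef_add]
  congr 1
  refine Coef.ext fun q => ?_
  change ((a / 2 * (1 + A ^ 2 / a ^ 2 * (q.1.1 ^ 2 + q.1.2.1 ^ 2)) : ℝ) : ℂ) =
    (a : ℂ) / 2 + (A : ℂ) ^ 2 / (2 * a) * ((q.1.1 : ℂ) * (q.1.1 : ℂ) + (q.1.2.1 : ℂ) * (q.1.2.1 :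
        ℂ))
  have ha' : (a : ℂ) ≠ 0 := by exact_mod_cast ha
  push_cast
  field_simp

theorem ofCoef_lamFun (a A : ℝ) : ofCoef (lamFun a A) =
    -(cst (A ^ 2 / (2 * a)) * (xiOne + cst Complex.I * xiTwo)) := by
  rw [xiOne, xiTwo, cst, cst, ← ofCoef_mul, ← ofCoef_add, ← ofCoef_mul,
    show ∀ f, -ofCoef f = ofCoef (-f) from fun f => (map_neg HahnSeries.C f).symm]
  congr 1
  refine Coef.ext fun q => ?_
  change -((A : ℂ) ^ 2 / (2 * (a : ℂ))) * ((q.1.1 : ℂ) + Complex.I * (q.1.2.1 : ℂ)) =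
    -((A : ℂ) ^ 2 / (2 * a) * ((q.1.1 : ℂ) + Complex.I * (q.1.2.1 : ℂ)))
  ring

theorem conj_ubFun : Coef.conj ubFun = ubFun := Coef.ext fun q => Complex.conj_ofReal q.1.2.2

theorem dir_ubFun (v : ℝ × ℝ × ℝ) : Coef.dir v ubFun = algebraMap ℂ Coef v.2.2 :=
  dir_linearCoef v ((ContinuousLinearMap.snd ℝ ℝ ℝ).comp (ContinuousLinearMap.snd ℝ ℝ (ℝ × ℝ)))

/-- The tail of the expansion is geometric with ratio p/u, p = 𝔄² u̲, hence satisfies T = p + u⁻¹ p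
T. The reality and the derivatives of 1/ρ then follow from its being an inverse of ρ. -/
theorem rhoInv_mul (A : ℝ) :
    rhoInv A * (cst ((A : ℂ) ^ 2) * ofCoef ubFun - upow 1) = 1 := by
  set p : Coef := algebraMap ℂ Coef ((A : ℂ) ^ 2) * ubFun with hp
  have hP : cst ((A : ℂ) ^ 2) * ofCoef ubFun = ofCoef p := (ofCoef_mul _ _).symm
  set T : FSeries := ofSeq fun k => p ^ (k + 1) with hT
  have hS : sSeries A = -T := by
    rw [sSeries, hT]
    congr 2
    funext k
    rw [hp, mul_pow, ← map_pow, ← pow_mul]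
  have hrec : T = ofCoef p + upow (-1) * (ofCoef p * T) := by
    refine HahnSeries.ext (funext fun n => ?_)
    rw [HahnSeries.coeff_add, coeff_upow_mul, coeff_ofCoef_mul]
    rcases lt_trichotomy n 0 with h | h | h
    · rw [hT, coeff_ofSeq_of_neg _ h, coeff_ofSeq_of_neg _ (by omega), mul_zero, add_zero, ofCoef,
        HahnSeries.C_apply, HahnSeries.coeff_single_of_ne (by omega)]
    · subst h
      rw [hT, coeff_ofSeq_of_neg _ (show (0 : ℤ) + -1 < 0 by omega), mul_zero, add_zero, ofCoef,
        HahnSeries.C_apply, HahnSeries.coeff_single_same]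
      simpa using coeff_ofSeq (fun k => p ^ (k + 1)) 0
    · obtain ⟨m, rfl⟩ : ∃ m : ℕ, n = m + 1 := ⟨(n - 1).toNat, by omega⟩
      rw [show ((m : ℤ) + 1 + -1) = (m : ℕ) by omega, hT, coeff_ofSeq, ofCoef, HahnSeries.C_apply,
        HahnSeries.coeff_single_of_ne (by omega), zero_add, ← pow_succ',
        show ((m : ℤ) + 1) = ((m + 1 : ℕ) : ℤ) by push_cast; rfl, coeff_ofSeq]
  have h1 : upow (-1) * upow 1 = 1 := by rw [upow_mul_upow]; exact upow_zero
  have h2 : upow (-2) = upow (-1) * upow (-1) := by rw [upow_mul_upow]; rfl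
  rw [rhoInv, hS, hP, h2]
  linear_combination (1 + upow (-1) * T) * h1 + upow (-1) * hrec

theorem bar_rhoInv (A : ℝ) : bar (rhoInv A) = rhoInv A := by
  have h := rhoInv_mul A
  have h2 := congrArg bar h
  have hA : star ((A : ℂ) ^ 2) = (A : ℂ) ^ 2 := by
    rw [star_pow]; exact congrArg (· ^ 2) (Complex.conj_ofReal A)
  rw [bar_mul, bar_sub, bar_mul, bar_cst, bar_ofCoef, conj_ubFun, bar_upow, bar_one, hA] at h2
  linear_combination rhoInv A * h2 - bar (rhoInv A) * h

theorem partialD_rhoInv_eq (A : ℝ) (μ : Coord) : partialD μ (rhoInv A) = -(rhoInv A * rhoInv A *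
    (cst ((A : ℂ) ^ 2) * partialD μ (ofCoef ubFun) - partialD μ (upow 1))) := by
  have h := rhoInv_mul A
  have h2 := congrArg (partialD μ) h
  rw [partialD_mul, partialD_sub, partialD_mul, partialD_one, partialD_cst] at h2
  linear_combination rhoInv A * h2 - partialD μ (rhoInv A) * h

theorem partialD_rhoInv (A : ℝ) (μ : Coord) : partialD μ (rhoInv A) =
    match μ with
    | .u => rhoInv A * rhoInv A
    | .ub => -(cst ((A : ℂ) ^ 2) * (rhoInv A * rhoInv A))
    | _ => 0 := by
  rw [partialD_rhoInv_eq]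
  cases μ
  case u => rw [partialD_ofCoef_u, partialD_upow_u]; simp [upow_zero]
  case xi1 =>
    rw [partialD_ofCoef_xi1, partialD_upow_of_ne _ (by simp), dir_ubFun]
    simp only [Complex.ofReal_zero]
    change -(_ * (_ * cst 0 - 0)) = _
    rw [cst_zero]; ring
  case xi2 =>
    rw [partialD_ofCoef_xi2, partialD_upow_of_ne _ (by simp), dir_ubFun]
    simp only [Complex.ofReal_zero]
    change -(_ * (_ * cst 0 - 0)) = _
    rw [cst_zero]; ring
  case ub =>
    rw [partialD_ofCoef_ub, partialD_upow_of_ne _ (by simp), dir_ubFun]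
    simp only [Complex.ofReal_one]
    change -(_ * (_ * cst 1 - 0)) = _
    rw [cst_one]; ring

theorem cst_I_mul_cst_I : cst Complex.I * cst Complex.I = -1 := by
  rw [← cst_mul, Complex.I_mul_I, cst_neg, cst_one]

theorem bar_cst_ofReal (x : ℝ) : bar (cst (x : ℂ)) = cst (x : ℂ) := by
  rw [bar_cst]; exact congrArg cst (Complex.conj_ofReal x)

theorem bar_cst_I : bar (cst Complex.I) = -cst Complex.I := by
  rw [bar_cst, ← cst_neg]; exact congrArg cst Complex.conj_I

/-- The components of the Minkowski field in terms of constants, coordinates and `1/ρ`. -/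
theorem exists_mink_eq {a : ℝ} (ha : a ≠ 0) (A : ℝ) : ∃ h b : FSeries,
    (bar h = h ∧ bar b = b ∧ (∀ μ, partialD μ h = 0) ∧ (∀ μ, partialD μ b = 0) ∧
      (∀ μ, partialD μ (rhoInv A) = match μ with
        | .u => rhoInv A * rhoInv A | .ub => -(4 * h * b * (rhoInv A * rhoInv A)) | _ => 0)) ∧
    mink a A = fun i => match i with
      | .e1 => rhoInv A * (h + b * (xiOne * xiOne + xiTwo * xiTwo))
      | .e2 => cst Complex.I * rhoInv A * (h + b * (xiOne * xiOne + xiTwo * xiTwo))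
      | .e3 => 1
      | .γ2 => rhoInv A * (4 * h * b)
      | .γ3 => -(rhoInv A * (b * (xiOne + cst Complex.I * xiTwo)))
      | .γ4 => -(rhoInv A * (b * (xiOne - cst Complex.I * xiTwo)))
      | .γ6 => -rhoInv A
      | _ => 0 := by
  -- The constants are h = a/2 and b = 𝔄²/(2a). With 4hb = 𝔄² no division is left, and the
  -- verification for the Minkowski field becomes polynomial.
  have h4 : cst ((A : ℂ) ^ 2) = 4 * cst (a / 2) * cst (A ^ 2 / (2 * a)) := by
    have : (4 : FSeries) = cst 4 := by rw [cst, ofCoef, map_ofNat, map_ofNat]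
    have ha' : (a : ℂ) ≠ 0 := by exact_mod_cast ha
    rw [this, ← cst_mul, ← cst_mul]
    congr 1
    field_simp
    ring
  have hb : bar (cst ((A : ℂ) ^ 2 / (2 * a))) = cst ((A : ℂ) ^ 2 / (2 * a)) := by
    have := bar_cst_ofReal (A ^ 2 / (2 * a))
    push_cast at this
    exact this
  refine ⟨cst (a / 2), cst (A ^ 2 / (2 * a)), ⟨by simpa using bar_cst_ofReal (a / 2), hb,
    fun μ => partialD_cst μ _, fun μ => partialD_cst μ _, fun μ => ?_⟩, funext fun i => ?_⟩
  · rw [partialD_rhoInv, h4]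
  · cases i <;> simp only [mink, ofCoef_eFun ha, ofCoef_lamFun, h4, bar_neg, bar_mul, bar_add, hb,
      bar_xiOne, bar_xiTwo, bar_cst_I] <;> ring

set_option maxHeartbeats 2000000 in
theorem isReduced_mink {a : ℝ} (ha : a ≠ 0) (A : ℝ) : IsReduced (mink a A) := by
  obtain ⟨h, b, ⟨hh, hb, dh, db, dr⟩, hm⟩ := exists_mink_eq ha A
  obtain ⟨j, hj, bj, dj⟩ : ∃ j, cst Complex.I = j ∧ bar j = -j ∧ ∀ μ, partialD μ j = 0 :=
    ⟨_, rfl, bar_cst_I, fun μ => partialD_cst μ _⟩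
  have hr := bar_rhoInv A
  rw [hm, hj]
  generalize rhoInv A = r at *
  constructor <;>
  simp only [constraint, rhs, opD, opDbar, opN, opL, symD, symDbar, symN, symL, two_mul_re,
    bar_add, bar_sub, bar_neg, bar_mul, bar_zero, bar_one, bar_ofNat, bar_xiOne,
    bar_xiTwo, bj, hh, hb, hr, partialD_add, partialD_sub, partialD_neg, partialD_mul,
    partialD_zero, partialD_one, partialD_ofNat, dj, partialD_xiOne, partialD_xiTwo, dh,
    db, dr] <;>
  ring

set_option maxHeartbeats 2000000 in
theorem resid_mink {a : ℝ} (ha : a ≠ 0) (A : ℝ) (i : Resid) : resid (mink a A) i = 0 := by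
  obtain ⟨h, b, ⟨hh, hb, dh, db, dr⟩, hm⟩ := exists_mink_eq ha A
  obtain ⟨j, hj, bj, dj⟩ : ∃ j, cst Complex.I = j ∧ bar j = -j ∧ ∀ μ, partialD μ j = 0 :=
    ⟨_, rfl, bar_cst_I, fun μ => partialD_cst μ _⟩
  -- Unlike the reduced system, the residuals need i² = -1, since e₁ and e₂ enter them together.
  have j2 : j ^ 2 = -1 := by rw [pow_two, ← hj, cst_I_mul_cst_I]
  have hr := bar_rhoInv A
  rw [hm, hj]
  generalize rhoInv A = r at *
  cases i <;>
  simp only [resid, constraint, rhs, opD, opDbar, opN, opL, symD, symDbar, symN, symL, two_mul_re,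
    bar_add, bar_sub, bar_neg, bar_mul, bar_zero, bar_xiOne,
    bar_xiTwo, bj, hh, hb, hr, partialD_add, partialD_sub, partialD_neg, partialD_mul,
    partialD_zero, partialD_ofNat, dj, partialD_xiOne, partialD_xiTwo, dh,
    db, dr] <;>
  (ring_nf; try (simp only [j2]; ring))

end FarField

end

noncomputable section

namespace FarField

/-! ### The recursion for the coefficients -/

/-- The operators whose values on the components are prescribed by the reduced system. -/
def evol : Comp → FSeries → FSeries
  | .e3, x => partialD .u x
  | .γ5, x => x
  | .w1, x => partialD .u x + upow (-1) * x
  | _, x => partialD .ub x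

/-- The right hand sides of the reduced system, solved for `evol`. -/
def source (Φ : Comp → FSeries) : Comp → FSeries
  | .e3 => rhs weight Φ .e3 - Φ .e4 * partialD .xi1 (Φ .e3) - Φ .e5 * partialD .xi2 (Φ .e3)
  | .γ5 => Φ .e3 * (bar (Φ .γ3) - Φ .γ4) - opDbar Φ (Φ .e3) - (Φ .e3 - 1) * Φ .γ5
  | .γ6 => re (opD Φ (Φ .γ5) + Φ .w3 - Φ .γ1 * Φ .γ7 - Φ .γ2 * Φ .γ6 + Φ .γ3 * Φ .γ5
      + Φ .γ5 * bar (Φ .γ4) + Φ .γ5 * bar (Φ .γ5)) - (Φ .e3 - 1) * partialD .ub (Φ .γ6)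
  | .γ7 => opDbar Φ (Φ .γ5) - Φ .γ2 * Φ .γ7 - Φ .γ4 * Φ .γ5 + Φ .γ5 * Φ .γ5
      - Φ .γ5 * bar (Φ .γ3) - Φ .γ6 * bar (Φ .γ1) - (Φ .e3 - 1) * partialD .ub (Φ .γ7)
  | .w1 => -(Φ .e4 * partialD .xi1 (Φ .w1)) - Φ .e5 * partialD .xi2 (Φ .w1) - opD Φ (Φ .w2)
      - (3 * Φ .γ1 * Φ .w3 - 6 * Φ .γ3 * Φ .w2 + (Φ .γ6 - upow (-1)) * Φ .w1
        - 4 * Φ .γ8 * Φ .w1 + 4 * bar (Φ .γ4) * Φ .w2)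
  | .w2 => -opDbar Φ (Φ .w1) - (4 * Φ .γ2 * Φ .w2 + 4 * Φ .γ4 * Φ .w1 + Φ .γ5 * Φ .w1)
      - (Φ .e3 - 1) * partialD .ub (Φ .w2)
  | .w3 => -opDbar Φ (Φ .w2) - (3 * Φ .γ2 * Φ .w3 + 2 * Φ .γ4 * Φ .w2 + 2 * Φ .γ5 * Φ .w2
      + Φ .γ7 * Φ .w1) - (Φ .e3 - 1) * partialD .ub (Φ .w3)
  | .w4 => -opDbar Φ (Φ .w3) - (2 * Φ .γ2 * Φ .w4 + 3 * Φ .γ5 * Φ .w3 + 2 * Φ .γ7 * Φ .w2)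
      - (Φ .e3 - 1) * partialD .ub (Φ .w4)
  | .w5 => -opDbar Φ (Φ .w4) - (Φ .γ2 * Φ .w5 - 2 * Φ .γ4 * Φ .w4 + 4 * Φ .γ5 * Φ .w4
      + 3 * Φ .γ7 * Φ .w3) - (Φ .e3 - 1) * partialD .ub (Φ .w5)
  | i => rhs weight Φ i - (Φ .e3 - 1) * partialD .ub (Φ i)

/-- The components that are real. -/
def realComps : List Comp := [.e3, .e4, .e5, .γ2, .γ6]

theorem eq_re_of_add_self {x y : FSeries} (h : x + x = y + bar y) : x = re y := by
  have h2 : cst (1 / 2) * 2 = 1 := by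
    rw [mul_comm, ← cst_one, show (2 : FSeries) = cst 2 by rw [cst, ofCoef, map_ofNat, map_ofNat],
      ← cst_mul]
    norm_num
  rw [re]
  linear_combination cst (1 / 2) * h - x * h2

/-- Each equation is solved for its leading operator, the rest going to the source: e₃ is split as 1
+ (e₃ - 1), and γ₆ in the w₁ equation as 1/u + (γ₆ - 1/u). The γ₅ equation is the conjugate of the
one for D e₃. Reality of γ₆ makes the real part of u₆ an equation for L γ₆. -/
theorem isReduced_iff {Φ : Comp → FSeries} : IsReduced Φ ↔
    (∀ i ∈ realComps, bar (Φ i) = Φ i) ∧ ∀ i, evol i (Φ i) = source Φ i := by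
  constructor
  · intro H
    refine ⟨by simp [realComps, H.real_e3, H.real_e4, H.real_e5, H.real_γ2, H.real_γ6],
      fun i => ?_⟩
    have hd := congrArg bar H.D_e3
    have h6 := H.L_γ6
    have hl := H.opL_bar (Φ .γ6)
    rw [H.real_γ6] at hl
    have key : ∀ {x : FSeries} y, opL Φ x = y → partialD .ub x = y - (Φ .e3 - 1) * partialD .ub x :=
      fun {x} y h => by rw [← h, opL, symL]; ring
    cases i
    case γ6 =>
      simp only [evol, source]
      rw [← eq_re_of_add_self (x := opL Φ (Φ .γ6))]
      · simp only [opL, symL]; ring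
      · simp only [constraint, bar_add, bar_sub, bar_mul, bar_bar, ← hl] at h6 ⊢
        linear_combination h6
    case γ5 =>
      simp only [H.real_e3, bar_sub, bar_mul, bar_bar, evol, source] at hd ⊢
      rw [opDbar_real Φ H.real_e3]
      linear_combination hd
    case w1 =>
      have := H.N_w1
      simp only [opN, symN, evol, source] at this ⊢
      linear_combination this
    case e3 =>
      have := H.N_e3
      simp only [opN, symN, evol, source] at this ⊢
      linear_combination this
    case e1 => exact key _ H.L_e1
    case e2 => exact key _ H.L_e2
    case e4 => exact key _ H.L_e4
    case e5 => exact key _ H.L_e5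
    case γ1 => exact key _ H.L_γ1
    case γ2 => exact key _ H.L_γ2
    case γ3 => exact key _ H.L_γ3
    case γ4 => exact key _ H.L_γ4
    case γ8 => exact key _ H.L_γ8
    case γ7 => exact key _ H.L_γ7
    case w2 => exact key _ H.L_w2
    case w3 => exact key _ H.L_w3
    case w4 => exact key _ H.L_w4
    case w5 => exact key _ H.L_w5
  · rintro ⟨hR, H⟩
    have key : ∀ {x : FSeries} y, partialD .ub x = y - (Φ .e3 - 1) * partialD .ub x → opL Φ x = y :=
      fun {x} y h => by rw [opL, symL]; linear_combination h
    have r3 : bar (Φ .e3) = Φ .e3 := hR _ (by simp [realComps])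
    have r6 : bar (Φ .γ6) = Φ .γ6 := hR _ (by simp [realComps])
    have l6 := key _ (H .γ6)
    refine {
      real_e3 := r3
      real_e4 := hR _ (by simp [realComps])
      real_e5 := hR _ (by simp [realComps])
      real_γ2 := hR _ (by simp [realComps])
      real_γ6 := r6
      L_e1 := key _ (H .e1)
      L_e2 := key _ (H .e2)
      L_e4 := key _ (H .e4)
      L_e5 := key _ (H .e5)
      L_γ1 := key _ (H .γ1)
      L_γ2 := key _ (H .γ2)
      L_γ3 := key _ (H .γ3)
      L_γ4 := key _ (H .γ4)
      L_γ8 := key _ (H .γ8)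
      L_γ7 := key _ (H .γ7)
      L_w2 := key _ (H .w2)
      L_w3 := key _ (H .w3)
      L_w4 := key _ (H .w4)
      L_w5 := key _ (H .w5)
      N_e3 := ?_
      D_e3 := ?_
      L_γ6 := ?_
      N_w1 := ?_ }
    · have := H .e3
      simp only [opN, symN, evol, source] at this ⊢
      linear_combination this
    · have := congrArg bar (H .γ5)
      simp only [evol, source, opDbar_real Φ r3, bar_sub, bar_mul, bar_bar, r3, bar_one] at this
      linear_combination this
    · have hl : bar (opL Φ (Φ .γ6)) = opL Φ (Φ .γ6) := by
        simp only [opL, symL, bar_mul, bar_partialD, r3, r6]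
      have h2 := congrArg (2 * ·) l6
      simp only [two_mul_re, bar_add, bar_sub, bar_mul, bar_bar] at h2
      simp only [constraint, bar_add, bar_sub, bar_mul, bar_bar, hl]
      linear_combination h2
    · have := H .w1
      simp only [opN, symN, evol, source] at this ⊢
      linear_combination this

/-- Both series vanish below order `m`, and they agree modulo the ideal `J` below order `d`. -/
def Close (J : Ideal Coef) (m d : ℤ) (x y : FSeries) : Prop :=
  Below ⊥ m x ∧ Below ⊥ m y ∧ Below J d (x - y)

namespace Close

variable {J : Ideal Coef} {m d m' d' : ℤ} {x y x' y' : FSeries}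

theorem below (h : Close J m d x y) {e : ℤ} (he : e ≤ d) : Below J e (x - y) := h.2.2.mono he

theorem add (h : Close J m d x y) (h' : Close J m' d' x' y') :
    Close J (min m m') (min d d') (x + x') (y + y') :=
  ⟨(h.1.mono (min_le_left _ _)).add (h'.1.mono (min_le_right _ _)),
    (h.2.1.mono (min_le_left _ _)).add (h'.2.1.mono (min_le_right _ _)), by
    rw [add_sub_add_comm]
    exact (h.2.2.mono (min_le_left _ _)).add (h'.2.2.mono (min_le_right _ _))⟩

theorem neg (h : Close J m d x y) : Close J m d (-x) (-y) :=
  ⟨h.1.neg, h.2.1.neg, by rw [← neg_sub']; exact h.2.2.neg⟩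

theorem sub (h : Close J m d x y) (h' : Close J m' d' x' y') :
    Close J (min m m') (min d d') (x - x') (y - y') := by
  rw [sub_eq_add_neg, sub_eq_add_neg]; exact h.add h'.neg

/-- A factor of order m raises by m the order to which the other factor's agreement is visible in
the product. -/
theorem mul (h : Close J m d x y) (h' : Close J m' d' x' y') :
    Close J (m + m') (min (d + m') (m + d')) (x * x') (y * y') :=
  ⟨h.1.mul h'.1, h.2.1.mul h'.2.1, by
    rw [show x * x' - y * y' = (x - y) * x' + y * (x' - y') by ring]
    exact ((h.2.2.mul h'.1).mono (min_le_left _ _)).add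
      ((Below.mul' h.2.1 h'.2.2).mono (min_le_right _ _))⟩

theorem const_mul {c : FSeries} (hc : Below ⊥ 0 c) (h : Close J m d x y) :
    Close J m d (c * x) (c * y) :=
  ⟨(hc.mul h.1).mono (by omega), (hc.mul h.2.1).mono (by omega), by
    rw [← mul_sub]; exact (Below.mul' hc h.2.2).mono (by omega)⟩

theorem ofNat_mul (n : ℕ) [n.AtLeastTwo] (h : Close J m d x y) :
    Close J m d (ofNat(n) * x) (ofNat(n) * y) := h.const_mul (below_bot_ofNat n)

variable {c : ℝ} {hc : 0 < c} (hJ : Coef.IsStable hc J)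

include hJ in
theorem bar (h : Close J m d x y) : Close J m d (bar x) (bar y) :=
  ⟨h.1.bar (Coef.isStable_bot hc).conj, h.2.1.bar (Coef.isStable_bot hc).conj, by
    rw [← bar_sub]; exact h.2.2.bar hJ.conj⟩

include hJ in
theorem partialD (h : Close J m d x y) (μ : Coord) :
    Close J m d (partialD μ x) (partialD μ y) :=
  ⟨h.1.partialD (Coef.isStable_bot hc).dir μ, h.2.1.partialD (Coef.isStable_bot hc).dir μ, by
    rw [← partialD_sub]; exact h.2.2.partialD hJ.dir μ⟩

include hJ in
theorem re (h : Close J m d x y) : Close J m d (re x) (re y) := by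
  have := (h.add (h.bar hJ)).const_mul (below_bot_ofCoef (algebraMap ℂ Coef (1 / 2)))
  rwa [min_self, min_self] at this

end Close

/-- The orders of the components of a far field. -/
def farOrder : Comp → ℤ
  | .e1 => 1 | .e2 => 1 | .e3 => 0 | .e4 => 3 | .e5 => 3
  | .γ1 => 1 | .γ2 => 1 | .γ3 => 1 | .γ4 => 1 | .γ5 => 2 | .γ6 => 1 | .γ7 => 2 | .γ8 => 3
  | .w1 => 1 | .w2 => 2 | .w3 => 3 | .w4 => 4 | .w5 => 4

/-- The order in which the components are determined at each order in `1/u`. -/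
def rank : Comp → ℕ
  | .w1 => 0 | .γ1 => 1 | .e1 => 2 | .e2 => 3 | .γ2 => 4 | .γ4 => 5 | .w2 => 6 | .γ3 => 7
  | .γ6 => 8 | .γ7 => 9 | .γ5 => 10 | .w3 => 11 | .γ8 => 12 | .e4 => 13 | .e5 => 14 | .e3 => 15
  | .w4 => 16 | .w5 => 17

/-- The change of the order under `evol`. -/
def evolShift : Comp → ℤ
  | .e3 => 1 | .w1 => 1 | _ => 0

set_option maxHeartbeats 1000000 in
-- In each term of the source, every component either has smaller rank, and may be known to one
-- order more, or is accompanied by factors that gain the missing order. The bounds `h3` and `h6`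
-- are needed separately: e₃ - 1 and γ₆ - 1/u have order two, while e₃ and γ₆ only have orders zero
-- and one.
theorem source_sub_below {J : Ideal Coef} {c : ℝ} {hc : 0 < c} (hJ : Coef.IsStable hc J)
    {Φ Φ' : Comp → FSeries} {k : ℤ} {i : Comp}
    (h : ∀ j, Close J (farOrder j) (expM j + k + if rank j < rank i then 1 else 0) (Φ j) (Φ' j))
    (h3 : Close J 2 (expM .e3 + k + if rank .e3 < rank i then 1 else 0)
      (Φ .e3 - 1) (Φ' .e3 - 1))
    (h6 : Close J 2 (expM .γ6 + k + if rank .γ6 < rank i then 1 else 0)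
      (Φ .γ6 - upow (-1)) (Φ' .γ6 - upow (-1))) :
    Below J (expM i + evolShift i + k + 1) (source Φ i - source Φ' i) := by
  cases i <;> simp only [source, rhs, opD, opDbar, symD, symDbar, two_mul_re] <;>
  -- The rules for `Close` compute the order of agreement from the shape of the term, leaving one
  -- arithmetic inequality.
  (apply Close.below
   repeat first
     | with_reducible exact h3
     | with_reducible exact h6
     | with_reducible exact h _
     | with_reducible apply Close.add
     | with_reducible apply Close.sub
     | with_reducible apply Close.neg
     | with_reducible apply Close.ofNat_mul
     | with_reducible apply Close.mul
     | with_reducible apply Close.bar hJ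
     | with_reducible apply Close.re hJ
     | with_reducible apply Close.partialD hJ
   simp [expM, rank, farOrder, evolShift] <;> omega)

end FarField

end

/-! ### The recursion as a fixed point problem -/

noncomputable section

namespace FarField

theorem below_bot_rhoInv (A : ℝ) : Below ⊥ 1 (rhoInv A) :=
  (below_bot_upow (-1)).neg.add
    (((below_bot_upow (-2)).mul (below_bot_ofSeq _).neg).mono (by omega))

theorem below_bot_mink (a A : ℝ) (i : Comp) : Below ⊥ (farOrder i) (mink a A i) := by
  have hr := below_bot_rhoInv A
  cases i <;> simp only [mink, farOrder]
  case e1 => exact (hr.mul (below_bot_ofCoef _)).mono (by omega)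
  case e2 => exact (((below_bot_ofCoef _).mul hr).mul (below_bot_ofCoef _)).mono (by omega)
  case e3 => exact below_bot_one
  case γ2 => exact (hr.mul (below_bot_ofCoef _)).mono (by omega)
  case γ3 => exact (hr.mul (below_bot_ofCoef _)).mono (by omega)
  case γ4 => exact (hr.mul (bar_ofCoef (lamFun a A) ▸ below_bot_ofCoef _)).mono (by omega)
  case γ6 => exact hr.neg
  all_goals exact Below.zero

theorem farOrder_le_expM (i : Comp) : farOrder i ≤ expM i := by
  cases i <;> simp [farOrder, expM]

/-- Compatibility at the resonance: the equation for the coefficient k = 0 of w₁ sits in degree 2,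
where `evol` gives zero. The source must vanish there as well for z₁(0) to be free. -/
theorem below_bot_source_w1 {Φ : Comp → FSeries} (h : ∀ j, Below ⊥ (farOrder j) (Φ j))
    (h6 : Below ⊥ 2 (Φ .γ6 - upow (-1))) : Below ⊥ 3 (source Φ .w1) := by
  have hJ := Coef.isStable_bot (one_pos (α := ℝ))
  -- Only the order component of `Close` is of interest here, so the two series are taken equal.
  have hz : ∀ {m x}, Below ⊥ m x → Close ⊥ m 0 x x := fun hx =>
    ⟨hx, hx, by rw [sub_self]; exact Below.zero⟩
  simp only [source, opD, symD]
  have hle : ∀ {m d x}, Close ⊥ m d x x → 3 ≤ m → Below ⊥ 3 x := fun hx hm => hx.1.mono hm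
  apply hle
  repeat first
     | with_reducible exact hz h6
     | with_reducible exact hz (h _)
     | with_reducible apply Close.add
     | with_reducible apply Close.sub
     | with_reducible apply Close.neg
     | with_reducible apply Close.ofNat_mul
     | with_reducible apply Close.mul
     | with_reducible apply Close.bar hJ
     | with_reducible apply Close.partialD hJ
  simp [farOrder]

section Recursion

variable (a A : ℝ) {c : ℝ} (hc : 0 < c)

/-- The field `[𝓜] + u^{-M} [Ψ]` of a sequence of coefficients. -/
abbrev fieldOf (ψ : ℕ → Comp → Coef) : Comp → FSeries := farField a A (toSeries ψ)

theorem fieldOf_zero : fieldOf a A 0 = mink a A := by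
  funext i
  have h : toSeries 0 i = 0 := by
    refine HahnSeries.ext (funext fun n => ?_)
    rcases lt_or_ge n 0 with h | h
    · exact coeff_ofSeq_of_neg _ h
    · obtain ⟨k, rfl⟩ := Int.eq_ofNat_of_zero_le h
      exact coeff_ofSeq _ k
  simp [fieldOf, farField, h]

theorem coeff_fieldOf_sub_mink (ψ : ℕ → Comp → Coef) (i : Comp) (k : ℕ) :
    (fieldOf a A ψ i - mink a A i).coeff (expM i + k) = ψ k i := by
  rw [fieldOf, farField, add_sub_cancel_left, coeff_upow_mul, toSeries,
    show expM i + k + -expM i = (k : ℤ) by ring, coeff_ofSeq]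

theorem below_bot_fieldOf_sub_mink (ψ : ℕ → Comp → Coef) (i : Comp) :
    Below ⊥ (expM i) (fieldOf a A ψ i - mink a A i) := by
  rw [fieldOf, farField, add_sub_cancel_left]
  exact ((below_bot_upow _).mul (below_bot_ofSeq _)).mono (by omega)

variable {a A} in
theorem below_fieldOf_sub {J : Ideal Coef} {ψ ψ' : ℕ → Comp → Coef} {i : Comp} {d : ℤ}
    (h : ∀ k : ℕ, (k : ℤ) < d → ψ k i - ψ' k i ∈ J) :
    Below J (expM i + d) (fieldOf a A ψ i - fieldOf a A ψ' i) := by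
  intro n hn
  rw [show fieldOf a A ψ i - fieldOf a A ψ' i =
    (fieldOf a A ψ i - mink a A i) - (fieldOf a A ψ' i - mink a A i) by ring]
  rcases lt_or_ge n (expM i) with h1 | h1
  · exact ((below_bot_fieldOf_sub_mink a A ψ i).sub
      (below_bot_fieldOf_sub_mink a A ψ' i)).of_bot n h1
  · obtain ⟨k, hk⟩ := Int.eq_ofNat_of_zero_le (sub_nonneg.2 h1)
    obtain rfl : n = expM i + k := by omega
    rw [HahnSeries.coeff_sub, coeff_fieldOf_sub_mink, coeff_fieldOf_sub_mink]
    exact h k (by omega)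

theorem below_bot_fieldOf (ψ : ℕ → Comp → Coef) (i : Comp) :
    Below ⊥ (farOrder i) (fieldOf a A ψ i) := by
  rw [show fieldOf a A ψ i = mink a A i + (fieldOf a A ψ i - mink a A i) by ring]
  exact (below_bot_mink a A i).add
    ((below_bot_fieldOf_sub_mink a A ψ i).mono (farOrder_le_expM i))

theorem below_bot_fieldOf_e3 (ψ : ℕ → Comp → Coef) :
    Below ⊥ 2 (fieldOf a A ψ .e3 - 1) :=
  below_bot_fieldOf_sub_mink a A ψ .e3

/-- The expansion of -1/ρ begins with 1/u, and the exponent M of γ₆ is two. -/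
theorem below_bot_fieldOf_γ6 (ψ : ℕ → Comp → Coef) :
    Below ⊥ 2 (fieldOf a A ψ .γ6 - upow (-1)) := by
  have h := below_bot_fieldOf_sub_mink a A ψ .γ6
  rw [show fieldOf a A ψ .γ6 - upow (-1) = (fieldOf a A ψ .γ6 - mink a A .γ6)
    - upow (-2) * sSeries A by simp only [mink, rhoInv]; ring]
  exact h.sub (((below_bot_upow (-2)).mul (below_bot_ofSeq _).neg).mono (by simp [expM]))

variable {a A hc} in
theorem source_fieldOf_sub {J : Ideal Coef} (hJ : Coef.IsStable hc J) {ψ ψ' : ℕ → Comp → Coef}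
    {k : ℤ} {i : Comp}
    (h : ∀ j, ∀ l : ℕ, (l : ℤ) < k + (if rank j < rank i then 1 else 0) → ψ l j - ψ' l j ∈ J) :
    Below J (expM i + evolShift i + k + 1)
      (source (fieldOf a A ψ) i - source (fieldOf a A ψ') i) := by
  have hd : ∀ j, Below J (expM j + k + if rank j < rank i then 1 else 0)
      (fieldOf a A ψ j - fieldOf a A ψ' j) := fun j => by
    rw [add_assoc]; exact below_fieldOf_sub (h j)
  refine source_sub_below hJ (fun j => ⟨below_bot_fieldOf a A ψ j, below_bot_fieldOf a A ψ' j,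
    hd j⟩) ⟨below_bot_fieldOf_e3 a A ψ, below_bot_fieldOf_e3 a A ψ', ?_⟩
    ⟨below_bot_fieldOf_γ6 a A ψ, below_bot_fieldOf_γ6 a A ψ', ?_⟩
  · rw [sub_sub_sub_cancel_right]; exact hd .e3
  · rw [sub_sub_sub_cancel_right]; exact hd .γ6

/-- The coefficient of index `k` determined by its right hand side. -/
def solveCoeff (D : Coef) (k : ℕ) : Comp → Coef → Coef
  | .e3, f => -((2 + k : ℂ)⁻¹ • f)
  | .γ5, f => f
  -- `evol` multiplies the k-th coefficient of w₁ by -k. For k = 0 the equation says nothing, and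
  -- the value is the one that the γ₁ equation forces on ω₁(0) = D.
  | .w1, f => if k = 0 then -Coef.dir (0, 0, 1) D else -((k : ℂ)⁻¹ • f)
  | _, f => Coef.antideriv hc f

/-- One step of the iteration that determines the coefficients. -/
def iterStep (D : Coef) (ψ : ℕ → Comp → Coef) : ℕ → Comp → Coef := fun k i =>
  solveCoeff hc D k i
    ((source (fieldOf a A ψ) i - source (mink a A) i).coeff (expM i + evolShift i + k))

theorem two_add_cast_ne_zero (k : ℕ) : (2 + k : ℂ) ≠ 0 := by
  exact_mod_cast (by omega : 2 + k ≠ 0)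

variable {hc} in
theorem solveCoeff_sub_mem {J : Ideal Coef} (hJ : Coef.IsStable hc J) {D D' : Coef}
    (hD : D - D' ∈ J) (k : ℕ) (i : Comp) {f f' : Coef} (hf : f - f' ∈ J) :
    solveCoeff hc D k i f - solveCoeff hc D' k i f' ∈ J := by
  have hs : ∀ z : ℂ, -(z • f) - -(z • f') ∈ J := fun z => by
    rw [← neg_sub', ← smul_sub, Algebra.smul_def]
    exact J.neg_mem (J.mul_mem_left _ hf)
  have hI : Coef.antideriv hc f - Coef.antideriv hc f' ∈ J := by
    rw [← Coef.antideriv_sub]; exact hJ.antideriv _ hf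
  cases i <;> simp only [solveCoeff]
  case e3 => exact hs _
  case γ5 => exact hf
  case w1 =>
    split_ifs
    · rw [← neg_sub', ← map_sub]
      exact J.neg_mem (hJ.dir _ hD _)
    · exact hs _
  all_goals exact hI

/-- Two sequences agree modulo the ideal `J` in the first `n` coefficients. -/
def AgreeUpTo (J : Ideal Coef) (n : ℕ) (ψ ψ' : ℕ → Comp → Coef) : Prop :=
  ∀ k i, 18 * k + rank i < n → ψ k i - ψ' k i ∈ J

theorem rank_lt (i : Comp) : rank i < 18 := by cases i <;> simp [rank]

variable {a A hc} in
-- With 18 components, 18 k + rank enumerates the pairs (k, i) lexicographically. By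
-- `source_fieldOf_sub` each new entry uses only entries before it, so a step of the iteration gains
-- one place.
theorem AgreeUpTo.iterStep {J : Ideal Coef} (hJ : Coef.IsStable hc J) {D D' : Coef}
    (hD : D - D' ∈ J) {n : ℕ} {ψ ψ' : ℕ → Comp → Coef} (h : AgreeUpTo J n ψ ψ') :
    AgreeUpTo J (n + 1) (iterStep a A hc D ψ) (iterStep a A hc D' ψ') := by
  intro k i hki
  refine solveCoeff_sub_mem hJ hD k i ?_
  rw [← HahnSeries.coeff_sub, sub_sub_sub_cancel_right]
  refine source_fieldOf_sub hJ (k := k) (fun j l hl => h l j ?_) _ (by omega)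
  have := rank_lt j
  split_ifs at hl <;> omega

variable {a A hc} in
-- Used with the zero ideal for uniqueness, with `Coef.vanishingIdeal` for the support, and with
-- `Coef.segmentIdeal` for finite speed.
theorem sub_mem_of_iterStep_eq {J : Ideal Coef} (hJ : Coef.IsStable hc J) {D D' : Coef}
    (hD : D - D' ∈ J) {ψ ψ' : ℕ → Comp → Coef} (h : iterStep a A hc D ψ = ψ)
    (h' : iterStep a A hc D' ψ' = ψ') (k : ℕ) (i : Comp) : ψ k i - ψ' k i ∈ J := by
  have key : ∀ n, AgreeUpTo J n ψ ψ' := fun n => by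
    induction n with
    | zero => intro k i hk; omega
    | succ n ih =>
      have := AgreeUpTo.iterStep hJ hD ih (a := a) (A := A)
      rwa [h, h'] at this
  exact key _ k i (Nat.lt_succ_self _)

/-- The coefficients of the solution with data `D`. -/
def solution (D : Coef) : ℕ → Comp → Coef := fun k i =>
  (iterStep a A hc D)^[18 * k + rank i + 1] 0 k i

/-- Entries become stationary along the iteration; `solution` collects the stationary values. -/
theorem agreeUpTo_iterate (D : Coef) (n : ℕ) :
    AgreeUpTo ⊥ n ((iterStep a A hc D)^[n] 0) ((iterStep a A hc D)^[n + 1] 0) := by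
  induction n with
  | zero => intro k i hk; omega
  | succ n ih =>
    rw [Function.iterate_succ_apply' _ n, Function.iterate_succ_apply' _ (n + 1)]
    exact AgreeUpTo.iterStep (Coef.isStable_bot hc) (by simp) ih

theorem iterate_eq_solution (D : Coef) {n k : ℕ} {i : Comp} (h : 18 * k + rank i < n) :
    (iterStep a A hc D)^[n] 0 k i = solution a A hc D k i := by
  induction n, h using Nat.le_induction with
  | base => rfl
  | succ n hn ih =>
    rw [← ih]
    exact (sub_eq_zero.1 (Ideal.mem_bot.1 (agreeUpTo_iterate a A hc D n k i hn))).symm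

theorem iterStep_solution (D : Coef) :
    iterStep a A hc D (solution a A hc D) = solution a A hc D := by
  funext k i
  set n := 18 * k + rank i with hn
  have h : AgreeUpTo ⊥ n (solution a A hc D) ((iterStep a A hc D)^[n] 0) := fun l j hl => by
    rw [iterate_eq_solution a A hc D hl, sub_self]; exact Submodule.zero_mem _
  have h2 := AgreeUpTo.iterStep (a := a) (A := A) (Coef.isStable_bot hc) (D := D) (D' := D) (by
      simp) h k i (by omega)
  rw [← Function.iterate_succ_apply' (iterStep a A hc D),
    iterate_eq_solution a A hc D (by omega)] at h2
  exact sub_eq_zero.1 (Ideal.mem_bot.1 h2)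

/-- The Minkowski source subtracted in `iterStep` makes zero the solution for zero data, against
which supports are compared. -/
theorem iterStep_zero : iterStep a A hc 0 0 = 0 := by
  funext k i
  rw [iterStep, fieldOf_zero, sub_self]
  change solveCoeff hc 0 k i 0 = 0
  cases i <;> simp [solveCoeff, Coef.antideriv_zero]

variable {a A hc} in
theorem vanishesBelow_of_iterStep_eq {u₀ : ℝ} (hcu : c < u₀) {D : Coef} (hD : VanishesBelow u₀ D)
    {ψ : ℕ → Comp → Coef} (h : iterStep a A hc D ψ = ψ) (k : ℕ) (i : Comp) :
    VanishesBelow u₀ (ψ k i) := by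
  have := sub_mem_of_iterStep_eq (Coef.isStable_vanishingIdeal hc hcu) (D := D) (D' := 0)
    (by rw [sub_zero]; exact hD) h (iterStep_zero a A hc) k i
  rwa [Pi.zero_apply, Pi.zero_apply, sub_zero] at this

/-- The components that are to be real are real. -/
def IsReal (ψ : ℕ → Comp → Coef) : Prop := ∀ k, ∀ i ∈ realComps, Coef.conj (ψ k i) = ψ k i

theorem bar_mink (i : Comp) (hi : i ∈ realComps) : bar (mink a A i) = mink a A i := by
  have hA : bar (cst ((A : ℂ) ^ 2)) = cst ((A : ℂ) ^ 2) := by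
    have := bar_cst_ofReal (A ^ 2)
    push_cast at this
    exact this
  fin_cases hi <;> simp [mink, bar_zero, bar_one, bar_neg, bar_mul, bar_rhoInv, hA]

variable {a A} in
theorem IsReal.bar_fieldOf {ψ : ℕ → Comp → Coef} (h : IsReal ψ) (i : Comp) (hi : i ∈ realComps) :
    bar (fieldOf a A ψ i) = fieldOf a A ψ i := by
  have hs : bar (toSeries ψ i) = toSeries ψ i := by
    refine HahnSeries.ext (funext fun n => ?_)
    rw [coeff_bar, toSeries]
    rcases lt_or_ge n 0 with h1 | h1
    · rw [coeff_ofSeq_of_neg _ h1, map_zero]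
    · obtain ⟨k, rfl⟩ := Int.eq_ofNat_of_zero_le h1
      rw [coeff_ofSeq]; exact h k i hi
  rw [fieldOf, farField, bar_add, bar_mul, bar_upow, hs, bar_mink a A i hi]

theorem bar_re (x : FSeries) : bar (re x) = re x := by
  rw [re, bar_mul, bar_add, bar_bar, add_comm (bar x)]
  congr 1
  simpa using bar_cst_ofReal (1 / 2)

theorem bar_source {Φ : Comp → FSeries} (h : ∀ i ∈ realComps, bar (Φ i) = Φ i) (i : Comp)
    (hi : i ∈ realComps) : bar (source Φ i) = source Φ i := by
  have h3 := h .e3 (by simp [realComps])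
  have h4 := h .e4 (by simp [realComps])
  have h5 := h .e5 (by simp [realComps])
  have h2 := h .γ2 (by simp [realComps])
  have h6 := h .γ6 (by simp [realComps])
  fin_cases hi <;> simp only [source, rhs, bar_sub, bar_mul, bar_re, bar_ofNat, bar_partialD,
    bar_neg, bar_bar, bar_one, h3, h4, h5, h2, h6]
  ring

theorem conj_smul_ofReal (x : ℝ) (f : Coef) :
    Coef.conj ((x : ℂ) • f) = (x : ℂ) • Coef.conj f := by
  rw [Algebra.smul_def, Algebra.smul_def, map_mul, Coef.conj_algebraMap]
  congr 2
  exact Complex.conj_ofReal x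

variable {a A hc} in
theorem IsReal.iterStep {ψ : ℕ → Comp → Coef} (h : IsReal ψ) (D : Coef) :
    IsReal (iterStep a A hc D ψ) := by
  intro k i hi
  rw [FarField.iterStep]
  have hf : Coef.conj ((source (fieldOf a A ψ) i - source (mink a A) i).coeff
      (expM i + evolShift i + k)) =
      (source (fieldOf a A ψ) i - source (mink a A) i).coeff (expM i + evolShift i + k) := by
    rw [← coeff_bar, bar_sub, bar_source h.bar_fieldOf i hi, bar_source (bar_mink a A) i hi]
  generalize (source (fieldOf a A ψ) i - source (mink a A) i).coeff _ = f at hf ⊢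
  have h2 : ((2 + k : ℂ)⁻¹) = (((2 + k : ℝ)⁻¹ : ℝ) : ℂ) := by push_cast; rfl
  fin_cases hi <;> simp only [solveCoeff, Coef.conj_antideriv, hf, map_neg, h2, conj_smul_ofReal]

theorem isReal_solution (D : Coef) : IsReal (solution a A hc D) := by
  have h : ∀ n, IsReal ((FarField.iterStep a A hc D)^[n] 0) := fun n => by
    induction n with
    | zero => intro k i _; exact map_zero _
    | succ n ih => rw [Function.iterate_succ_apply']; exact ih.iterStep D
  exact fun k i hi => h _ k i hi

theorem evol_sub (i : Comp) (x y : FSeries) : evol i (x - y) = evol i x - evol i y := by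
  cases i <;> simp only [evol, partialD_sub]
  ring

theorem coeff_evol_sub_mink (ψ : ℕ → Comp → Coef) (k : ℕ) (i : Comp) :
    (evol i (fieldOf a A ψ i - mink a A i)).coeff (expM i + evolShift i + k) =
      match i with
      | .e3 => -((2 + k : ℂ) • ψ k .e3)
      | .γ5 => ψ k .γ5
      | .w1 => -((k : ℂ) • ψ k .w1)
      | i => Coef.dir (0, 0, 1) (ψ k i) := by
  have h := coeff_fieldOf_sub_mink a A ψ i k
  have hn : ∀ (n : ℤ) (f : Coef), n • f = (n : ℂ) • f := fun n f =>
    (Int.cast_smul_eq_zsmul ℂ n f).symm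
  generalize fieldOf a A ψ i - mink a A i = x at h ⊢
  cases i <;> simp only [evol, evolShift, add_zero]
  case e3 =>
    rw [coeff_partialD_u, show expM .e3 + 1 + (k : ℤ) - 1 = expM .e3 + k by ring, h, hn]
    simp [expM]
  case γ5 => exact h
  case w1 =>
    rw [HahnSeries.coeff_add, coeff_upow_mul, coeff_partialD_u, ← sub_eq_add_neg,
      show expM .w1 + 1 + (k : ℤ) - 1 = expM .w1 + k by ring, h, hn]
    simp only [expM]
    push_cast; module
  all_goals exact congrArg (Coef.dir (0, 0, 1)) h

theorem below_bot_evol_sub_mink (ψ : ℕ → Comp → Coef) (i : Comp) :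
    Below ⊥ (expM i + evolShift i) (evol i (fieldOf a A ψ i - mink a A i)) := by
  have h := below_bot_fieldOf_sub_mink a A ψ i
  have hs := Coef.isStable_bot (one_pos (α := ℝ))
  cases i <;> simp only [evol, evolShift]
  case e3 => exact h.partialD_u
  case w1 => exact h.partialD_u.add (((below_bot_upow _).mul h).mono (by simp [expM]))
  case γ5 => exact h.mono (by simp)
  all_goals exact (h.partialD hs.dir _).mono (by simp)

variable {a A hc} in
-- Only differences from the Minkowski field are compared, which suffices because that field itself
-- solves the reduced system.
theorem evol_eq_source_of_iterStep_eq (ha : a ≠ 0) {D : Coef} {ψ : ℕ → Comp → Coef}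
    (h : iterStep a A hc D ψ = ψ) (i : Comp) :
    evol i (fieldOf a A ψ i) = source (fieldOf a A ψ) i := by
  have hm := ((isReduced_iff.1 (isReduced_mink ha A)).2 i)
  rw [← sub_left_inj (a := evol i (mink a A i)), ← evol_sub, hm]
  refine HahnSeries.ext (funext fun n => ?_)
  rcases lt_or_ge n (expM i + evolShift i) with hn | hn
  · rw [Ideal.mem_bot.1 (below_bot_evol_sub_mink a A ψ i n hn)]
    -- With k = -1 the hypothesis on earlier coefficients is empty: below the first degree of the
    -- recursion the source is that of the Minkowski field.
    have := source_fieldOf_sub (a := a) (A := A) (Coef.isStable_bot hc) (ψ := ψ) (ψ' := 0)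
      (k := -1) (i := i) fun j l hl => by split_ifs at hl <;> omega
    rw [fieldOf_zero] at this
    exact (Ideal.mem_bot.1 (this n (by omega))).symm
  · obtain ⟨k, hk⟩ := Int.eq_ofNat_of_zero_le (sub_nonneg.2 hn)
    obtain rfl : n = expM i + evolShift i + k := by omega
    have hk := congrFun (congrFun h k) i
    have h0 := below_bot_source_w1 (below_bot_fieldOf a A ψ) (below_bot_fieldOf_γ6 a A ψ)
    have h1 := below_bot_source_w1 (below_bot_mink a A)
      (by simpa only [fieldOf_zero] using below_bot_fieldOf_γ6 a A 0)
    have h2 := h0.sub h1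
    rw [coeff_evol_sub_mink]
    rw [iterStep] at hk
    cases i <;> simp only [solveCoeff] at hk ⊢
    case e3 =>
      rw [← hk, smul_neg, neg_neg, smul_smul, mul_inv_cancel₀ (two_add_cast_ne_zero k), one_smul]
    case γ5 => exact hk.symm
    case w1 =>
      rcases Nat.eq_zero_or_pos k with rfl | hk0
      -- The resonant degree: both sides are zero.
      · rw [Ideal.mem_bot.1 (h2 _ (by simp [expM, evolShift]))]; simp
      · have : (k : ℂ) ≠ 0 := by exact_mod_cast hk0.ne'
        rw [← hk, if_neg hk0.ne', smul_neg, neg_neg, smul_smul, mul_inv_cancel₀ this, one_smul]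
    all_goals rw [← hk, Coef.dir_antideriv]

variable {a A hc} in
theorem iterStep_eq_of_evol_eq_source (ha : a ≠ 0) {u₀ : ℝ} (hcu : c < u₀) {D : Coef}
    {ψ : ℕ → Comp → Coef} (hv : ∀ k i, VanishesBelow u₀ (ψ k i))
    (h : ∀ i, evol i (fieldOf a A ψ i) = source (fieldOf a A ψ) i)
    (hD : ψ 0 .w1 = -Coef.dir (0, 0, 1) D) : iterStep a A hc D ψ = ψ := by
  funext k i
  have hm := ((isReduced_iff.1 (isReduced_mink ha A)).2 i)
  rw [iterStep, ← h, ← hm, ← evol_sub, coeff_evol_sub_mink]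
  cases i <;> simp only [solveCoeff]
  case e3 =>
    rw [smul_neg, neg_neg, smul_smul, inv_mul_cancel₀ (two_add_cast_ne_zero k), one_smul]
  case w1 =>
    rcases Nat.eq_zero_or_pos k with rfl | hk0
    · rw [if_pos rfl, hD]
    · have : (k : ℂ) ≠ 0 := by exact_mod_cast hk0.ne'
      rw [if_neg hk0.ne', smul_neg, neg_neg, smul_smul, inv_mul_cancel₀ this, one_smul]
  -- Vanishing below u₀ > c is what recovers a coefficient from its u̲-derivative.
  all_goals exact Coef.antideriv_dir hc hcu (hv k _)

/-- The lowest order of the equation for `γ₁`. -/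
theorem dir_γ1_eq {ψ : ℕ → Comp → Coef}
    (h : evol .γ1 (fieldOf a A ψ .γ1) = source (fieldOf a A ψ) .γ1) :
    Coef.dir (0, 0, 1) (ψ 0 .γ1) = -ψ 0 .w1 := by
  have hb := below_bot_fieldOf a A ψ
  have hs := Coef.isStable_bot (one_pos (α := ℝ))
  have h1 := congrArg (HahnSeries.coeff · 1) h
  -- Apart from -w₁, every term of the γ₁ source has order at least two.
  have h2 : Below ⊥ 2 (source (fieldOf a A ψ) .γ1 + fieldOf a A ψ .w1) := by
    rw [show source (fieldOf a A ψ) .γ1 + fieldOf a A ψ .w1 =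
      -(2 * (fieldOf a A ψ .γ1 * fieldOf a A ψ .γ2))
        - (fieldOf a A ψ .e3 - 1) * partialD .ub (fieldOf a A ψ .γ1) by
      simp only [source, rhs]; ring]
    exact (((below_bot_ofNat 2).mul ((hb .γ1).mul (hb .γ2))).mono (by simp [farOrder])).neg.sub
      (((below_bot_fieldOf_e3 a A ψ).mul ((hb .γ1).partialD hs.dir _)).mono (by simp [farOrder]))
  have h3 := Ideal.mem_bot.1 (h2 1 (by omega))
  have hγ := coeff_fieldOf_sub_mink a A ψ .γ1 0
  have hw := coeff_fieldOf_sub_mink a A ψ .w1 0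
  simp only [mink, sub_zero, expM, Nat.cast_zero, add_zero] at hγ hw
  rw [HahnSeries.coeff_add, hw] at h3
  rw [← hγ]
  exact h1.trans (eq_neg_of_add_eq_zero_left h3)

end Recursion

end FarField

end

noncomputable section

namespace FarField

/-! ### Vanishing of the residuals -/

/-- All coefficients of the two series agree modulo the ideal `J`. -/
def Cong (J : Ideal Coef) (x y : FSeries) : Prop := ∀ d, Below J d (x - y)

namespace Cong

variable {J : Ideal Coef} {x y x' y' : FSeries}

theorem refl (J : Ideal Coef) (x : FSeries) : Cong J x x := fun _ => by
  rw [sub_self]; exact Below.zero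

theorem neg (h : Cong J x y) : Cong J (-x) (-y) := fun d => by
  rw [← neg_sub']; exact (h d).neg

theorem add (h : Cong J x y) (h' : Cong J x' y') : Cong J (x + x') (y + y') := fun d => by
  rw [add_sub_add_comm]; exact (h d).add (h' d)

theorem sub (h : Cong J x y) (h' : Cong J x' y') : Cong J (x - x') (y - y') := by
  rw [sub_eq_add_neg, sub_eq_add_neg]; exact h.add h'.neg

/-- A Laurent series has finitely many negative degrees, so a factor costs a finite shift, which
agreement to all orders absorbs. -/
theorem mul (h : Cong J x y) (h' : Cong J x' y') : Cong J (x * x') (y * y') := fun d => by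
  obtain ⟨m, hm⟩ := exists_below_bot x'
  obtain ⟨m', hm'⟩ := exists_below_bot y
  rw [show x * x' - y * y' = (x - y) * x' + y * (x' - y') by ring]
  exact (((h (d - m)).mul hm).mono (by omega)).add
    ((Below.mul' hm' (h' (d - m'))).mono (by omega))

variable {c : ℝ} {hc : 0 < c} (hJ : Coef.IsStable hc J)

include hJ in
theorem bar (h : Cong J x y) : Cong J (bar x) (bar y) := fun d => by
  rw [← bar_sub]; exact (h d).bar hJ.conj

include hJ in
theorem partialD (h : Cong J x y) (μ : Coord) : Cong J (partialD μ x) (partialD μ y) := fun d => by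
  rw [← partialD_sub]; exact (h d).partialD hJ.dir μ

end Cong

set_option maxHeartbeats 1000000 in
-- Applied with the ideal of functions vanishing below u₀, it transfers the vanishing of the
-- Minkowski residuals to that region.
theorem resid_cong {J : Ideal Coef} {c : ℝ} {hc : 0 < c} (hJ : Coef.IsStable hc J)
    {Φ Φ' : Comp → FSeries} (h : ∀ j, Cong J (Φ j) (Φ' j)) (i : Resid) :
    Cong J (resid Φ i) (resid Φ' i) := by
  cases i <;> simp only [resid, constraint, rhs, opD, opDbar, opN, opL, symD, symDbar, symN, symL,
    two_mul_re] <;>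
  repeat first
    | with_reducible exact h _
    | with_reducible exact Cong.refl J _
    | with_reducible apply Cong.add
    | with_reducible apply Cong.sub
    | with_reducible apply Cong.neg
    | with_reducible apply Cong.mul
    | with_reducible apply Cong.bar hJ
    | with_reducible apply Cong.partialD hJ

theorem Below.mul_of_le {d m e : ℤ} {x y : FSeries} (hx : Below ⊥ m x) (hy : Below ⊥ e y)
    (h : d ≤ m + e) : Below ⊥ d (x * y) := (hx.mul hy).mono h

theorem Below.ofNat_mul {d : ℤ} {x : FSeries} (n : ℕ) [n.AtLeastTwo] (hx : Below ⊥ d x) :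
    Below ⊥ d (ofNat(n) * x) := (Below.mul' (below_bot_ofNat n) hx).mono (by omega)

set_option maxHeartbeats 1000000 in
theorem below_bot_resid {Φ : Comp → FSeries} (h : ∀ j, Below ⊥ (farOrder j) (Φ j)) (i : Resid) :
    Below ⊥ 0 (resid Φ i) := by
  have hJ := Coef.isStable_bot (one_pos (α := ℝ))
  cases i <;> simp only [resid, constraint, rhs, opD, opDbar, opN, opL, symD, symDbar, symN, symL,
    two_mul_re] <;>
  repeat' first
    | with_reducible exact h _
    | with_reducible apply Below.add
    | with_reducible apply Below.sub
    | with_reducible apply Below.neg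
    | with_reducible apply Below.ofNat_mul
    | with_reducible apply Below.mul_of_le
    | with_reducible apply Below.bar hJ.conj
    | with_reducible apply Below.partialD hJ.dir
    | with_reducible exact (h _).mono (by simp [farOrder])
    | simp [farOrder]

/-- The order in which the residuals are shown to vanish at each order in `1/u`. -/
def residRank : Resid → ℕ
  | .τ1 => 0 | .τ2 => 1 | .t4 => 2 | .t5 => 3 | .u1 => 4 | .u2 => 5 | .u3 => 6 | .u4 => 7
  | .u6 => 8 | .b2 => 9 | .b3 => 10 | .b4 => 11 | .u7 => 12 | .u8 => 13 | .u9 => 14 | .c5 => 15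
  | .c6 => 16 | .c7 => 17

set_option maxHeartbeats 1000000 in
-- Each residual on the right is multiplied by a factor of positive order or has smaller rank. The
-- rank is needed for terms with a factor of order zero, such as L u₂ for u₃, e₃ u₂ for u₆, b₂ for
-- u₇, e₃ u₇ and e₃ u₈ for c₅, and b₃ for c₆.
theorem coupling_below {Φ : Comp → FSeries} (h : ∀ j, Below ⊥ (farOrder j) (Φ j)) {d : ℤ}
    {i : Resid}
    (hR : ∀ j, Below ⊥ (d + if residRank j < residRank i then 1 else 0) (resid Φ j)) :
    Below ⊥ (d + 1) (coupling Φ i) := by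
  have hJ := Coef.isStable_bot (one_pos (α := ℝ))
  cases i <;> simp only [coupling, opD, opDbar, opN, opL, symD, symDbar, symN, symL] <;>
  repeat' first
    | with_reducible exact h _
    | with_reducible exact hR _
    | with_reducible apply Below.add
    | with_reducible apply Below.sub
    | with_reducible apply Below.neg
    | with_reducible apply Below.ofNat_mul
    | with_reducible apply Below.mul_of_le
    | with_reducible apply Below.bar hJ.conj
    | with_reducible apply Below.partialD hJ.dir
    | with_reducible exact (h _).mono (by simp [farOrder])
    | with_reducible exact (hR _).mono (by simp [residRank])
    | simp [farOrder, residRank]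

/-- Since e is 1 up to higher order, it can be divided out. -/
theorem below_of_mul {x e : FSeries} {d : ℤ} (he : Below ⊥ 1 (e - 1)) (hx : Below ⊥ d x)
    (h : Below ⊥ (d + 1) (e * x)) : Below ⊥ (d + 1) x := by
  rw [show x = e * x - (e - 1) * x by ring]
  exact h.sub ((he.mul hx).mono (by omega))

/-- At leading order L is ∂_{u̲}, and a coefficient vanishing below u₀ with zero u̲-derivative is
zero. For u₆ and c₅ no integration is needed. -/
theorem below_succ_of_propagated {Φ : Comp → FSeries} (h3 : Below ⊥ 1 (Φ .e3 - 1)) {u₀ : ℝ}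
    (hu₀ : 0 < u₀) (hv : ∀ i n, VanishesBelow u₀ ((resid Φ i).coeff n)) {d : ℤ} {i : Resid}
    (hR : Below ⊥ d (resid Φ i)) (hp : Below ⊥ (d + 1) (propagated Φ i)) :
    Below ⊥ (d + 1) (resid Φ i) := by
  have key : Below ⊥ (d + 1) (opL Φ (resid Φ i)) → Below ⊥ (d + 1) (resid Φ i) := fun h => by
    have h2 := below_of_mul h3
      (hR.partialD (Coef.isStable_bot (one_pos (α := ℝ))).dir .ub) h
    exact fun n hn => Ideal.mem_bot.2
      (Coef.eq_zero_of_dir_eq_zero hu₀ (hv i n) (Ideal.mem_bot.1 (h2 n hn)))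
  cases i
  case u6 =>
    refine below_of_mul h3 hR ?_
    have h2 : cst (1 / 2) * 2 = 1 := by
      rw [← cst_one, show (2 : FSeries) = cst 2 by rw [cst, ofCoef, map_ofNat, map_ofNat],
        ← cst_mul]
      norm_num
    rw [show Φ .e3 * resid Φ .u6 = cst (1 / 2) * (2 * Φ .e3 * resid Φ .u6) by
      linear_combination -(Φ .e3 * resid Φ .u6) * h2]
    exact (Below.mul' (below_bot_ofCoef _) hp).mono (by omega)
  case c5 =>
    refine below_of_mul h3 hR ?_
    rw [mul_comm]
    exact hp
  all_goals exact key hp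

/-- A double induction: over the order in 1/u, and within one order over the rank of the residual.
-/
theorem resid_eq_zero {Φ : Comp → FSeries} (H : IsReduced Φ)
    (h : ∀ j, Below ⊥ (farOrder j) (Φ j)) (h3 : Below ⊥ 1 (Φ .e3 - 1)) {u₀ : ℝ}
    (hu₀ : 0 < u₀) (hv : ∀ i n, VanishesBelow u₀ ((resid Φ i).coeff n)) (i : Resid) :
    resid Φ i = 0 := by
  have key : ∀ d : ℕ, ∀ i, Below ⊥ (d : ℤ) (resid Φ i) := fun d => by
    induction d with
    | zero => exact below_bot_resid h
    | succ d ih =>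
      have hr : ∀ r, ∀ i, residRank i < r → Below ⊥ ((d : ℤ) + 1) (resid Φ i) := fun r => by
        induction r with
        | zero => intro i hi; omega
        | succ r ihr =>
          intro i hi
          refine below_succ_of_propagated h3 hu₀ hv (ih i) ?_
          rw [H.propagated_eq]
          refine coupling_below h fun j => ?_
          split_ifs with hj
          · exact ihr j (by omega)
          · rw [add_zero]; exact ih j
      intro i
      exact_mod_cast hr _ i (Nat.lt_succ_self _)
  exact eq_zero_of_forall_below fun d => (key d.toNat i).mono (Int.self_le_toNat d)

/-! ### The reduced system and the full system -/

theorem weight_mul_cancel (j : ℕ) {x y : FSeries} (h : weight j * x = weight j * y) : x = y :=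
  upow_mul_cancel _ h

/-- Each of the rows w₂, w₃, w₄ is a weighted sum of a reduced equation along L and a residual
equation along N. -/
theorem Amat_eq_rhs_of_resid {Φ : Comp → FSeries} (H : IsReduced Φ) (hR : ∀ i, resid Φ i = 0) :
    Amat weight Φ (fun j μ => partialD μ (Φ j)) = rhs weight Φ := by
  funext i
  cases i
  case e1 => exact H.L_e1
  case e2 => exact H.L_e2
  case e3 => exact H.N_e3
  case e4 => exact H.L_e4
  case e5 => exact H.L_e5
  case γ1 => exact H.L_γ1
  case γ2 => exact H.L_γ2
  case γ3 => exact H.L_γ3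
  case γ4 => exact H.L_γ4
  case γ8 => exact H.L_γ8
  case γ5 => exact sub_eq_zero.1 (hR .c5)
  case γ6 => exact sub_eq_zero.1 (hR .c6)
  case γ7 => exact sub_eq_zero.1 (hR .c7)
  case w1 =>
    change weight 1 * opN Φ (Φ .w1) + weight 1 * opD Φ (Φ .w2) = _
    rw [H.N_w1, rhs]; ring
  case w2 =>
    change weight 1 * opDbar Φ (Φ .w1) + (weight 1 * opL Φ (Φ .w2) + weight 2 * opN Φ (Φ .w2))
      + weight 2 * opD Φ (Φ .w3) = _
    rw [H.L_w2, opN_w2, hR, rhs]; ring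
  case w3 =>
    change weight 2 * opDbar Φ (Φ .w2) + (weight 2 * opL Φ (Φ .w3) + weight 3 * opN Φ (Φ .w3))
      + weight 3 * opD Φ (Φ .w4) = _
    rw [H.L_w3, opN_w3, hR, rhs]; ring
  case w4 =>
    change weight 3 * opDbar Φ (Φ .w3) + (weight 3 * opL Φ (Φ .w4) + weight 4 * opN Φ (Φ .w4))
      + weight 4 * opD Φ (Φ .w5) = _
    rw [H.L_w4, opN_w4, hR, rhs]; ring
  case w5 =>
    change weight 4 * opDbar Φ (Φ .w4) + weight 4 * opL Φ (Φ .w5) = _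
    rw [H.L_w5, rhs]; ring

theorem constraint_eq_zero_of_resid {Φ : Comp → FSeries} (H : IsReduced Φ)
    (hR : ∀ i, resid Φ i = 0) : constraint weight Φ = 0 := by
  have hi : ∀ x, x - bar x = 0 → -(2 * im x) = 0 := fun x h => by
    rw [im, h, mul_zero, mul_zero, neg_zero]
  funext i
  rw [Pi.zero_apply]
  cases i
  case t1 =>
    refine hi _ ?_
    have := hR .τ1
    simp only [resid, opD_bar, bar_add, bar_mul, bar_bar] at this ⊢
    linear_combination this
  case t2 =>
    refine hi _ ?_
    have := hR .τ2
    simp only [resid, opD_bar, bar_add, bar_mul, bar_bar] at this ⊢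
    linear_combination this
  case t3 => rw [constraint, H.D_e3]; ring
  case t4 => exact hR .t4
  case t5 => exact hR .t5
  case u1 => exact hR .u1
  case u2 => exact hR .u2
  case u3 => exact hR .u3
  case u4 => exact hR .u4
  case u5 => rw [constraint, H.L_γ7]; ring
  case u6 => exact hR .u6
  case u7 => exact hR .u7
  case u8 => exact hR .u8
  case u9 => exact hR .u9
  case v1 => rw [constraint, H.L_w2]; ring
  case v2 => rw [constraint, H.L_w3]; ring
  case v3 => rw [constraint, H.L_w4]; ring

/-- The constraints v₁, v₂, v₃ isolate the L-equations of w₂, w₃, w₄, which the system only contains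
mixed with N-equations. The weights cancel, being powers of u. -/
theorem isReduced_of_Amat_eq_rhs {Φ : Comp → FSeries} (hr : ∀ i ∈ realComps, bar (Φ i) = Φ i)
    (hA : Amat weight Φ (fun j μ => partialD μ (Φ j)) = rhs weight Φ)
    (hC : constraint weight Φ = 0) : IsReduced Φ where
  real_e3 := hr _ (by simp [realComps])
  real_e4 := hr _ (by simp [realComps])
  real_e5 := hr _ (by simp [realComps])
  real_γ2 := hr _ (by simp [realComps])
  real_γ6 := hr _ (by simp [realComps])
  L_e1 := congrFun hA .e1
  L_e2 := congrFun hA .e2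
  N_e3 := congrFun hA .e3
  L_e4 := congrFun hA .e4
  L_e5 := congrFun hA .e5
  L_γ1 := congrFun hA .γ1
  L_γ2 := congrFun hA .γ2
  L_γ3 := congrFun hA .γ3
  L_γ4 := congrFun hA .γ4
  L_γ8 := congrFun hA .γ8
  D_e3 := by
    have h := congrFun hC .t3
    simp only [constraint, Pi.zero_apply] at h
    linear_combination h
  L_γ6 := by rw [hC, Pi.zero_apply, bar_zero, add_zero]
  L_γ7 := by
    have h := congrFun hC .u5
    simp only [constraint, Pi.zero_apply] at h
    linear_combination -h
  N_w1 := weight_mul_cancel 1 (by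
    have h : weight 1 * opN Φ (Φ .w1) + weight 1 * opD Φ (Φ .w2) = rhs weight Φ .w1 :=
      congrFun hA .w1
    rw [rhs] at h
    linear_combination h)
  L_w2 := weight_mul_cancel 1 (by
    have h := congrFun hC .v1
    simp only [constraint, Pi.zero_apply] at h
    linear_combination h)
  L_w3 := weight_mul_cancel 2 (by
    have h := congrFun hC .v2
    simp only [constraint, Pi.zero_apply] at h
    linear_combination h)
  L_w4 := weight_mul_cancel 3 (by
    have h := congrFun hC .v3
    simp only [constraint, Pi.zero_apply] at h
    linear_combination h)
  L_w5 := weight_mul_cancel 4 (by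
    have h : weight 4 * opDbar Φ (Φ .w4) + weight 4 * opL Φ (Φ .w5) = rhs weight Φ .w5 :=
      congrFun hA .w5
    rw [rhs] at h
    linear_combination h)

theorem Amat_add (lam : ℕ → FSeries) (Φ : Comp → FSeries) (X Y : Comp → Coord → FSeries) :
    Amat lam Φ (fun j μ => X j μ + Y j μ) = fun i => Amat lam Φ X i + Amat lam Φ Y i := by
  funext i
  cases i <;> simp only [Amat, symL, symN, symD, symDbar] <;> ring

/-- By the Leibniz rule the far field system is the original system for [Φ], multiplied by the
invertible power u^(E-M). -/
theorem farLHS_eq_farRHS_iff (a A : ℝ) (Ψ : Comp → FSeries) :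
    farLHS a A Ψ = farRHS a A Ψ ↔ Amat weight (farField a A Ψ)
      (fun j μ => partialD μ (farField a A Ψ j)) = rhs weight (farField a A Ψ) := by
  have hX : (fun j μ => partialD μ (farField a A Ψ j)) = fun j μ =>
      (partialD μ (mink a A j) + partialD μ (upow (-expM j)) * Ψ j)
        + upow (-expM j) * partialD μ (Ψ j) := by
    funext j μ
    conv_lhs => rw [farField, partialD_add, partialD_mul]
    ring
  rw [hX, Amat_add, Amat_add weight (farField a A Ψ) (fun j μ => partialD μ (mink a A j))
    (fun j μ => partialD μ (upow (-expM j)) * Ψ j), funext_iff, funext_iff]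
  refine forall_congr' fun i => ?_
  have hu : upow (expE i - expM i) = upow (expE i) * upow (-expM i) := by
    rw [upow_mul_upow, sub_eq_add_neg]
  simp only [farLHS, farRHS]
  rw [hu, ← mul_assoc, ← hu]
  constructor
  · intro h
    have := upow_mul_cancel _ h
    linear_combination this
  · intro h
    congr 1
    linear_combination h

theorem farConstraint_eq_zero_iff (a A : ℝ) (Ψ : Comp → FSeries) :
    farConstraint a A Ψ = 0 ↔ constraint weight (farField a A Ψ) = 0 := by
  rw [funext_iff, funext_iff]
  refine forall_congr' fun i => ?_
  simp only [farConstraint, Pi.zero_apply]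
  exact ⟨fun h => upow_mul_cancel _ (h.trans (mul_zero _).symm), fun h => by rw [h, mul_zero]⟩

/-! ### Formal solutions as fixed points -/

theorem valuedInR_iff {φ : Comp → Coef} :
    ValuedInR φ ↔ ∀ i ∈ realComps, Coef.conj (φ i) = φ i := by
  refine forall_congr' fun i => forall_congr' fun _ => ⟨fun h => ?_, fun h q => ?_⟩
  · exact Coef.ext fun q => Complex.conj_eq_iff_im.2 (h q)
  · exact Complex.conj_eq_iff_im.1 (congrArg (fun f : Coef => f q) h)

variable {a A c : ℝ} (ha : a ≠ 0) (hc : 0 < c) {u₀ : ℝ} {D : Coef}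

include ha in
theorem iterStep_eq_of_isFormalSolution (hcu : c < u₀) {ψ : ℕ → Comp → Coef}
    (h : IsFormalSolution a A u₀ D ψ) : iterStep a A hc D ψ = ψ := by
  have hr : IsReal ψ := fun k => valuedInR_iff.1 (h.valued k)
  have H := isReduced_of_Amat_eq_rhs (hr.bar_fieldOf (a := a) (A := A))
    ((farLHS_eq_farRHS_iff _ _ _).1 h.system) ((farConstraint_eq_zero_iff _ _ _).1 h.constraint)
  have hs := (isReduced_iff.1 H).2
  refine iterStep_eq_of_evol_eq_source ha hcu h.vanish hs ?_
  rw [← h.data, dir_γ1_eq a A (hs .γ1), neg_neg]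

include ha in
theorem isFormalSolution_solution (hcu : c < u₀) (hD : VanishesBelow u₀ D) :
    IsFormalSolution a A u₀ D (solution a A hc D) := by
  have hfix := iterStep_solution a A hc D
  have hreal := isReal_solution a A hc D
  have hv := vanishesBelow_of_iterStep_eq hcu hD hfix
  set ψ := solution a A hc D
  have hs := evol_eq_source_of_iterStep_eq ha hfix
  have H := isReduced_iff.2 ⟨hreal.bar_fieldOf, hs⟩
  have hu₀ : 0 < u₀ := hc.trans hcu
  -- Below u₀ the constructed field coincides with the Minkowski field, so its residuals vanish
  -- there.
  have hcong : ∀ j, Cong (Coef.vanishingIdeal u₀) (fieldOf a A ψ j) (mink a A j) := fun j d => by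
    rw [← fieldOf_zero]
    refine (below_fieldOf_sub (d := d - expM j) fun k _ => ?_).mono (by omega)
    rw [Pi.zero_apply, Pi.zero_apply, sub_zero]
    exact hv k j
  have hvr : ∀ i n, VanishesBelow u₀ ((resid (fieldOf a A ψ) i).coeff n) := fun i n => by
    have := resid_cong (Coef.isStable_vanishingIdeal hc hcu) hcong i (n + 1) n (by omega)
    rwa [resid_mink ha, sub_zero] at this
  have hR := resid_eq_zero H (below_bot_fieldOf a A ψ)
    ((below_bot_fieldOf_e3 a A ψ).mono (by omega)) hu₀ hvr
  refine ⟨fun k => valuedInR_iff.2 (hreal k), (farLHS_eq_farRHS_iff _ _ _).2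
    (Amat_eq_rhs_of_resid H hR), (farConstraint_eq_zero_iff _ _ _).2
    (constraint_eq_zero_of_resid H hR), hv, ?_⟩
  have hw : ψ 0 .w1 = -Coef.dir (0, 0, 1) D := by
    rw [← hfix, iterStep, solveCoeff, if_pos rfl]
  -- z₁(0) was prescribed as -∂_{u̲} D, so ω₁(0) and D have equal u̲-derivatives; both vanish below
  -- u₀.
  have hd : Coef.dir (0, 0, 1) (ψ 0 .γ1 - D) = 0 := by
    rw [map_sub, dir_γ1_eq a A (hs .γ1), hw, neg_neg, sub_self]
  refine sub_eq_zero.1 (Coef.eq_zero_of_dir_eq_zero hu₀ (fun q hq => ?_) hd)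
  rw [Coef.sub_apply, hv 0 .γ1 q hq, hD q hq, sub_zero]

end FarField

end
-- The proposition
theorem mainTheorem5 (a A : ℝ) (ha : a ≠ 0) (hA : A ≠ 0) :
    (∀ u₀ : ℝ, 0 < u₀ → ∀ DATA : FarField.Coef, FarField.VanishesBelow u₀ DATA →
      ∃! Ψ : ℕ → FarField.Comp → FarField.Coef, FarField.IsFormalSolution a A u₀ DATA Ψ) ∧
    (∀ u₀ u₀' : ℝ, 0 < u₀ → 0 < u₀' → ∀ DATA DATA' : FarField.Coef,
      ∀ Ψ Ψ' : ℕ → FarField.Comp → FarField.Coef,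
      FarField.IsFormalSolution a A u₀ DATA Ψ → FarField.IsFormalSolution a A u₀' DATA' Ψ' →
      ∀ q : FarField.HalfSpace, FarField.AgreeAlongSegment DATA DATA' q →
      ∀ (k : ℕ) (i : FarField.Comp), Ψ k i q = Ψ' k i q) := by
  refine ⟨fun u₀ hu₀ DATA hD => ?_, ?_⟩
  -- Any base height of integration strictly between 0 and u₀ would do.
  · have hc : 0 < u₀ / 2 := half_pos hu₀
    have hcu : u₀ / 2 < u₀ := half_lt_self hu₀
    refine ⟨_, FarField.isFormalSolution_solution ha hc hcu hD, fun Ψ h => ?_⟩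
    funext k i
    exact sub_eq_zero.1 (Ideal.mem_bot.1 (FarField.sub_mem_of_iterStep_eq
      (FarField.Coef.isStable_bot hc) (D := DATA) (D' := DATA) (by simp)
      (FarField.iterStep_eq_of_isFormalSolution ha hc hcu h)
      (FarField.iterStep_solution a A hc DATA) k i))
  · intro u₀ u₀' hu₀ hu₀' DATA DATA' Ψ Ψ' h h' q hq k i
    -- Both solutions must be fixed points of iterations with the same base height, so it is chosen
    -- below both thresholds. The data are components of the solutions and hence vanish below the
    -- smaller one.
    have hm : 0 < min u₀ u₀' := lt_min hu₀ hu₀'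
    have hc : 0 < min u₀ u₀' / 2 := half_pos hm
    have hcm : min u₀ u₀' / 2 < min u₀ u₀' := half_lt_self hm
    have hv : FarField.VanishesBelow (min u₀ u₀') DATA := fun p hp => by
      rw [← h.data]; exact h.vanish 0 _ p (hp.trans_le (min_le_left _ _))
    have hv' : FarField.VanishesBelow (min u₀ u₀') DATA' := fun p hp => by
      rw [← h'.data]; exact h'.vanish 0 _ p (hp.trans_le (min_le_right _ _))
    have hmem := FarField.sub_mem_of_iterStep_eq (FarField.Coef.isStable_segmentIdeal hc hcm q)
      (FarField.Coef.sub_mem_segmentIdeal hv hv' hq)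
      (FarField.iterStep_eq_of_isFormalSolution ha hc (hcm.trans_le (min_le_left _ _)) h)
      (FarField.iterStep_eq_of_isFormalSolution ha hc (hcm.trans_le (min_le_right _ _)) h') k i
    have := FarField.Coef.apply_eq_zero_of_mem_segmentIdeal hmem
    exact sub_eq_zero.1 this
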